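/- Let $K$ be a number field of degree $d$ with ring of integers $\mathcal O_K$, let $p$ be a prime number, and put $\mathcal O_{K,p}=\mathcal O_K\otimes\mathbb Z_p\simeq\prod_{\mathfrak p\mid p}\mathcal O_{K,\mathfrak p}$ and $\overline{\mathcal O_{K,p}}=(\mathcal O_K\otimes\mathbb F_p)_{\mathrm{red}}\simeq\prod_{\mathfrak p\mid p}\mathbb F_{\mathfrak p}$. For an $\mathcal O_K$-scheme $X$ and $x\in X(\overline{\mathcal O_{K,p}})$, let $X(\mathcal O_{K,p})_x$ be the residue disk of $x$, i.e. the set of points of $X(\mathcal O_{K,p})$ that reduce to $x$; write $x_{\mathfrak p}\in X(\mathbb F_{\mathfrak p})$ for the components of $x$. Fix a uniformizer $\pi_{\mathfrak p}$ of each $\mathcal O_{K,\mathfrak p}$, $\mathfrak p\mid p$. If $X$ is smooth over $\mathcal O_K$, local parameters of $X$ at $x$ are, for every $\mathfrak p\mid p$, elements $t_{\mathfrak p,1},\dots,t_{\mathfrak p,m_{\mathfrak p}}$ of the local ring of $X_{\mathcal O_{K,\mathfrak p}}$ at $x_{\mathfrak p}$ such that $\pi_{\mathfrak p},t_{\mathfrak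 p,1},\dots,t_{\mathfrak p,m_{\mathfrak p}}$ is a regular system of parameters. They define a map $\tilde x\mapsto(t_{\mathfrak p,i}(\tilde x)/\pi_{\mathfrak p})_{\mathfrak p,i}$ from $X(\mathcal O_{K,p})_x$ to $\prod_{\mathfrak p\mid p}\mathcal O_{K,\mathfrak p}^{m_{\mathfrak p}}$. Restricting scalars means taking coordinates of the result with respect to chosen $\mathbb Z_p$-bases of the rings $\mathcal O_{K,\mathfrak p}$. A convergent power series over $\mathbb Z_p$ is a power series in finitely many variables with coefficients in $\mathbb Z_p$ that tend to $0$. (1) Let $X$ and $Y$ be smooth $\mathcal O_K$-schemes of relative dimensions $m$ and $n$, let $f\colon X\to Y$ be a morphism of $\mathcal O_K$-schemes, and let $x\in X(\overline{\mathcal O_{K,p}})$. Any choice of local parameters of $X$ at $x$ and of $Y$ at $f(x)$, followed by restriction of scalars, induces bijections $X(\mathcal O_{K,p})_x\simeq\mathbb Z_p^{dm}$ and $Y(\mathcal O_{K,p})_{f(x)}\simeq\mathbb Z_p^{dn}$, and the composition $$\mathbb Z_p^{dm}\simeq X(\mathcal O_{K,p})_x\xrightarrow{\ f\ }Y(\mathcal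 O_{K,p})_{f(x)}\simeq\mathbb Z_p^{dn}$$ is given by convergent power series over $\mathbb Z_p$. (2) Assume that the ramification indices satisfy $e(\mathfrak p/p)<p-1$ for all $\mathfrak p\mid p$. Let $Y$ be a smooth $\mathcal O_K$-scheme, $G\to Y$ a smooth group scheme with identity section $e$, and $y\in Y(\overline{\mathcal O_{K,p}})$. For $\sigma\in Y(\mathcal O_{K,p})_y$, the fibre of $G(\mathcal O_{K,p})_{e(y)}\to Y(\mathcal O_{K,p})_y$ over $\sigma$ is a group $H_\sigma$, namely the kernel of reduction on the group of points of $G$ over $\sigma$. The map $$\mathbb Z\times G(\mathcal O_{K,p})_{e(y)}\to G(\mathcal O_{K,p})_{e(y)},\qquad (z,g)\mapsto z\cdot g,$$ where $z\cdot g$ is the $z$-th multiple (power) of $g$ in its fibre, extends to a map $A\colon\mathbb Z_p\times G(\mathcal O_{K,p})_{e(y)}\to G(\mathcal O_{K,p})_{e(y)}$ with the following properties. (a) $A$ preserves each fibre $H_\sigma$, and there (writing the group law additively) $(a+b)g=ag+bg$, $(ab)g=a(bg)$, and $a(g+h)=ag+ah$ whenever $g$ and $h$ commute; in particular, if $G$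 is commutative, $A$ is a $\mathbb Z_p$-module structure on each $H_\sigma$. It is the natural one: if $a\equiv a'\pmod{p^j}$, then $ag$ and $a'g$ have the same image in $G(\mathcal O_{K,p}/p^j)$. (b) For any local parameters $s_{\mathfrak p,1},\dots,s_{\mathfrak p,n_{\mathfrak p}}$ of $Y$ at $y$, any elements $t_{\mathfrak p,1},\dots,t_{\mathfrak p,m_{\mathfrak p}}$ (for each $\mathfrak p\mid p$) of the kernel $I_{\mathfrak p}$ of the map induced by $e$ from the local ring of $G_{\mathcal O_{K,\mathfrak p}}$ at $e(y_{\mathfrak p})$ to that of $Y_{\mathcal O_{K,\mathfrak p}}$ at $y_{\mathfrak p}$ that form a basis of $I_{\mathfrak p}/I_{\mathfrak p}^2$, and any $\mathbb Z_p$-bases of the $\mathcal O_{K,\mathfrak p}$, the functions $s_{\mathfrak p,i}/\pi_{\mathfrak p}$ and $t_{\mathfrak p,i}/\pi_{\mathfrak p}$ followed by restriction of scalars give a bijection $G(\mathcal O_{K,p})_{e(y)}\simeq\mathbb Z_p^{N}$, where $N=\sum_{\mathfrak p\mid p}[K_{\mathfrak p}:\mathbb Q_p](n_{\mathfrak p}+m_{\mathfrak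 p})$, under which $A$ becomes a map $\mathbb Z_p\times\mathbb Z_p^N\to\mathbb Z_p^N$ given by convergent power series over $\mathbb Z_p$. -/

import Mathlib

open CategoryTheory CategoryTheory.Limits AlgebraicGeometry
open scoped NumberField TensorProduct MonObj

universe u

set_option linter.unusedSectionVars false

noncomputable section

namespace ResidueDisk

/-! ### Points of schemes with values in algebras -/

section Generic

variable {S : Type u} [CommRing S]

/-- `Spec A` as a scheme over `Spec S`, for a ring homomorphism `φ : S → A`. For an `S`-scheme `X`,
the set `X(A)` of `A`-points is `specOver φ ⟶ X`. -/
abbrev specOver {A : Type u} [CommRing A] (φ : S →+* A) : Over (Spec (CommRingCat.of S)) :=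
  Over.mk (Spec.map (CommRingCat.ofHom φ))

/-- The morphism `Spec B ⟶ Spec A` of `S`-schemes given by `ψ : A → B`. Precomposition with it is
the map `X(A) → X(B)`. -/
def specOverMap {A B : Type u} [CommRing A] [CommRing B] (φ : S →+* A) (ψ : A →+* B) :
    specOver (ψ.comp φ) ⟶ specOver φ :=
  Over.homMk (Spec.map (CommRingCat.ofHom ψ)) (by
    simp [← Spec.map_comp, ← CommRingCat.ofHom_comp])

variable {A : Type u} [CommRing A]

/-- The base change `X_A = X ×_S A`. -/
abbrev baseChange (X : Over (Spec (CommRingCat.of S))) (φ : S →+* A) : Scheme.{u} :=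
  pullback X.hom (Spec.map (CommRingCat.ofHom φ))

/-- The morphism `X_A ⟶ Y_A` induced by a morphism `X ⟶ Y` of `S`-schemes. -/
def baseChangeMap {X Y : Over (Spec (CommRingCat.of S))} (f : X ⟶ Y) (φ : S →+* A) :
    baseChange X φ ⟶ baseChange Y φ :=
  pullback.lift (pullback.fst _ _ ≫ f.left) (pullback.snd _ _) (by
    rw [Category.assoc, Over.w f, pullback.condition])

/-- For `ψ : A → B`, a `B`-point of `X` as a morphism `Spec B ⟶ X_A`
over `Spec B ⟶ Spec A`. -/
def liftPoint {X : Over (Spec (CommRingCat.of S))} {B : Type u} [CommRing B] (φ : S →+* A)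
    (ψ : A →+* B) (x : specOver (ψ.comp φ) ⟶ X) : Spec (CommRingCat.of B) ⟶ baseChange X φ :=
  pullback.lift x.left (Spec.map (CommRingCat.ofHom ψ)) (by
    rw [Over.w x]; simp [← Spec.map_comp, ← CommRingCat.ofHom_comp])

lemma liftPoint_fst {X : Over (Spec (CommRingCat.of S))} {B : Type u} [CommRing B] (φ : S →+* A)
    (ψ : A →+* B) (x : specOver (ψ.comp φ) ⟶ X) :
    liftPoint φ ψ x ≫ pullback.fst X.hom (Spec.map (CommRingCat.ofHom φ)) = x.left :=
  pullback.lift_fst _ _ _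

lemma liftPoint_snd {X : Over (Spec (CommRingCat.of S))} {B : Type u} [CommRing B] (φ : S →+* A)
    (ψ : A →+* B) (x : specOver (ψ.comp φ) ⟶ X) :
    liftPoint φ ψ x ≫ pullback.snd X.hom (Spec.map (CommRingCat.ofHom φ)) =
      Spec.map (CommRingCat.ofHom ψ) :=
  pullback.lift_snd _ _ _

lemma baseChangeMap_fst {X Y : Over (Spec (CommRingCat.of S))} (f : X ⟶ Y) (φ : S →+* A) :
    baseChangeMap f φ ≫ pullback.fst Y.hom (Spec.map (CommRingCat.ofHom φ)) =
      pullback.fst X.hom (Spec.map (CommRingCat.ofHom φ)) ≫ f.left :=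
  pullback.lift_fst _ _ _

lemma baseChangeMap_snd {X Y : Over (Spec (CommRingCat.of S))} (f : X ⟶ Y) (φ : S →+* A) :
    baseChangeMap f φ ≫ pullback.snd Y.hom (Spec.map (CommRingCat.ofHom φ)) =
      pullback.snd X.hom (Spec.map (CommRingCat.ofHom φ)) :=
  pullback.lift_snd _ _ _

lemma liftPoint_comp {X Y : Over (Spec (CommRingCat.of S))} {B : Type u} [CommRing B]
    (φ : S →+* A) (ψ : A →+* B) (x : specOver (ψ.comp φ) ⟶ X) (f : X ⟶ Y) :
    liftPoint φ ψ (x ≫ f) = liftPoint φ ψ x ≫ baseChangeMap f φ := by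
  apply pullback.hom_ext
  · rw [liftPoint_fst, Category.assoc, baseChangeMap_fst, ← Category.assoc, liftPoint_fst]
    rfl
  · rw [liftPoint_snd, Category.assoc, baseChangeMap_snd, liftPoint_snd]

variable [IsLocalRing A]

/-- The point of `X_A` defined by a point of `X` with values in the residue field of `A`. -/
def residuePt {X : Over (Spec (CommRingCat.of S))} (φ : S →+* A)
    (x : specOver ((IsLocalRing.residue A).comp φ) ⟶ X) : baseChange X φ :=
  liftPoint φ (IsLocalRing.residue A) x (IsLocalRing.closedPoint (IsLocalRing.ResidueField A))

lemma residuePt_comp {X Y : Over (Spec (CommRingCat.of S))} (φ : S →+* A)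
    (x : specOver ((IsLocalRing.residue A).comp φ) ⟶ X) (f : X ⟶ Y) :
    residuePt φ (x ≫ f) = baseChangeMap f φ (residuePt φ x) := by
  have h := Scheme.Hom.comp_apply (liftPoint φ (IsLocalRing.residue A) x) (baseChangeMap f φ)
    (IsLocalRing.closedPoint (IsLocalRing.ResidueField A))
  rw [← liftPoint_comp] at h
  exact h

/-- The local ring of `X_A` at the point defined by `x`. -/
abbrev localRing {X : Over (Spec (CommRingCat.of S))} (φ : S →+* A)
    (x : specOver ((IsLocalRing.residue A).comp φ) ⟶ X) : CommRingCat.{u} :=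
  (baseChange X φ).presheaf.stalk (residuePt φ x)

/-- The structure homomorphism from `A` to the local ring of `X_A` at `x`. -/
def structureMap {X : Over (Spec (CommRingCat.of S))} (φ : S →+* A)
    (x : specOver ((IsLocalRing.residue A).comp φ) ⟶ X) : A →+* localRing φ x :=
  ((Scheme.ΓSpecIso (CommRingCat.of A)).inv ≫
    (pullback.snd X.hom (Spec.map (CommRingCat.ofHom φ))).appTop ≫
    (baseChange X φ).presheaf.germ ⊤ (residuePt φ x) (TopologicalSpace.Opens.mem_top _)).hom

/-- The comorphism on local rings of the base change of a morphism `f : X ⟶ Y` of `S`-schemes. -/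
def localRingMap {X Y : Over (Spec (CommRingCat.of S))} (φ : S →+* A)
    (x : specOver ((IsLocalRing.residue A).comp φ) ⟶ X) (f : X ⟶ Y) :
    localRing φ (x ≫ f) →+* localRing φ x :=
  ((baseChange Y φ).presheaf.stalkSpecializes
      (specializes_of_eq (residuePt_comp φ x f).symm) ≫
    (baseChangeMap f φ).stalkMap (residuePt φ x)).hom

lemma liftPoint_closedPoint {X : Over (Spec (CommRingCat.of S))} (φ : S →+* A)
    (x : specOver ((IsLocalRing.residue A).comp φ) ⟶ X) (σ : specOver φ ⟶ X)
    (h : specOverMap φ (IsLocalRing.residue A) ≫ σ = x) :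
    liftPoint φ (RingHom.id A) σ (IsLocalRing.closedPoint A) = residuePt φ x := by
  subst h
  have h1 : liftPoint φ (IsLocalRing.residue A) (specOverMap φ (IsLocalRing.residue A) ≫ σ) =
      Spec.map (CommRingCat.ofHom (IsLocalRing.residue A)) ≫ liftPoint φ (RingHom.id A) σ := by
    apply pullback.hom_ext
    · rw [liftPoint_fst, Category.assoc, liftPoint_fst]
      rfl
    · rw [liftPoint_snd, Category.assoc, liftPoint_snd, ← Spec.map_comp, ← CommRingCat.ofHom_comp]
  have h2 : Spec.map (CommRingCat.ofHom (IsLocalRing.residue A))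
      (IsLocalRing.closedPoint (IsLocalRing.ResidueField A)) = IsLocalRing.closedPoint A :=
    IsLocalRing.comap_closedPoint (IsLocalRing.residue A)
  have h3 := Scheme.Hom.comp_apply (Spec.map (CommRingCat.ofHom (IsLocalRing.residue A)))
    (liftPoint φ (RingHom.id A) σ) (IsLocalRing.closedPoint (IsLocalRing.ResidueField A))
  rw [← h1] at h3
  exact (h3.trans (congrArg _ h2)).symm

/-- The value `t ↦ t(σ)`, from the local ring of `X_A` at `x` to `A`, at an `A`-point `σ` of `X`
that reduces to `x`. -/
def evalAt {X : Over (Spec (CommRingCat.of S))} (φ : S →+* A)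
    (x : specOver ((IsLocalRing.residue A).comp φ) ⟶ X) (σ : specOver φ ⟶ X)
    (h : specOverMap φ (IsLocalRing.residue A) ≫ σ = x) : localRing φ x →+* A :=
  ((baseChange X φ).presheaf.stalkSpecializes
      (specializes_of_eq (liftPoint_closedPoint φ x σ h)) ≫
    Scheme.stalkClosedPointTo (liftPoint φ (RingHom.id A) σ)).hom

end Generic

/-! ### The rings attached to a number field and a prime number -/

section Rings

variable (p : ℕ) [Fact p.Prime] (K : Type u) [Field K] [NumberField K]

/-- `𝒪_{K,p} = ℤ_p ⊗ 𝒪_K`. -/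
abbrev OKp : Type u := ℤ_[p] ⊗[ℤ] 𝓞 K

/-- The homomorphism `𝒪_K → 𝒪_{K,p}`. -/
def toOKp : 𝓞 K →+* OKp p K := Algebra.TensorProduct.includeRight.toRingHom

/-- `(𝒪_K ⊗ 𝔽_p)_red`, as the quotient of `𝒪_{K,p}` by the radical of the ideal `(p)`. -/
def ResRing : Type u := OKp p K ⧸ (Ideal.span {(p : OKp p K)}).radical

instance : CommRing (ResRing p K) :=
  inferInstanceAs (CommRing (OKp p K ⧸ (Ideal.span {(p : OKp p K)}).radical))

/-- The reduction homomorphism `𝒪_{K,p} → (𝒪_K ⊗ 𝔽_p)_red`. -/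
def red : OKp p K →+* ResRing p K := Ideal.Quotient.mk (Ideal.span {(p : OKp p K)}).radical

/-- `𝒪_{K,p} / p^j`. -/
def ModPow (j : ℕ) : Type u := OKp p K ⧸ Ideal.span {(p : OKp p K) ^ j}

instance (j : ℕ) : CommRing (ModPow p K j) :=
  inferInstanceAs (CommRing (OKp p K ⧸ Ideal.span {(p : OKp p K) ^ j}))

/-- The reduction homomorphism `𝒪_{K,p} → 𝒪_{K,p} / p^j`. -/
def modPow (j : ℕ) : OKp p K →+* ModPow p K j := Ideal.Quotient.mk (Ideal.span {(p : OKp p K) ^ j})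

variable {p K}

instance (v : MaximalSpectrum (OKp p K)) : v.asIdeal.IsPrime := v.isMaximal.isPrime

/-- The maximal ideals `v` of `𝒪_{K,p}` correspond to the primes `𝔭` of `𝒪_K` above `p`. As
`𝒪_{K,p}` is the product of the completions `𝒪_{K,𝔭}`, its localization at `v` is `𝒪_{K,𝔭}`. -/
def OKv (v : MaximalSpectrum (OKp p K)) : Type u := Localization.AtPrime v.asIdeal

instance (v : MaximalSpectrum (OKp p K)) : CommRing (OKv v) :=
  inferInstanceAs (CommRing (Localization.AtPrime v.asIdeal))

instance (v : MaximalSpectrum (OKp p K)) : IsLocalRing (OKv v) :=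
  inferInstanceAs (IsLocalRing (Localization.AtPrime v.asIdeal))

instance (v : MaximalSpectrum (OKp p K)) : Algebra (OKp p K) (OKv v) :=
  inferInstanceAs (Algebra (OKp p K) (Localization.AtPrime v.asIdeal))

instance (v : MaximalSpectrum (OKp p K)) : Algebra ℤ_[p] (OKv v) :=
  inferInstanceAs (Algebra ℤ_[p] (Localization.AtPrime v.asIdeal))

instance (v : MaximalSpectrum (OKp p K)) : IsScalarTower ℤ_[p] (OKp p K) (OKv v) :=
  inferInstanceAs (IsScalarTower ℤ_[p] (OKp p K) (Localization.AtPrime v.asIdeal))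

instance (v : MaximalSpectrum (OKp p K)) : IsLocalization.AtPrime (OKv v) v.asIdeal :=
  inferInstanceAs (IsLocalization.AtPrime (Localization.AtPrime v.asIdeal) v.asIdeal)

/-- The localization homomorphism `𝒪_{K,p} → 𝒪_{K,𝔭}`. -/
def locMap (v : MaximalSpectrum (OKp p K)) : OKp p K →+* OKv v :=
  algebraMap (OKp p K) (OKv v)

/-- The homomorphism `𝒪_K → 𝒪_{K,𝔭}`. -/
def toOKv (v : MaximalSpectrum (OKp p K)) : 𝓞 K →+* OKv v :=
  (locMap v).comp (toOKp p K)

lemma p_mem (v : MaximalSpectrum (OKp p K)) : (p : OKp p K) ∈ v.asIdeal := by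
  have := v.isMaximal
  have h : (v.asIdeal.comap (algebraMap ℤ_[p] (OKp p K))).IsMaximal :=
    Ideal.isMaximal_comap_of_isIntegral_of_isMaximal v.asIdeal
  have h2 : (p : ℤ_[p]) ∈ v.asIdeal.comap (algebraMap ℤ_[p] (OKp p K)) := by
    rw [IsLocalRing.eq_maximalIdeal h, PadicInt.maximalIdeal_eq_span_p]
    exact Ideal.mem_span_singleton_self _
  simpa using h2

/-- The projection from `(𝒪_K ⊗ 𝔽_p)_red` to the residue field `𝔽_𝔭` of `𝒪_{K,𝔭}`. -/
def resToResidueField (v : MaximalSpectrum (OKp p K)) :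
    ResRing p K →+* IsLocalRing.ResidueField (OKv v) :=
  Ideal.Quotient.lift (Ideal.span {(p : OKp p K)}).radical ((IsLocalRing.residue (OKv v)).comp (locMap v)) (by
    intro a ha
    have h1 : a ∈ v.asIdeal :=
      (Ideal.IsPrime.radical_le_iff inferInstance).2
        ((Ideal.span_singleton_le_iff_mem _).2 (p_mem v)) ha
    rw [RingHom.comp_apply, IsLocalRing.residue_eq_zero_iff]
    exact (IsLocalization.AtPrime.to_map_mem_maximal_iff (OKv v) v.asIdeal a).2 h1)

end Rings

/-! ### Residue disks, local parameters and charts -/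

section Disks

variable {p : ℕ} [Fact p.Prime] {K : Type u} [Field K] [NumberField K]

/-- The set `X((𝒪_K ⊗ 𝔽_p)_red)`. -/
abbrev ResPoint (p : ℕ) [Fact p.Prime] {K : Type u} [Field K] [NumberField K]
    (X : Over (Spec (CommRingCat.of (𝓞 K)))) :=
  specOver ((red p K).comp (toOKp p K)) ⟶ X

/-- The residue disk `X(𝒪_{K,p})_x`. -/
@[ext]
structure Disk {X : Over (Spec (CommRingCat.of (𝓞 K)))} (x : ResPoint p X) : Type u where
  /-- the underlying `𝒪_{K,p}`-point of `X` -/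
  pt : specOver (toOKp p K) ⟶ X
  reduces : specOverMap (toOKp p K) (red p K) ≫ pt = x

/-- The map of residue disks induced by a morphism of `𝒪_K`-schemes. -/
def Disk.map {X Y : Over (Spec (CommRingCat.of (𝓞 K)))} {x : ResPoint p X} (σ : Disk x)
    (f : X ⟶ Y) : Disk (x ≫ f) :=
  ⟨σ.pt ≫ f, by rw [← Category.assoc, σ.reduces]⟩

/-- The reduction in `X(𝒪_{K,p} / p^j)` of a point of a residue disk. -/
def Disk.modPow {X : Over (Spec (CommRingCat.of (𝓞 K)))} {x : ResPoint p X} (σ : Disk x) (j : ℕ) :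
    specOver ((ResidueDisk.modPow p K j).comp (toOKp p K)) ⟶ X :=
  specOverMap (toOKp p K) (ResidueDisk.modPow p K j) ≫ σ.pt

/-- The component `x_𝔭 ∈ X(𝔽_𝔭)` of `x`. -/
def ResPoint.at {X : Over (Spec (CommRingCat.of (𝓞 K)))} (x : ResPoint p X)
    (v : MaximalSpectrum (OKp p K)) :
    specOver ((IsLocalRing.residue (OKv v)).comp (toOKv v)) ⟶ X :=
  specOverMap ((red p K).comp (toOKp p K)) (resToResidueField v) ≫ x

/-- The component in `X(𝒪_{K,𝔭})` of a point of `X(𝒪_{K,p})`. -/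
def Disk.at {X : Over (Spec (CommRingCat.of (𝓞 K)))} {x : ResPoint p X} (σ : Disk x)
    (v : MaximalSpectrum (OKp p K)) : specOver (toOKv v) ⟶ X :=
  specOverMap (toOKp p K) (locMap v) ≫ σ.pt

lemma Disk.at_reduces {X : Over (Spec (CommRingCat.of (𝓞 K)))} {x : ResPoint p X} (σ : Disk x)
    (v : MaximalSpectrum (OKp p K)) :
    specOverMap (toOKv v) (IsLocalRing.residue (OKv v)) ≫ σ.at v = x.at v := by
  obtain ⟨σ, rfl⟩ := σ
  apply Over.OverMorphism.ext
  have h : (resToResidueField v).comp (red p K) =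
      (IsLocalRing.residue (OKv v)).comp (locMap v) :=
    RingHom.ext fun a => rfl
  have h2 : Spec.map (CommRingCat.ofHom (IsLocalRing.residue (OKv v))) ≫
        Spec.map (CommRingCat.ofHom (locMap v)) =
      Spec.map (CommRingCat.ofHom (resToResidueField v)) ≫
        Spec.map (CommRingCat.ofHom (red p K)) := by
    rw [← Spec.map_comp, ← Spec.map_comp, ← CommRingCat.ofHom_comp, ← CommRingCat.ofHom_comp, h]
  have h3 := congrArg (fun q => q ≫ σ.left) h2
  simp only [Category.assoc] at h3
  exact h3

/-- The local ring of `X_{𝒪_{K,𝔭}}` at `x_𝔭`. -/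
abbrev ResPoint.localRing {X : Over (Spec (CommRingCat.of (𝓞 K)))} (x : ResPoint p X)
    (v : MaximalSpectrum (OKp p K)) : CommRingCat.{u} :=
  ResidueDisk.localRing (toOKv v) (x.at v)

/-- The value in `𝒪_{K,𝔭}` of an element of the local ring at `x_𝔭` at a point of the residue disk
of `x`. -/
def Disk.eval {X : Over (Spec (CommRingCat.of (𝓞 K)))} {x : ResPoint p X} (σ : Disk x)
    {v : MaximalSpectrum (OKp p K)} (t : x.localRing v) : OKv v :=
  evalAt (toOKv v) (x.at v) (σ.at v) (σ.at_reduces v) t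

/-- A choice of local parameters at `x`: for each `𝔭` above `p`, with uniformizer `ϖ`, elements
`t_1, …, t_n` such that `ϖ, t_1, …, t_n` is a regular system of parameters of the local ring
at `x_𝔭`, i.e. (this local ring being regular) a minimal system of generators of its maximal
ideal. -/
structure LocalParameters {X : Over (Spec (CommRingCat.of (𝓞 K)))} (x : ResPoint p X)
    (ϖ : ∀ v : MaximalSpectrum (OKp p K), OKv v) (n : MaximalSpectrum (OKp p K) → ℕ) where
  /-- the parameters -/
  t : ∀ v, Fin (n v) → x.localRing v
  span_eq : ∀ v, Ideal.span (insert (structureMap (toOKv v) (x.at v) (ϖ v)) (Set.range (t v))) =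
    IsLocalRing.maximalIdeal (x.localRing v)
  minimal : ∀ v, Submodule.spanFinrank (IsLocalRing.maximalIdeal (x.localRing v)) = n v + 1

/-- The identification `e` of a set `D` with a power of `ℤ_p` is obtained from the functions
`t_i : D → 𝒪_{K,𝔭}` by dividing them by the uniformizers and taking coordinates with respect to the
`ℤ_p`-bases `b` of the rings `𝒪_{K,𝔭}`. -/
def IsChart {D : Type*} (ϖ : ∀ v : MaximalSpectrum (OKp p K), OKv v)
    {k : MaximalSpectrum (OKp p K) → ℕ}
    (b : ∀ v, Module.Basis (Fin (k v)) ℤ_[p] (OKv v)) {I : MaximalSpectrum (OKp p K) → Type*}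
    (t : ∀ v, I v → D → OKv v) (e : D ≃ ((Σ v, I v × Fin (k v)) → ℤ_[p])) : Prop :=
  ∀ (σ : D) (v : MaximalSpectrum (OKp p K)) (i : I v),
    ϖ v * ∑ j, e σ ⟨v, i, j⟩ • b v j = t v i σ

/-- The map `F` is given by convergent power series with coefficients in `ℤ_p`, i.e. by power series
whose coefficients tend to `0`. -/
def GivenByConvergentPowerSeries {α β : Type*} (F : (α → ℤ_[p]) → (β → ℤ_[p])) : Prop :=
  ∀ j, ∃ f : MvPowerSeries α ℤ_[p], MvPowerSeries.IsRestricted (fun _ => (1 : ℝ)) f ∧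
    ∀ z : α → ℤ_[p],
      HasSum (fun J : α →₀ ℕ => MvPowerSeries.coeff J f * J.prod fun i a => z i ^ a) (F z j)

end Disks

/-! ### Group schemes -/

section Groups

variable {p : ℕ} [Fact p.Prime] {K : Type u} [Field K] [NumberField K]
  {Y : Over (Spec (CommRingCat.of (𝓞 K)))} (G : Over Y.left)

/-- The `Y`-scheme `G` as a scheme over `𝒪_K`. -/
abbrev total : Over (Spec (CommRingCat.of (𝓞 K))) := Over.mk (G.hom ≫ Y.hom)

/-- The structure morphism `G ⟶ Y` over `𝒪_K`. -/
def proj : total G ⟶ Y := Over.homMk G.hom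

variable [GrpObj G]

/-- The identity section `e : Y ⟶ G`. -/
def idSection : Y ⟶ total G :=
  Over.homMk (MonObj.one (X := G)).left (by
    have h := Over.w (MonObj.one (X := G))
    have h' : (MonObj.one (X := G)).left ≫ G.hom = 𝟙 Y.left := h
    simp [reassoc_of% h'])

lemma idSection_proj : idSection G ≫ proj G = 𝟙 Y := by
  ext1
  exact Over.w (MonObj.one (X := G))

/-- The points of `G` over a point `s : T ⟶ Y`; they form a group by means of the group scheme
structure. -/
abbrev FibrePoint {T : Over (Spec (CommRingCat.of (𝓞 K)))} (s : T ⟶ Y) :=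
  Over.mk s.left ⟶ G

lemma one_left {T : Over (Spec (CommRingCat.of (𝓞 K)))} (s : T ⟶ Y) :
    (1 : FibrePoint G s).left = (s ≫ idSection G).left := by
  have h : (1 : FibrePoint G s) =
      CartesianMonoidalCategory.toUnit (Over.mk s.left) ≫ MonObj.one (X := G) := rfl
  have h2 : (CartesianMonoidalCategory.toUnit (Over.mk s.left)).left = s.left := by
    have h3 := Over.w (CartesianMonoidalCategory.toUnit (Over.mk s.left))
    exact (Category.comp_id _).symm.trans h3
  rw [h, Over.comp_left, h2]
  rfl

/-- The homomorphism from the group of points of `G` over `s` to the group of points over `q ≫ s`. -/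
def FibrePoint.pullback {T T' : Over (Spec (CommRingCat.of (𝓞 K)))} (q : T' ⟶ T) (s : T ⟶ Y) :
    FibrePoint G s →* FibrePoint G (q ≫ s) where
  toFun g := (Over.homMk q.left : Over.mk (q ≫ s).left ⟶ Over.mk s.left) ≫ g
  map_one' := MonObj.comp_one _
  map_mul' := MonObj.comp_mul _

/-- For a point `s` in the residue disk of `y`, the fibre over `s` of the residue disk at the
identity: the kernel of the reduction map on the group of points of `G` over `s`. -/
def fibre {y : ResPoint p Y} (s : Disk y) : Subgroup (FibrePoint G s.pt) :=
  (FibrePoint.pullback G (specOverMap (toOKp p K) (red p K)) s.pt).ker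

/-- The inclusion of the fibre over `s` into the residue disk `G(𝒪_{K,p})_{e(y)}`. -/
def fibre.incl {y : ResPoint p Y} {s : Disk y} (g : fibre G s) : Disk (y ≫ idSection G) :=
  ⟨Over.homMk g.1.left (by
      have h := Over.w g.1
      have h2 := Over.w s.pt
      simp only [Over.mk_hom] at h h2 ⊢
      rw [reassoc_of% h, h2]), by
    obtain ⟨s, rfl⟩ := s
    obtain ⟨g, hg⟩ := g
    have h : (FibrePoint.pullback G (specOverMap (toOKp p K) (red p K)) s g).left = _ :=
      congrArg Over.Hom.left (MonoidHom.mem_ker.1 hg)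
    rw [one_left] at h
    ext1
    exact h⟩

/-- The map `G(𝒪_{K,p})_{e(y)} ⟶ Y(𝒪_{K,p})_y` induced by the structure morphism of `G`. -/
def Disk.toBase {y : ResPoint p Y} (g : Disk (y ≫ idSection G)) : Disk y :=
  ⟨g.pt ≫ proj G, by
    rw [← Category.assoc, g.reduces, Category.assoc, idSection_proj, Category.comp_id]⟩

/-- Every point of the residue disk lies in the fibre over its image. -/
lemma exists_incl_eq {y : ResPoint p Y} (g : Disk (y ≫ idSection G)) :
    ∃ h : fibre G (g.toBase G), fibre.incl G h = g := by
  refine ⟨⟨Over.homMk g.pt.left rfl, ?_⟩, ?_⟩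
  · rw [fibre, MonoidHom.mem_ker]
    ext1
    rw [one_left]
    have h : (specOverMap (toOKp p K) (red p K) ≫ g.pt).left =
        ((specOverMap (toOKp p K) (red p K) ≫ (g.toBase G).pt) ≫ idSection G).left := by
      rw [g.reduces, (g.toBase G).reduces]
    exact h
  · apply Disk.ext
    ext1
    rfl

/-- The kernel of the comorphism of the identity section from the local ring of `G` at `e(y)` to the
local ring of `Y` at `y`, at each prime above `p`. -/
def idKernel (y : ResPoint p Y) (v : MaximalSpectrum (OKp p K)) :
    Ideal (ResPoint.localRing (y ≫ idSection G) v) :=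
  RingHom.ker (localRingMap (toOKv v) (y.at v) (idSection G))

/-- A choice of relative local parameters for `G ⟶ Y` at `e(y)`: for each `𝔭` above `p`, elements
`t_1, …, t_m` of the kernel `I` of the comorphism of the identity section on local rings that form a
basis of `I / I²` (over the quotient by `I` of the local ring of `G`, which is the local ring
of `Y`). -/
structure RelativeLocalParameters (y : ResPoint p Y) (m : MaximalSpectrum (OKp p K) → ℕ) where
  /-- the parameters -/
  t : ∀ v, Fin (m v) → idKernel G y v
  basis : ∀ v, ∃ B : Module.Basis (Fin (m v))
      (ResPoint.localRing (y ≫ idSection G) v ⧸ idKernel G y v) (idKernel G y v).Cotangent,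
    ∀ i, B i = (idKernel G y v).toCotangent (t v i)

/-- The coordinate functions on the residue disk `G(𝒪_{K,p})_{e(y)}` that are given by local parameters
`s` of `Y` at `y` and relative local parameters `t` for `G ⟶ Y` at `e(y)`. -/
def relativeCoordinates {y : ResPoint p Y} {ϖ : ∀ v : MaximalSpectrum (OKp p K), OKv v}
    {n m : MaximalSpectrum (OKp p K) → ℕ} (s : LocalParameters y ϖ n)
    (t : RelativeLocalParameters G y m) (v : MaximalSpectrum (OKp p K)) :
    Fin (n v) ⊕ Fin (m v) → Disk (y ≫ idSection G) → OKv v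
  | Sum.inl i, g => (g.toBase G).eval (s.t v i)
  | Sum.inr i, g => g.eval (t.t v i).1

/-- An action of `ℤ_p` on a group `H` (by powers) that extends the map
`(n, h) ↦ hⁿ` for integers `n`. If `H` is commutative, this is the structure of a `ℤ_p`-module. -/
structure IsPadicPowerAction {H : Type*} [Group H] (act : ℤ_[p] → H → H) : Prop where
  intCast : ∀ (n : ℤ) (h : H), act n h = h ^ n
  add : ∀ (a b : ℤ_[p]) (h : H), act (a + b) h = act a h * act b h
  mul : ∀ (a b : ℤ_[p]) (h : H), act (a * b) h = act a (act b h)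
  map_mul : ∀ (a : ℤ_[p]) (h h' : H), Commute h h' → act a (h * h') = act a h * act a h'

end Groups

end ResidueDisk

end

noncomputable section

namespace ResidueDisk

/-! ### Coordinate systems on formally smooth local algebras -/

section Coordinates

open IsLocalRing

variable {A R W J : Type*} [CommRing A] [CommRing R] [Algebra A R] [IsLocalRing R]
  [CommRing W] [Algebra A W]

/-! Write `A` for a completion `𝒪_{K,𝔭}` with uniformizer `ϖ`, and `R` for the local ring of `X_A`
at `x_𝔭`. Since `𝒪_{K,p}` is the product of its localizations, a point of the residue disk is a
family of `A`-algebra homomorphisms `R → A`, one for each `𝔭` (`Disk.evalHom_bijective`). The ring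
`R` is formally smooth over `A` with residue field `A / ϖ`.

Let `W` be a `ϖ`-adically complete `A`-algebra and `τ` a finite coordinate system of `R`.
Homomorphisms `h : R → W` that send the maximal ideal into `ϖ W` correspond to arbitrary families `h
(τ i) / ϖ` in `W`. Uniqueness (`IsCoordinateSystem.hom_ext`) is successive approximation modulo
powers of `ϖ`. Existence (`IsCoordinateSystem.exists_hom`) lifts step by step by formal smoothness
and corrects each lift by derivations dual to `τ`. For `W = A` this gives the charts. For `W` the
restricted power series over `A` it gives a universal point with indeterminate coordinates
(`exists_universalHom`), and every chart is its specialization (`seriesEval_comp_universalHom`). An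
element of the maximal ideal takes at the universal point a value `ϖ g` with `g` restricted, so
morphisms are given by convergent series over `A`; taking `ℤ_p`-coordinates of the coefficients
gives series over `ℤ_p`.

For group schemes, the key fact is `pow_dvd_fwdDiff`: if `g` is trivial modulo `ϖ`, the `i`-th
finite difference of `j ↦ r (g ^ j)` is divisible by `ϖ ^ i`. Newton's formula then writes `r (g ^
n)` as a sum of `n.choose i` times multiples of `ϖ ^ i`. The condition `e < p - 1` makes `ϖ ^ (i -
1) / i!` integral and convergent to zero (`exists_factorial_mul`). Hence `g ^ (p ^ j)` is trivial
modulo `p ^ j`, so powers extend to exponents in `ℤ_p` (`exists_padicPowerAction`). The same Newton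
series at the universal point, with the exponent as one more variable, is a restricted power series
(`exists_newtonSeries`), and it computes the action because it does so for natural exponents, which
are dense. -/

/-- The residue field of the local `A`-algebra `R` is `A / ϖ`. -/
structure IsRational (ϖ : A) (R : Type*) [CommRing R] [Algebra A R] [IsLocalRing R] : Prop where
  mem_iff : ∀ a : A, algebraMap A R a ∈ maximalIdeal R ↔ ϖ ∣ a
  exists_sub_mem : ∀ x : R, ∃ a : A, x - algebraMap A R a ∈ maximalIdeal R

/-- The elements `τ i` of the maximal ideal form a basis of the cotangent space of `R` relative
to `A`, where `ϖ` is a uniformizer of `A`. -/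
structure IsCoordinateSystem (ϖ : A) (τ : J → R) : Prop where
  mem : ∀ i, τ i ∈ maximalIdeal R
  le_span : maximalIdeal R ≤
    Ideal.span (insert (algebraMap A R ϖ) (Set.range τ)) ⊔ maximalIdeal R ^ 2
  exists_derivation : ∀ c : J → ResidueField R,
    ∃ D : Derivation A R (ResidueField R), ∀ i, D (τ i) = c i

/-- A homomorphism that maps the maximal ideal to multiples of `ϖ`. -/
def IsCentered (ϖ : A) (h : R →ₐ[A] W) : Prop :=
  ∀ x ∈ maximalIdeal R, algebraMap A W ϖ ∣ h x

/-- The element `x - h x` is killed by `h`, so it is not a unit of `R`. Hence the scalar `h x` lies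
in the maximal ideal together with `x`. -/
lemma isCentered_of_isRational {ϖ : A}
    (hR : IsRational ϖ R) (h : R →ₐ[A] A) :
    IsCentered ϖ h := by
  intro x hx
  rw [Algebra.algebraMap_self, RingHom.id_apply, ← hR.mem_iff]
  by_contra hn
  have h1 : x - algebraMap A R (h x) ∉ maximalIdeal R := fun h2 => hn (by
    simpa using sub_mem hx h2)
  have h2 : IsUnit (x - algebraMap A R (h x)) := by simpa using h1
  have h3 := (h2.map h).map (algebraMap A R)
  simp at h3

lemma IsRational.of_span [IsLocalRing A] {ϖ : A} (hϖ : Ideal.span {ϖ} = maximalIdeal A)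
    (h : IsLocalHom (algebraMap A R))
    (h' : ∀ x : R, ∃ a : A, x - algebraMap A R a ∈ maximalIdeal R) : IsRational ϖ R := by
  refine ⟨fun a => ?_, h'⟩
  rw [← Ideal.mem_span_singleton, hϖ, mem_maximalIdeal, mem_maximalIdeal, mem_nonunits_iff,
    mem_nonunits_iff, isUnit_map_iff]

/-- Two centered homomorphisms that agree on a coordinate system modulo `ϖ ^ N` agree modulo
`ϖ ^ N`. -/
lemma IsCoordinateSystem.sub_mem_pow {ϖ : A} {τ : J → R} (hR : IsRational ϖ R)
    (hτ : IsCoordinateSystem ϖ τ) {h h' : R →ₐ[A] W} (hh : IsCentered ϖ h)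
    (hh' : IsCentered ϖ h') (N : ℕ)
    (hN : ∀ i, algebraMap A W ϖ ^ N ∣ h (τ i) - h' (τ i)) (x : R) :
    algebraMap A W ϖ ^ N ∣ h x - h' x := by
  set q := algebraMap A W ϖ
  -- The congruence is improved by one factor `ϖ` at a time. Both maps agree on scalars, so only the
  -- maximal ideal matters; there, in a product, the congruence for one factor is multiplied by the
  -- centered value of the other.
  suffices ∀ n ≤ N, ∀ x, q ^ n ∣ h x - h' x from this N le_rfl x
  intro n
  induction n with
  | zero => intro _ x; simp
  | succ n ih =>
    intro hn
    have ih := ih (by omega)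
    have hmem : ∀ x ∈ maximalIdeal R, q ^ (n + 1) ∣ h x - h' x := by
      intro x hx
      obtain ⟨y, hy, z, hz, rfl⟩ := Submodule.mem_sup.1 (hτ.le_span hx)
      have h1 : q ^ (n + 1) ∣ h y - h' y := by
        refine Submodule.span_induction (p := fun y _ => q ^ (n + 1) ∣ h y - h' y) ?_ ?_ ?_ ?_ hy
        · rintro _ (rfl | ⟨i, rfl⟩)
          · simp
          · exact (pow_dvd_pow _ hn).trans (hN i)
        · simp
        · intro a b _ _ ha hb
          rw [map_add, map_add, add_sub_add_comm]
          exact dvd_add ha hb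
        · intro a b hb1 hb
          have hb2 : b ∈ maximalIdeal R := by
            refine (Ideal.span_le.2 ?_) hb1
            rintro _ (rfl | ⟨i, rfl⟩)
            · exact (hR.mem_iff ϖ).2 dvd_rfl
            · exact hτ.mem i
          have e : h (a • b) - h' (a • b) = (h a - h' a) * h b + h' a * (h b - h' b) := by
            simp only [smul_eq_mul, map_mul]; ring
          rw [e]
          refine dvd_add ?_ (dvd_mul_of_dvd_right hb _)
          rw [pow_succ]
          exact mul_dvd_mul (ih a) (hh b hb2)
      have h2 : q ^ (n + 1) ∣ h z - h' z := by
        rw [pow_two] at hz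
        refine Submodule.mul_induction_on hz ?_ ?_
        · intro a ha b hb
          have e : h (a * b) - h' (a * b) = (h a - h' a) * h b + (h b - h' b) * h' a := by
            simp only [map_mul]; ring
          rw [e, pow_succ]
          exact dvd_add (mul_dvd_mul (ih a) (hh b hb)) (mul_dvd_mul (ih b) (hh' a ha))
        · intro a b ha hb
          rw [map_add, map_add, add_sub_add_comm]
          exact dvd_add ha hb
      rw [map_add, map_add, add_sub_add_comm]
      exact dvd_add h1 h2
    intro x
    obtain ⟨a, ha⟩ := hR.exists_sub_mem x
    have := hmem _ ha
    simpa using this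

lemma dvd_pow_of_isHausdorff {q : W} [IsHausdorff (Ideal.span {q}) W] {x : W}
    (h : ∀ n, q ^ n ∣ x) : x = 0 := by
  refine IsHausdorff.haus (I := Ideal.span {q}) inferInstance x fun n => ?_
  rw [SModEq.zero, smul_eq_mul, Ideal.mul_top, Ideal.span_singleton_pow]
  exact Ideal.mem_span_singleton.2 (h n)

lemma IsCoordinateSystem.hom_ext {ϖ : A} {τ : J → R} (hR : IsRational ϖ R)
    (hτ : IsCoordinateSystem ϖ τ) [IsHausdorff (Ideal.span {algebraMap A W ϖ}) W]
    {h h' : R →ₐ[A] W} (hh : IsCentered ϖ h)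
    (hh' : IsCentered ϖ h') (hN : ∀ i, h (τ i) = h' (τ i)) : h = h' := by
  ext x
  rw [← sub_eq_zero]
  exact dvd_pow_of_isHausdorff fun n => hτ.sub_mem_pow hR hh hh' n (fun i => by simp [hN i]) x

/-- The homomorphism to `W / ϖ` that factors over the residue field. -/
lemma exists_residual_hom {ϖ : A} (hR : IsRational ϖ R) :
    ∃ φ : R →ₐ[A] W ⧸ Ideal.span {algebraMap A W ϖ}, ∀ x ∈ maximalIdeal R, φ x = 0 := by
  choose ρ hρ using hR.exists_sub_mem
  -- The scalar `ρ x` is determined up to a multiple of `ϖ`, which dies in the quotient. Hence any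
  -- convenient scalar representative may be used, and the ring axioms follow.
  have key : ∀ (x : R) (a : A), x - algebraMap A R a ∈ maximalIdeal R →
      algebraMap A (W ⧸ Ideal.span {algebraMap A W ϖ}) (ρ x) = algebraMap A _ a := by
    intro x a hx
    have h1 : algebraMap A R (ρ x - a) ∈ maximalIdeal R := by
      have := sub_mem hx (hρ x)
      rw [map_sub]
      convert this using 1; ring
    obtain ⟨c, hc⟩ := (hR.mem_iff _).1 h1
    have h2 : Ideal.Quotient.mk (Ideal.span {algebraMap A W ϖ}) (algebraMap A W (ϖ * c)) = 0 := by
      rw [Ideal.Quotient.eq_zero_iff_mem, map_mul]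
      exact Ideal.mul_mem_right _ _ (Ideal.mem_span_singleton_self _)
    rw [← sub_eq_zero, ← map_sub, hc]
    exact h2
  refine ⟨
    { toFun := fun x => algebraMap A _ (ρ x)
      map_one' := ?_
      map_mul' := ?_
      map_zero' := ?_
      map_add' := ?_
      commutes' := ?_ }, ?_⟩
  · rw [key 1 1 (by simp), map_one]
  · intro x y
    rw [key (x * y) (ρ x * ρ y), map_mul]
    have : x * y - algebraMap A R (ρ x * ρ y) =
      x * (y - algebraMap A R (ρ y)) + algebraMap A R (ρ y) * (x - algebraMap A R (ρ x)) := by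
      rw [map_mul]; ring
    rw [this]
    exact add_mem (Ideal.mul_mem_left _ _ (hρ y)) (Ideal.mul_mem_left _ _ (hρ x))
  · rw [key 0 0 (by simp), map_zero]
  · intro x y
    rw [key (x + y) (ρ x + ρ y), map_add]
    rw [map_add, add_sub_add_comm]
    exact add_mem (hρ x) (hρ y)
  · intro a
    exact key _ a (by simp)
  · intro x hx
    simpa using key x 0 (by simpa using hx)

/-- The correction of a homomorphism to an algebra in which `ϖ ^ (n + 2) = 0` by a derivation. -/
lemma exists_corrected_hom {ϖ : A} (hR : IsRational ϖ R) (n : ℕ)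
    (hW : algebraMap A W ϖ ^ (n + 2) = 0) (φ : R →ₐ[A] W) (hφ : IsCentered ϖ φ)
    [Finite J] (τ : J → R)
    (hτ : ∀ c : J → ResidueField R, ∃ D : Derivation A R (ResidueField R), ∀ i, D (τ i) = c i)
    (w : J → W) :
    ∃ ψ : R →ₐ[A] W, (∀ x, algebraMap A W (ϖ ^ (n + 1)) ∣ ψ x - φ x) ∧
      ∀ i, ψ (τ i) = φ (τ i) + algebraMap A W (ϖ ^ (n + 1)) * w i := by
  classical
  have := Fintype.ofFinite J
  set q := algebraMap A W ϖ with hq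
  choose ρ hρ using hR.exists_sub_mem
  choose D hD using fun i => hτ (Pi.single i 1)
  let s := Function.surjInv (residue_surjective (R := R))
  have hs : ∀ y, residue R (s y) = y := Function.surjInv_eq _
  let d : J → R → A := fun i x => ρ (s (D i x))
  have hκ : ∀ x, residue R (algebraMap A R (ρ x)) = residue R x := fun x =>
    ((Ideal.Quotient.eq).2 (hρ x)).symm
  have hd : ∀ i x, residue R (algebraMap A R (d i x)) = D i x := fun i x => by
    rw [hκ, hs]
  -- The values of the derivations are lifted to scalars only modulo `ϖ`. Multiplication by `ϖ ^ (n
  -- + 1)` makes the lifts well defined in `W`, where `ϖ ^ (n + 2) = 0`.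
  have key : ∀ a b : A, residue R (algebraMap A R a) = residue R (algebraMap A R b) →
      q ^ (n + 1) * algebraMap A W a = q ^ (n + 1) * algebraMap A W b := by
    intro a b h
    rw [← sub_eq_zero, ← map_sub, ← map_sub, residue_eq_zero_iff, hR.mem_iff] at h
    obtain ⟨c, hc⟩ := h
    rw [← sub_eq_zero, ← mul_sub, ← map_sub, hc, map_mul, ← mul_assoc, ← pow_succ, hW, zero_mul]
  have hρφ : ∀ x, q ^ (n + 1) * φ x = q ^ (n + 1) * algebraMap A W (ρ x) := by
    intro x
    obtain ⟨c, hc⟩ := hφ _ (hρ x)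
    rw [← sub_eq_zero, ← mul_sub, ← AlgHom.commutes φ, ← map_sub, hc, ← mul_assoc, ← pow_succ,
      hW, zero_mul]
  have hadd : ∀ i x y, q ^ (n + 1) * algebraMap A W (d i (x + y)) =
      q ^ (n + 1) * algebraMap A W (d i x) + q ^ (n + 1) * algebraMap A W (d i y) := by
    intro i x y
    rw [key _ (d i x + d i y), map_add, mul_add]
    simp [hd]
  have hmul : ∀ i x y, q ^ (n + 1) * algebraMap A W (d i (x * y)) =
      q ^ (n + 1) * algebraMap A W (d i y) * φ x + q ^ (n + 1) * algebraMap A W (d i x) * φ y := by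
    intro i x y
    rw [mul_right_comm, hρφ, mul_right_comm _ _ (φ y), hρφ,
      key _ (ρ x * d i y + ρ y * d i x)]
    · simp only [map_add, map_mul]; ring
    · simp only [map_add, map_mul, hd, hκ, Derivation.leibniz, Algebra.smul_def]
      rfl
  have hal : ∀ i a, q ^ (n + 1) * algebraMap A W (d i (algebraMap A R a)) = 0 := by
    intro i a
    rw [key _ 0 (by simp [hd]), map_zero, mul_zero]
  -- This is `ϖ ^ (n + 1)` times the combination of the dual derivations with coefficients `w i`. It
  -- is a derivation along `φ` with values in an ideal of square zero, since `2 (n + 1) ≥ n + 2`;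
  -- therefore `φ + δ` is again a homomorphism.
  let δ : R → W := fun x => ∑ i, w i * (q ^ (n + 1) * algebraMap A W (d i x))
  have δadd : ∀ x y, δ (x + y) = δ x + δ y := by
    intro x y
    simp only [δ, hadd, mul_add, Finset.sum_add_distrib]
  have δmul : ∀ x y, δ (x * y) = φ x * δ y + φ y * δ x := by
    intro x y
    simp only [δ, hmul, mul_add, Finset.sum_add_distrib, Finset.mul_sum]
    congr 1 <;> exact Finset.sum_congr rfl fun i _ => by ring
  have δal : ∀ a, δ (algebraMap A R a) = 0 := by
    intro a
    simp [δ, hal]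
  have δδ : ∀ x, q ^ (n + 1) ∣ δ x := fun x =>
    Finset.dvd_sum fun i _ => dvd_mul_of_dvd_right (dvd_mul_right _ _) _
  have δsq : ∀ x y, δ x * δ y = 0 := by
    intro x y
    obtain ⟨a, ha⟩ := δδ x
    obtain ⟨b, hb⟩ := δδ y
    have : q ^ (n + 1) * a * (q ^ (n + 1) * b) = q ^ (n + 2) * (q ^ n * a * b) := by ring
    rw [ha, hb, this, hW, zero_mul]
  refine ⟨
    { toFun := fun x => φ x + δ x
      map_one' := ?_
      map_mul' := ?_
      map_zero' := ?_
      map_add' := ?_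
      commutes' := ?_ }, fun x => ?_, fun i => ?_⟩
  · have := δal 1
    rw [map_one] at this
    simp [this]
  · intro x y
    rw [map_mul, δmul]
    linear_combination -δsq x y
  · have := δal 0
    rw [map_zero] at this
    simp [this]
  · intro x y
    rw [map_add, δadd]; ring
  · intro a
    simp [δal]
  · change _ ∣ φ x + δ x - φ x
    rw [add_sub_cancel_left, map_pow]
    exact δδ x
  · change φ (τ i) + δ (τ i) = _
    rw [add_right_inj, map_pow]
    simp only [δ]
    rw [Finset.sum_eq_single i]
    · rw [key _ 1 (by simp [hd, hD]), map_one]; ring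
    · intro j _ hj
      rw [key _ 0 (by simp [hd, hD, Ne.symm hj]), map_zero]; ring
    · simp

/-- The lifting theorem: there is a homomorphism with prescribed values (divisible by `ϖ`) at a
coordinate system. -/
theorem IsCoordinateSystem.exists_hom {ϖ : A} {τ : J → R} (hR : IsRational ϖ R)
    (hτ : IsCoordinateSystem ϖ τ) [Algebra.FormallySmooth A R] [Finite J]
    [IsAdicComplete (Ideal.span {algebraMap A W ϖ}) W] (w : J → W) :
    ∃ h : R →ₐ[A] W, IsCentered ϖ h ∧ ∀ i, h (τ i) = algebraMap A W ϖ * w i := by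
  set I := Ideal.span {algebraMap A W ϖ} with hI
  have hmemI : ∀ n x, x ∈ I ^ n ↔ algebraMap A W ϖ ^ n ∣ x := fun n x => by
    rw [hI, Ideal.span_singleton_pow, Ideal.mem_span_singleton]
  -- Level `n` lives modulo `I ^ (n + 1)`, so level `0` is the residual homomorphism. Centeredness
  -- is carried along because the correction by derivations requires it.
  let P : (n : ℕ) → (R →ₐ[A] W ⧸ I ^ (n + 1)) → Prop := fun n φ =>
    (∀ x ∈ maximalIdeal R, ∃ y, φ x = Ideal.Quotient.mk _ (algebraMap A W ϖ * y)) ∧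
    ∀ i, φ (τ i) = Ideal.Quotient.mk _ (algebraMap A W ϖ * w i)
  have base : ∃ φ, P 0 φ := by
    obtain ⟨φ, hφ⟩ := exists_residual_hom (W := W) hR
    have e : I = I ^ (0 + 1) := by simp
    have h0 : ∀ y, Ideal.Quotient.mk (I ^ (0 + 1)) (algebraMap A W ϖ * y) = 0 := fun y => by
      rw [Ideal.Quotient.eq_zero_iff_mem, hmemI]; simp
    refine ⟨((Ideal.quotientEquivAlgOfEq A e : _ →ₐ[A] _)).comp φ, fun x hx => ⟨0, ?_⟩, fun i => ?_⟩
    · rw [h0, AlgHom.comp_apply, hφ x hx, map_zero]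
    · rw [h0, AlgHom.comp_apply, hφ _ (hτ.mem i), map_zero]
  have step : ∀ n φ, P n φ → ∃ ψ, P (n + 1) ψ ∧
      (Ideal.Quotient.factorPow I (n + 1).le_succ).comp (ψ : R →+* W ⧸ I ^ (n + 2)) = φ := by
    rintro n φ ⟨hφ1, hφ2⟩
    let g : (W ⧸ I ^ (n + 2)) →ₐ[A] W ⧸ I ^ (n + 1) :=
      Ideal.Quotient.factorₐ A (Ideal.pow_le_pow_right (n + 1).le_succ)
    have hg : ∀ x, g (Ideal.Quotient.mk _ x) = Ideal.Quotient.mk _ x := fun x => rfl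
    have hgs : Function.Surjective g := fun x => by
      obtain ⟨x, rfl⟩ := Ideal.Quotient.mk_surjective x
      exact ⟨_, hg x⟩
    have hker : ∀ x, g x = 0 ↔ algebraMap A _ (ϖ ^ (n + 1)) ∣ x := by
      intro x
      obtain ⟨x, rfl⟩ := Ideal.Quotient.mk_surjective x
      rw [hg, Ideal.Quotient.eq_zero_iff_mem, hmemI]
      constructor
      · rintro ⟨c, rfl⟩
        refine ⟨Ideal.Quotient.mk _ c, ?_⟩
        rw [map_mul, ← map_pow]; rfl
      · rintro ⟨c, hc⟩
        obtain ⟨c, rfl⟩ := Ideal.Quotient.mk_surjective c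
        have h1 : Ideal.Quotient.mk (I ^ (n + 2)) (x - algebraMap A W ϖ ^ (n + 1) * c) = 0 := by
          rw [map_sub, hc, map_mul, ← map_pow, sub_eq_zero]; rfl
        rw [Ideal.Quotient.eq_zero_iff_mem, hmemI] at h1
        have h2 := (pow_dvd_pow (algebraMap A W ϖ) (n + 1).le_succ).trans h1
        exact (dvd_sub_left (dvd_mul_right _ _)).1 h2
    have hnil : IsNilpotent (RingHom.ker (g : W ⧸ I ^ (n + 2) →+* W ⧸ I ^ (n + 1))) := by
      refine ⟨2, ?_⟩
      rw [Ideal.zero_eq_bot, eq_bot_iff, pow_two, Ideal.mul_le]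
      intro a ha b hb
      obtain ⟨a', rfl⟩ := (hker a).1 ha
      obtain ⟨b', rfl⟩ := (hker b).1 hb
      have e : algebraMap A (W ⧸ I ^ (n + 2)) (ϖ ^ (n + 1)) * a' *
          (algebraMap A _ (ϖ ^ (n + 1)) * b') =
          algebraMap A _ (ϖ ^ (n + 2)) * (algebraMap A _ (ϖ ^ n) * a' * b') := by
        rw [pow_succ ϖ n, pow_add ϖ n 2]; simp only [map_mul, map_pow]; ring
      have e2 : algebraMap A (W ⧸ I ^ (n + 2)) (ϖ ^ (n + 2)) = 0 := by
        refine Ideal.Quotient.eq_zero_iff_mem.2 ((hmemI _ _).2 ?_)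
        rw [map_pow]
      rw [e, e2, zero_mul]
      exact zero_mem _
    have hpow0 : algebraMap A (W ⧸ I ^ (n + 2)) ϖ ^ (n + 2) = 0 :=
      Ideal.Quotient.eq_zero_iff_mem.2 ((hmemI (n + 2) _).2 dvd_rfl)
    -- Formal smoothness lifts `φ` across a kernel of square zero. The lift misses the prescribed
    -- values at `τ i` by `ϖ ^ (n + 1) * c i`, and the correction with coefficients `-c i` removes
    -- this error without changing the reduction.
    let φ' := Algebra.FormallySmooth.liftOfSurjective φ g hgs hnil
    have hφ' : ∀ x, g (φ' x) = φ x :=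
      Algebra.FormallySmooth.liftOfSurjective_apply φ g hgs hnil
    have hdvd : ∀ y z, g y = Ideal.Quotient.mk _ z →
        ∃ c, y = Ideal.Quotient.mk _ z + algebraMap A _ (ϖ ^ (n + 1)) * c := by
      intro y z h
      rw [← hg, ← sub_eq_zero, ← map_sub, hker] at h
      obtain ⟨c, hc⟩ := h
      exact ⟨c, by rw [← hc]; ring⟩
    have hpow : ∀ c, ∃ c', algebraMap A (W ⧸ I ^ (n + 2)) (ϖ ^ (n + 1)) * c =
        Ideal.Quotient.mk _ (algebraMap A W ϖ * c') := by
      intro c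
      obtain ⟨c, rfl⟩ := Ideal.Quotient.mk_surjective c
      refine ⟨algebraMap A W ϖ ^ n * c, ?_⟩
      rw [← mul_assoc, ← pow_succ', map_mul, ← map_pow]; rfl
    have hc1 : ∀ x ∈ maximalIdeal R, ∃ y, φ' x = Ideal.Quotient.mk _ (algebraMap A W ϖ * y) := by
      intro x hx
      obtain ⟨y, hy⟩ := hφ1 x hx
      obtain ⟨c, hc⟩ := hdvd (φ' x) _ ((hφ' x).trans hy)
      obtain ⟨c', hc'⟩ := hpow c
      exact ⟨y + c', by rw [hc, hc', ← map_add, mul_add]⟩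
    choose c hc using fun i => hdvd (φ' (τ i)) _ ((hφ' _).trans (hφ2 i))
    obtain ⟨ψ, hψ1, hψ2⟩ := exists_corrected_hom hR n hpow0 φ' (fun x hx => by
      obtain ⟨y, hy⟩ := hc1 x hx
      rw [hy, map_mul]
      exact dvd_mul_right _ _) τ hτ.exists_derivation (fun i => -c i)
    refine ⟨ψ, ⟨fun x hx => ?_, fun i => ?_⟩, ?_⟩
    · obtain ⟨y, hy⟩ := hc1 x hx
      obtain ⟨a, ha⟩ := hψ1 x
      obtain ⟨c', hc'⟩ := hpow a
      refine ⟨y + c', ?_⟩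
      rw [sub_eq_iff_eq_add.1 ha, hc', hy, ← map_add]
      congr 1; ring
    · rw [hψ2, hc]; ring
    · ext x
      change g (ψ x) = φ x
      rw [← hφ', ← sub_eq_zero, ← map_sub, hker]
      exact hψ1 x
  choose φ₀ hφ₀ using base
  choose next hnext1 hnext2 using step
  let F : (n : ℕ) → {φ // P n φ} := fun n =>
    Nat.rec ⟨φ₀, hφ₀⟩ (fun n φ => ⟨next n φ.1 φ.2, hnext1 n φ.1 φ.2⟩) n
  have hF : ∀ n, (Ideal.Quotient.factorPow I (n + 1).le_succ).comp
      ((F (n + 1)).1 : R →+* W ⧸ I ^ (n + 2)) = (F n).1 := fun n => hnext2 n (F n).1 (F n).2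
  have hmono : StrictMono (fun n : ℕ => n + 1) := fun a b h => by simpa using h
  let h := IsAdicComplete.StrictMono.liftRingHom I hmono
    (fun n => ((F n).1 : R →+* W ⧸ I ^ (n + 1))) (fun {m} => hF m)
  have hh : ∀ n x, Ideal.Quotient.mk (I ^ (n + 1)) (h x) = (F n).1 x := fun n x =>
    IsAdicComplete.StrictMono.mk_liftRingHom I hmono
      (fun n => ((F n).1 : R →+* W ⧸ I ^ (n + 1))) (fun {m} => hF m) x
  have hext : ∀ x y : W, (∀ n, Ideal.Quotient.mk (I ^ (n + 1)) x = Ideal.Quotient.mk _ y) →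
      x = y := by
    intro x y hxy
    rw [← sub_eq_zero]
    refine dvd_pow_of_isHausdorff (q := algebraMap A W ϖ) fun n => ?_
    have := (hmemI (n + 1) (x - y)).1 (Ideal.Quotient.eq.1 (hxy n))
    exact (pow_dvd_pow _ n.le_succ).trans this
  refine ⟨{ h with commutes' := fun a => ?_ }, fun x hx => ?_, fun i => ?_⟩
  · exact hext _ _ fun n => (hh n _).trans (((F n).1.commutes a))
  · obtain ⟨y, hy⟩ := (F 0).2.1 x hx
    have h1 := Ideal.Quotient.eq.1 ((hh 0 x).trans hy)
    rw [hmemI, zero_add, pow_one] at h1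
    exact (dvd_sub_left (dvd_mul_right _ _)).1 h1
  · exact hext _ _ fun n => (hh n _).trans ((F n).2.2 i)

/-- A minimal system of generators of the maximal ideal that extends `ϖ` defines a coordinate
system. -/
lemma isCoordinateSystem_of_spanFinrank {ϖ : A} (hR : IsRational ϖ R) {n : ℕ} {τ : Fin n → R}
    (h : Ideal.span (insert (algebraMap A R ϖ) (Set.range τ)) = maximalIdeal R)
    (hn : Submodule.spanFinrank (maximalIdeal R) = n + 1) : IsCoordinateSystem ϖ τ := by
  have hmem : ∀ i, τ i ∈ maximalIdeal R := fun i => by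
    rw [← h]; exact Ideal.subset_span (Or.inr ⟨i, rfl⟩)
  have hϖ : algebraMap A R ϖ ∈ maximalIdeal R := (hR.mem_iff ϖ).2 dvd_rfl
  refine ⟨hmem, h.symm.le.trans le_sup_left, fun c => ?_⟩
  -- The index `none` stands for `ϖ`. The resulting `n + 1` classes span a cotangent space of
  -- dimension `n + 1`, so they are a basis and functionals on it can be prescribed.
  let v : Option (Fin n) → maximalIdeal R := fun o => o.elim ⟨_, hϖ⟩ fun i => ⟨τ i, hmem i⟩
  have hfg : (maximalIdeal R).FG := by
    rw [← h]
    exact Submodule.fg_span ((Set.finite_range τ).insert _)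
  have hv : Submodule.span R (Set.range v) = ⊤ := by
    apply Submodule.map_injective_of_injective (maximalIdeal R).injective_subtype
    rw [Submodule.map_span, Submodule.map_top, Submodule.range_subtype, ← Set.range_comp]
    have : Set.range ((maximalIdeal R).subtype ∘ v) = insert (algebraMap A R ϖ) (Set.range τ) := by
      ext x
      simp only [Set.mem_range, Option.exists, Set.mem_insert_iff]
      simp [v, eq_comm]
    rw [this]; exact h
  let b : Option (Fin n) → CotangentSpace R := fun o => (maximalIdeal R).toCotangent (v o)
  have hb : ⊤ ≤ Submodule.span (ResidueField R) (Set.range b) := by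
    rintro x -
    obtain ⟨y, rfl⟩ := (maximalIdeal R).toCotangent_surjective x
    have hy : y ∈ Submodule.span R (Set.range v) := hv ▸ Submodule.mem_top
    refine Submodule.span_induction (p := fun y _ => (maximalIdeal R).toCotangent y ∈
      Submodule.span (ResidueField R) (Set.range b)) ?_ ?_ ?_ ?_ hy
    · rintro _ ⟨o, rfl⟩; exact Submodule.subset_span ⟨o, rfl⟩
    · simp
    · intro _ _ _ _ h1 h2; rw [map_add]; exact add_mem h1 h2
    · intro a z _ hz
      rw [map_smul]
      have : a • (maximalIdeal R).toCotangent z =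
        (residue R a) • (maximalIdeal R).toCotangent z := rfl
      rw [this]
      exact Submodule.smul_mem _ _ hz
  have hcard : Fintype.card (Option (Fin n)) = Module.finrank (ResidueField R) (CotangentSpace R) := by
    rw [← spanFinrank_maximalIdeal_eq_finrank_cotangentSpace_of_fg hfg, hn]; simp
  have hli := linearIndependent_of_top_le_span_of_card_eq_finrank hb hcard
  let B := Module.Basis.mk hli hb
  -- The functional vanishes at the class of `ϖ`. Hence its value at `x - ρ x` does not depend on
  -- the choice of the scalar `ρ x`, and `x ↦ L (x - ρ x)` is a derivation over `A`.
  let L : CotangentSpace R →ₗ[ResidueField R] ResidueField R :=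
    B.constr (ResidueField R) fun o => o.elim 0 c
  have hL0 : L ((maximalIdeal R).toCotangent ⟨_, hϖ⟩) = 0 := by
    have := B.constr_basis (ResidueField R) (fun o => o.elim 0 c) none
    rwa [Module.Basis.mk_apply] at this
  have hLi : ∀ i, L ((maximalIdeal R).toCotangent ⟨_, hmem i⟩) = c i := by
    intro i
    have := B.constr_basis (ResidueField R) (fun o => o.elim 0 c) (some i)
    rwa [Module.Basis.mk_apply] at this
  choose ρ hρ using hR.exists_sub_mem
  let ℓ : maximalIdeal R → ResidueField R := fun y => L ((maximalIdeal R).toCotangent y)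
  have ℓadd : ∀ y z, ℓ (y + z) = ℓ y + ℓ z := fun y z => by simp [ℓ]
  have ℓsmul : ∀ (a : R) y, ℓ (a • y) = residue R a * ℓ y := fun a y => by
    simp only [ℓ, map_smul]
    have : a • (maximalIdeal R).toCotangent y =
        (residue R a) • (maximalIdeal R).toCotangent y := rfl
    rw [this, map_smul, smul_eq_mul]
  let D₀ : R → ResidueField R := fun x => ℓ ⟨_, hρ x⟩
  have key : ∀ (x : R) (a : A) (hx : x - algebraMap A R a ∈ maximalIdeal R),
      D₀ x = ℓ ⟨_, hx⟩ := by
    intro x a hx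
    have h1 : algebraMap A R (a - ρ x) ∈ maximalIdeal R := by
      have := sub_mem (hρ x) hx
      rw [map_sub]
      convert this using 1; ring
    obtain ⟨e, he⟩ := (hR.mem_iff _).1 h1
    have h2 : (⟨_, hρ x⟩ : maximalIdeal R) = ⟨_, hx⟩ + algebraMap A R e • ⟨_, hϖ⟩ := by
      apply Subtype.ext
      have : algebraMap A R a - algebraMap A R (ρ x) = algebraMap A R ϖ * algebraMap A R e := by
        rw [← map_sub, he, map_mul]
      simp only [Submodule.coe_add, Submodule.coe_smul, smul_eq_mul]
      linear_combination this
    simp only [D₀]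
    rw [h2, ℓadd, ℓsmul]
    simp [ℓ, hL0]
  have hκ : ∀ x, residue R (algebraMap A R (ρ x)) = residue R x := fun x =>
    ((Ideal.Quotient.eq).2 (hρ x)).symm
  have D₀alg : ∀ a, D₀ (algebraMap A R a) = 0 := fun a => by
    rw [key _ a (by simp)]
    have : (⟨_, (by simp : algebraMap A R a - algebraMap A R a ∈ maximalIdeal R)⟩ :
      maximalIdeal R) = (0 : R) • 0 := by ext; simp
    rw [this, ℓsmul]; simp
  have D₀mul : ∀ x y, D₀ (x * y) = residue R x * D₀ y + residue R y * D₀ x := by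
    intro x y
    have e : x * y - algebraMap A R (ρ x * ρ y) = x * (y - algebraMap A R (ρ y)) +
        algebraMap A R (ρ y) * (x - algebraMap A R (ρ x)) := by rw [map_mul]; ring
    have hxy : x * y - algebraMap A R (ρ x * ρ y) ∈ maximalIdeal R := by
      rw [e]
      exact add_mem (Ideal.mul_mem_left _ _ (hρ y)) (Ideal.mul_mem_left _ _ (hρ x))
    rw [key _ _ hxy]
    have : (⟨_, hxy⟩ : maximalIdeal R) = x • ⟨_, hρ y⟩ + algebraMap A R (ρ y) • ⟨_, hρ x⟩ :=
      Subtype.ext e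
    rw [this, ℓadd, ℓsmul, ℓsmul, hκ]
  have D₀add : ∀ x y, D₀ (x + y) = D₀ x + D₀ y := by
    intro x y
    have e : x + y - algebraMap A R (ρ x + ρ y) = (x - algebraMap A R (ρ x)) +
        (y - algebraMap A R (ρ y)) := by rw [map_add]; ring
    have hxy : x + y - algebraMap A R (ρ x + ρ y) ∈ maximalIdeal R := by
      rw [e]; exact add_mem (hρ x) (hρ y)
    rw [key _ _ hxy]
    have : (⟨_, hxy⟩ : maximalIdeal R) = ⟨_, hρ x⟩ + ⟨_, hρ y⟩ := Subtype.ext e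
    rw [this, ℓadd]
  refine ⟨Derivation.mk' { toFun := D₀, map_add' := D₀add, map_smul' := fun a x => ?_ }
    fun x y => ?_, fun i => ?_⟩
  · simp only [Algebra.smul_def, D₀mul, D₀alg, RingHom.id_apply]
    rw [mul_zero, add_zero]; rfl
  · exact D₀mul x y
  · change D₀ (τ i) = c i
    rw [key (τ i) 0 (by simpa using hmem i)]
    simp only [map_zero, sub_zero]
    exact hLi i

end Coordinates

/-! ### Restricted power series -/

section Restricted

variable {A : Type u} [CommRing A]

lemma isAdicComplete_span_singleton {q : A} (h : ∀ x : A, (∀ n, q ^ n ∣ x) → x = 0)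
    (h' : ∀ f : ℕ → A, (∀ n, q ^ n ∣ f (n + 1) - f n) → ∃ L, ∀ n, q ^ n ∣ L - f n) :
    IsAdicComplete (Ideal.span {q}) A := by
  have key : ∀ n (x y : A), x ≡ y [SMOD (Ideal.span {q} ^ n • ⊤ : Submodule A A)] ↔
      q ^ n ∣ x - y := fun n x y => by
    rw [SModEq.sub_mem, smul_eq_mul, Ideal.mul_top, Ideal.span_singleton_pow,
      Ideal.mem_span_singleton]
  have h1 : IsHausdorff (Ideal.span {q}) A :=
    ⟨fun x hx => h x fun n => by simpa using (key n x 0).1 (hx n)⟩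
  have h2 : IsPrecomplete (Ideal.span {q}) A := ⟨fun f hf => by
    obtain ⟨L, hL⟩ := h' f fun n => (key _ _ _).1 (hf n.le_succ).symm
    exact ⟨L, fun n => ((key _ _ _).2 (hL n)).symm⟩⟩
  exact {}

lemma exists_limit_of_isPrecomplete {q : A} [IsPrecomplete (Ideal.span {q}) A] (f : ℕ → A)
    (hf : ∀ n, q ^ n ∣ f (n + 1) - f n) : ∃ L, ∀ n, q ^ n ∣ L - f n := by
  have key : ∀ n (x y : A), x ≡ y [SMOD (Ideal.span {q} ^ n • ⊤ : Submodule A A)] ↔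
      q ^ n ∣ x - y := fun n x y => by
    rw [SModEq.sub_mem, smul_eq_mul, Ideal.mul_top, Ideal.span_singleton_pow,
      Ideal.mem_span_singleton]
  have h1 : ∀ {m n}, m ≤ n → f m ≡ f n [SMOD (Ideal.span {q} ^ m • ⊤ : Submodule A A)] := by
    intro m n hmn
    rw [key]
    induction n, hmn using Nat.le_induction with
    | base => simp
    | succ n hmn ih =>
      have := dvd_sub ih ((pow_dvd_pow q hmn).trans (hf n))
      rwa [sub_sub, add_sub_cancel] at this
  obtain ⟨L, hL⟩ := IsPrecomplete.prec (I := Ideal.span {q}) inferInstance h1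
  exact ⟨L, fun n => (key _ _ _).1 (hL n).symm⟩

/-- The algebra of power series whose coefficients tend to zero `ϖ`-adically. -/
def restrictedSeries (ϖ : A) (α : Type u) : Subalgebra A (MvPowerSeries α A) where
  carrier := {f | ∀ n, {J | ¬ ϖ ^ n ∣ MvPowerSeries.coeff J f}.Finite}
  mul_mem' := by
    classical
    intro f g hf hg n
    -- A coefficient of the product escapes divisibility by `ϖ ^ n` only if its exponent is a sum of
    -- two exceptional exponents, one for each factor; the sumset of two finite sets is finite.
    refine ((hf n).add (hg n)).subset fun J hJ => ?_
    by_contra hJ'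
    refine hJ ?_
    rw [MvPowerSeries.coeff_mul]
    refine Finset.dvd_sum fun x hx => ?_
    rw [Finset.HasAntidiagonal.mem_antidiagonal] at hx
    by_cases h1 : ϖ ^ n ∣ MvPowerSeries.coeff x.1 f
    · exact dvd_mul_of_dvd_left h1 _
    by_cases h2 : ϖ ^ n ∣ MvPowerSeries.coeff x.2 g
    · exact dvd_mul_of_dvd_right h2 _
    exact (hJ' ⟨x.1, h1, x.2, h2, hx⟩).elim
  add_mem' := by
    intro f g hf hg n
    refine ((hf n).union (hg n)).subset fun J hJ => ?_
    by_contra hJ'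
    simp only [Set.mem_union, Set.mem_ofPred_eq, not_or, not_not] at hJ' hJ
    exact hJ (by rw [map_add]; exact dvd_add hJ'.1 hJ'.2)
  algebraMap_mem' := by
    classical
    intro a n
    refine (Set.finite_singleton 0).subset fun J hJ => ?_
    by_contra hJ'
    refine hJ ?_
    rw [← MvPowerSeries.c_eq_algebraMap, MvPowerSeries.coeff_C, if_neg (by simpa using hJ')]
    exact dvd_zero _

namespace restrictedSeries

variable {ϖ : A} {α : Type u}

/-- The coefficients of a restricted power series. -/
abbrev coeff (J : α →₀ ℕ) (f : restrictedSeries ϖ α) : A := MvPowerSeries.coeff J f.1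

lemma coeff_sub (J : α →₀ ℕ) (f g : restrictedSeries ϖ α) :
    coeff J (f - g) = coeff J f - coeff J g := by
  simp [coeff]

/-- Regularity of `ϖ` ensures that the quotient series is again restricted: if `ϖ ^ (n + m)` divides
`ϖ ^ n * c`, then `ϖ ^ m` divides `c`. -/
lemma pow_dvd_iff (hϖ : IsLeftRegular ϖ) (n : ℕ) (f : restrictedSeries ϖ α) :
    algebraMap A (restrictedSeries ϖ α) ϖ ^ n ∣ f ↔ ∀ J, ϖ ^ n ∣ coeff J f := by
  have hco : ∀ (a : A) (g : restrictedSeries ϖ α) J, coeff J (algebraMap A _ a * g) =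
      a * coeff J g := fun a g J => by
    rw [← Algebra.smul_def]
    exact MvPowerSeries.coeff_smul g.1 J a
  constructor
  · rintro ⟨g, rfl⟩ J
    rw [← map_pow, hco]
    exact dvd_mul_right _ _
  · intro h
    choose c hc using h
    have hcoe : ∀ J, MvPowerSeries.coeff J (c : MvPowerSeries α A) = c J := fun J => rfl
    refine ⟨⟨c, fun m => (f.2 (n + m)).subset fun J hJ h => hJ ?_⟩, ?_⟩
    · have h1 : ϖ ^ (n + m) ∣ ϖ ^ n * c J := by rw [← hc]; exact h
      obtain ⟨d, hd⟩ := h1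
      rw [pow_add, mul_assoc] at hd
      exact ⟨d, (hϖ.pow n) hd⟩
    · apply Subtype.ext
      ext J
      rw [← map_pow]
      exact (hc J).trans (hco _ ⟨c, _⟩ J).symm

-- By `pow_dvd_iff` congruences are tested on coefficients, so limits are formed coefficientwise.
-- The limit is restricted because modulo `ϖ ^ n` it agrees with the `n`-th term of the sequence.
variable (α) in
lemma isAdicComplete (hϖ : IsLeftRegular ϖ) [IsAdicComplete (Ideal.span {ϖ}) A] :
    IsAdicComplete (Ideal.span {algebraMap A (restrictedSeries ϖ α) ϖ})
      (restrictedSeries ϖ α) := by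
  refine isAdicComplete_span_singleton (fun f hf => ?_) fun f hf => ?_
  · apply Subtype.ext
    ext J
    exact dvd_pow_of_isHausdorff fun n => (pow_dvd_iff hϖ n f).1 (hf n) J
  · have h1 : ∀ J n, ϖ ^ n ∣ coeff J (f (n + 1)) - coeff J (f n) := fun J n => by
      rw [← coeff_sub]
      exact (pow_dvd_iff hϖ n _).1 (hf n) J
    choose L hL using fun J => exists_limit_of_isPrecomplete (fun n => coeff J (f n)) (h1 J)
    refine ⟨⟨L, fun n => ((f n).2 n).subset fun J hJ h => hJ ?_⟩, fun n => ?_⟩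
    · have := dvd_add (hL J n) h
      rw [sub_add_cancel] at this
      exact this
    · rw [pow_dvd_iff hϖ]
      intro J
      rw [coeff_sub]
      exact hL J n

/-- A polynomial as a restricted power series. -/
def ofPolynomial : MvPolynomial α A →ₐ[A] restrictedSeries ϖ α :=
  (MvPolynomial.coeToMvPowerSeries.algHom A).codRestrict _ fun p n =>
    p.support.finite_toSet.subset fun J hJ => by
      by_contra h
      have : MvPolynomial.coeff J p = 0 := by simpa using h
      refine hJ ?_
      have e : MvPowerSeries.coeff J (MvPolynomial.coeToMvPowerSeries.algHom A p) =
        MvPolynomial.coeff J p := by simp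
      rw [e, this]
      exact dvd_zero _

lemma coeff_ofPolynomial (J : α →₀ ℕ) (p : MvPolynomial α A) :
    coeff J (ofPolynomial (ϖ := ϖ) p) = p.coeff J := by
  exact MvPolynomial.coeff_coe p J

/-- The truncation of a restricted power series to a finite set of monomials. -/
def trunc (S : Finset (α →₀ ℕ)) (f : restrictedSeries ϖ α) : MvPolynomial α A :=
  ∑ J ∈ S, MvPolynomial.monomial J (coeff J f)

lemma pow_dvd_sub_trunc (hϖ : IsLeftRegular ϖ) (n : ℕ) (S : Finset (α →₀ ℕ))
    (f : restrictedSeries ϖ α) (hS : ∀ J ∉ S, ϖ ^ n ∣ coeff J f) :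
    algebraMap A (restrictedSeries ϖ α) ϖ ^ n ∣ f - ofPolynomial (trunc S f) := by
  classical
  rw [pow_dvd_iff hϖ]
  intro J
  rw [coeff_sub, coeff_ofPolynomial, trunc, MvPolynomial.coeff_sum]
  simp only [MvPolynomial.coeff_monomial]
  rw [Finset.sum_ite_eq' S J]
  split_ifs with h
  · simp
  · simpa using hS J h

lemma exists_polynomial (hϖ : IsLeftRegular ϖ) (n : ℕ) (f : restrictedSeries ϖ α) :
    ∃ p : MvPolynomial α A, algebraMap A (restrictedSeries ϖ α) ϖ ^ n ∣ f - ofPolynomial p := by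
  refine ⟨_, pow_dvd_sub_trunc hϖ n (f.2 n).toFinset f fun J hJ => ?_⟩
  simpa using hJ

lemma pow_dvd_aeval (hϖ : IsLeftRegular ϖ) (n : ℕ) (p : MvPolynomial α A) (a : α → A)
    (h : algebraMap A (restrictedSeries ϖ α) ϖ ^ n ∣ ofPolynomial p) :
    ϖ ^ n ∣ MvPolynomial.aeval a p := by
  rw [pow_dvd_iff hϖ] at h
  rw [MvPolynomial.aeval_def, MvPolynomial.eval₂_eq]
  refine Finset.dvd_sum fun J _ => dvd_mul_of_dvd_left ?_ _
  have := h J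
  rwa [coeff_ofPolynomial] at this

/-- Polynomials are dense and their evaluation preserves `ϖ`-adic congruences, so the values of
polynomial approximations converge. The limit does not depend on the approximations (`hE'`), and the
ring axioms are inherited from polynomials. -/
lemma exists_eval (hϖ : IsLeftRegular ϖ) [IsAdicComplete (Ideal.span {ϖ}) A] (a : α → A) :
    ∃ E : restrictedSeries ϖ α →ₐ[A] A, ∀ i, E (ofPolynomial (MvPolynomial.X i)) = a i := by
  choose P hP using fun n f => exists_polynomial (α := α) hϖ n f
  have hcomp : ∀ n m f (p q : MvPolynomial α A), n ≤ m →
      algebraMap A (restrictedSeries ϖ α) ϖ ^ n ∣ f - ofPolynomial p →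
      algebraMap A (restrictedSeries ϖ α) ϖ ^ m ∣ f - ofPolynomial q →
      ϖ ^ n ∣ MvPolynomial.aeval a q - MvPolynomial.aeval a p := by
    intro n m f p q hnm hp hq
    rw [← map_sub]
    apply pow_dvd_aeval hϖ
    have := dvd_sub hp ((pow_dvd_pow _ hnm).trans hq)
    rwa [sub_sub_sub_cancel_left, ← map_sub] at this
  choose E hE using fun f => exists_limit_of_isPrecomplete (q := ϖ)
    (fun n => MvPolynomial.aeval a (P n f))
    fun n => hcomp n (n + 1) f _ _ n.le_succ (hP _ _) (hP _ _)
  have hE' : ∀ n f p, algebraMap A (restrictedSeries ϖ α) ϖ ^ n ∣ f - ofPolynomial p →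
      ϖ ^ n ∣ E f - MvPolynomial.aeval a p := by
    intro n f p hp
    have := dvd_add (hE f n) (hcomp n n f p _ le_rfl hp (hP n f))
    rwa [sub_add_sub_cancel] at this
  have hext : ∀ x y : A, (∀ n, ϖ ^ n ∣ x - y) → x = y := fun x y h =>
    sub_eq_zero.1 (dvd_pow_of_isHausdorff h)
  have hpoly : ∀ p : MvPolynomial α A, E (ofPolynomial p) = MvPolynomial.aeval a p := fun p =>
    hext _ _ fun n => hE' n _ _ (by simp)
  refine ⟨
    { toFun := E
      map_one' := ?_
      map_mul' := ?_
      map_zero' := ?_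
      map_add' := ?_
      commutes' := ?_ }, fun i => ?_⟩
  · rw [← map_one ofPolynomial, hpoly, map_one]
  · intro f g
    refine hext _ _ fun n => ?_
    have h1 := hE' n (f * g) (P n f * P n g) (by
      have e : f * g - ofPolynomial (P n f * P n g) = (f - ofPolynomial (P n f)) * g +
        (g - ofPolynomial (P n g)) * ofPolynomial (P n f) := by rw [map_mul]; ring
      rw [e]
      exact dvd_add (dvd_mul_of_dvd_left (hP n f) _) (dvd_mul_of_dvd_left (hP n g) _))
    have h2 : ϖ ^ n ∣ E f * E g - MvPolynomial.aeval a (P n f * P n g) := by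
      have e : E f * E g - MvPolynomial.aeval a (P n f * P n g) =
        (E f - MvPolynomial.aeval a (P n f)) * E g +
        (E g - MvPolynomial.aeval a (P n g)) * MvPolynomial.aeval a (P n f) := by
        rw [map_mul]; ring
      rw [e]
      exact dvd_add (dvd_mul_of_dvd_left (hE f n) _) (dvd_mul_of_dvd_left (hE g n) _)
    have := dvd_sub h1 h2
    rwa [sub_sub_sub_cancel_right] at this
  · rw [← map_zero ofPolynomial, hpoly, map_zero]
  · intro f g
    refine hext _ _ fun n => ?_
    have h1 := hE' n (f + g) (P n f + P n g) (by
      rw [map_add, add_sub_add_comm]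
      exact dvd_add (hP n f) (hP n g))
    have h2 := dvd_add (hE f n) (hE g n)
    rw [← add_sub_add_comm, ← map_add] at h2
    have := dvd_sub h1 h2
    rwa [sub_sub_sub_cancel_right] at this
  · intro r
    rw [← AlgHom.commutes ofPolynomial, hpoly, AlgHom.commutes]
  · exact (hpoly _).trans (by simp)

/-- The evaluation of restricted power series. -/
def eval (hϖ : IsLeftRegular ϖ) [IsAdicComplete (Ideal.span {ϖ}) A] (a : α → A) :
    restrictedSeries ϖ α →ₐ[A] A :=
  (exists_eval hϖ a).choose

lemma eval_ofPolynomial (hϖ : IsLeftRegular ϖ) [IsAdicComplete (Ideal.span {ϖ}) A] (a : α → A)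
    (p : MvPolynomial α A) : eval hϖ a (ofPolynomial p) = MvPolynomial.aeval a p := by
  have : (eval hϖ a).comp ofPolynomial = MvPolynomial.aeval a := by
    ext i
    rw [MvPolynomial.aeval_X]
    exact (exists_eval hϖ a).choose_spec i
  exact DFunLike.congr_fun this p

lemma pow_dvd_eval (hϖ : IsLeftRegular ϖ) [IsAdicComplete (Ideal.span {ϖ}) A] (a : α → A)
    (n : ℕ) {f : restrictedSeries ϖ α} (h : algebraMap A (restrictedSeries ϖ α) ϖ ^ n ∣ f) :
    ϖ ^ n ∣ eval hϖ a f := by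
  have := map_dvd (eval hϖ a) h
  rwa [map_pow, AlgHom.commutes] at this

/-- Evaluation respects congruences of the arguments. -/
lemma pow_dvd_eval_sub_eval (hϖ : IsLeftRegular ϖ) [IsAdicComplete (Ideal.span {ϖ}) A]
    (a a' : α → A) (n : ℕ) (h : ∀ i, ϖ ^ n ∣ a i - a' i) (f : restrictedSeries ϖ α) :
    ϖ ^ n ∣ eval hϖ a f - eval hϖ a' f := by
  obtain ⟨p, hp⟩ := exists_polynomial hϖ n f
  have h1 := pow_dvd_eval hϖ a n hp
  have h2 := pow_dvd_eval hϖ a' n hp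
  rw [map_sub, eval_ofPolynomial] at h1 h2
  have h3 : ϖ ^ n ∣ MvPolynomial.aeval a p - MvPolynomial.aeval a' p := by
    rw [← Ideal.mem_span_singleton, ← Ideal.Quotient.eq]
    have : (Ideal.Quotient.mkₐ A (Ideal.span {ϖ ^ n})).comp (MvPolynomial.aeval a) =
        (Ideal.Quotient.mkₐ A (Ideal.span {ϖ ^ n})).comp (MvPolynomial.aeval a') := by
      ext i
      simpa [Ideal.Quotient.eq, Ideal.mem_span_singleton] using h i
    exact DFunLike.congr_fun this p
  have := dvd_add (dvd_sub h1 h2) h3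
  convert this using 1; ring

variable {p : ℕ} [Fact p.Prime] [Algebra ℤ_[p] A]

lemma pow_dvd_repr {k : Type*} (b : Module.Basis k ℤ_[p] A) {n : ℕ} {x : A}
    (h : (p : A) ^ n ∣ x) (j : k) : (p : ℤ_[p]) ^ n ∣ b.repr x j := by
  obtain ⟨y, rfl⟩ := h
  have : (p : A) ^ n * y = ((p : ℤ_[p]) ^ n) • y := by
    rw [Algebra.smul_def]; simp
  rw [this, map_smul, Finsupp.smul_apply, smul_eq_mul]
  exact dvd_mul_right _ _

/-- The coordinates of the values of a restricted power series at `ℤ_p`-points are given by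
convergent power series. -/
lemma exists_series_repr (hϖ : IsLeftRegular ϖ) [IsAdicComplete (Ideal.span {ϖ}) A] {e : ℕ}
    (he : (p : A) ∣ ϖ ^ e) {k : Type*} (b : Module.Basis k ℤ_[p] A) (j : k)
    (f : restrictedSeries ϖ α) :
    ∃ g : MvPowerSeries α ℤ_[p], MvPowerSeries.IsRestricted (fun _ => (1 : ℝ)) g ∧
      ∀ z : α → ℤ_[p],
        HasSum (fun J : α →₀ ℕ => MvPowerSeries.coeff J g * J.prod fun i a => z i ^ a)
          (b.repr (eval hϖ (fun i => algebraMap ℤ_[p] A (z i)) f) j) := by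
  have hp : ∀ n x, ϖ ^ (e * n) ∣ x → (p : ℤ_[p]) ^ n ∣ b.repr x j := fun n x h =>
    pow_dvd_repr b ((by rw [pow_mul]; exact pow_dvd_pow_of_dvd he n :
      (p : A) ^ n ∣ ϖ ^ (e * n)).trans h) j
  have hnorm : ∀ ε > 0, ∃ n : ℕ, ∀ x : ℤ_[p], (p : ℤ_[p]) ^ n ∣ x → ‖x‖ < ε := by
    intro ε hε
    obtain ⟨n, hn⟩ := exists_pow_lt_of_lt_one hε
      (inv_lt_one_of_one_lt₀ (by exact_mod_cast (Fact.out : p.Prime).one_lt : (1 : ℝ) < p))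
    refine ⟨n, fun x hx => ?_⟩
    have := (PadicInt.norm_le_pow_iff_mem_span_pow x n).2 (Ideal.mem_span_singleton.2 hx)
    refine this.trans_lt ?_
    rwa [zpow_neg, zpow_natCast, ← inv_pow]
  -- Monomials take values in `ℤ_p` at `ℤ_p`-points and the `j`-th coordinate is `ℤ_p`-linear, so it
  -- can be applied to each coefficient. The inequality of valuations in `hp` turns `ϖ`-adic
  -- smallness into `p`-adic smallness.
  let g : MvPowerSeries α ℤ_[p] := fun J => b.repr (coeff J f) j
  have hg : ∀ J, MvPowerSeries.coeff J g = b.repr (coeff J f) j := fun J => rfl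
  refine ⟨g, ?_, fun z => ?_⟩
  · rw [MvPowerSeries.IsRestricted, Metric.tendsto_nhds]
    intro ε hε
    obtain ⟨n, hn⟩ := hnorm ε hε
    refine (f.2 (e * n)).subset fun J hJ h => hJ ?_
    simp only [hg]
    simpa using hn _ (hp n _ h)
  · rw [HasSum, SummationFilter.unconditional_filter, Metric.tendsto_nhds]
    intro ε hε
    obtain ⟨n, hn⟩ := hnorm ε hε
    filter_upwards [Filter.eventually_ge_atTop (f.2 (e * n)).toFinset] with S hS
    rw [dist_comm, dist_eq_norm]
    apply hn
    have h1 := pow_dvd_eval hϖ (fun i => algebraMap ℤ_[p] A (z i)) (e * n)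
      (pow_dvd_sub_trunc hϖ (e * n) S f fun J hJ => by
        by_contra h
        exact hJ (hS (by simpa using h)))
    have h2 := hp _ _ h1
    rw [map_sub, eval_ofPolynomial, map_sub, Finsupp.sub_apply] at h2
    convert h2 using 2
    rw [trunc, map_sum, map_sum, Finsupp.finsetSum_apply]
    refine Finset.sum_congr rfl fun J _ => ?_
    rw [hg, MvPolynomial.aeval_monomial, Algebra.algebraMap_self, RingHom.id_apply]
    have : (J.prod fun i a => algebraMap ℤ_[p] A (z i) ^ a) =
        algebraMap ℤ_[p] A (J.prod fun i a => z i ^ a) := by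
      simp [Finsupp.prod, map_prod]
    rw [this, mul_comm (coeff J f), ← Algebra.smul_def, map_smul, Finsupp.smul_apply, smul_eq_mul,
      mul_comm]

end restrictedSeries

end Restricted

/-! ### The structure of the ring `𝒪_K ⊗ ℤ_p` -/

section Structure

variable {p : ℕ} [Fact p.Prime] {K : Type u} [Field K] [NumberField K]

lemma pow_dvd_iff_repr {A : Type*} [CommRing A] [Algebra ℤ_[p] A] {k : Type*} [Finite k]
    (b : Module.Basis k ℤ_[p] A) (n : ℕ) (x : A) :
    (p : A) ^ n ∣ x ↔ ∀ j, (p : ℤ_[p]) ^ n ∣ b.repr x j := by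
  have := Fintype.ofFinite k
  refine ⟨fun h j => restrictedSeries.pow_dvd_repr b h j, fun h => ?_⟩
  choose c hc using h
  refine ⟨∑ j, c j • b j, ?_⟩
  rw [← b.sum_repr x, Finset.mul_sum]
  refine Finset.sum_congr rfl fun j _ => ?_
  rw [hc, mul_smul, Algebra.smul_def ((p : ℤ_[p]) ^ n)]
  simp

lemma isAdicComplete_of_basis {A : Type*} [CommRing A] [Algebra ℤ_[p] A] {k : Type*} [Finite k]
    (b : Module.Basis k ℤ_[p] A) : IsAdicComplete (Ideal.span {(p : A)}) A := by
  have := Fintype.ofFinite k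
  have hZ : IsAdicComplete (Ideal.span {(p : ℤ_[p])}) ℤ_[p] := by
    rw [← PadicInt.maximalIdeal_eq_span_p]
    infer_instance
  refine isAdicComplete_span_singleton (fun x hx => ?_) fun f hf => ?_
  · apply b.repr.injective
    ext j
    rw [map_zero, Finsupp.zero_apply]
    exact dvd_pow_of_isHausdorff fun n => (pow_dvd_iff_repr b n x).1 (hx n) j
  · choose L hL using fun j => exists_limit_of_isPrecomplete (q := (p : ℤ_[p]))
      (fun n => b.repr (f n) j) fun n => by
        simpa using (pow_dvd_iff_repr b n _).1 (hf n) j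
    refine ⟨∑ j, L j • b j, fun n => (pow_dvd_iff_repr b n _).2 fun j => ?_⟩
    rw [map_sub, Finsupp.sub_apply, b.repr_sum_self]
    exact hL j n

lemma isLeftRegular_of_basis {A : Type*} [CommRing A] [Algebra ℤ_[p] A] {k : Type*}
    (b : Module.Basis k ℤ_[p] A) : IsLeftRegular (p : A) := by
  rw [isLeftRegular_iff_right_eq_zero_of_mul]
  intro x hx
  apply b.repr.injective
  ext j
  have : (p : ℤ_[p]) • x = 0 := by rw [Algebra.smul_def]; simpa using hx
  have h := DFunLike.congr_fun (congrArg b.repr this) j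
  rw [map_smul, map_zero, Finsupp.smul_apply, smul_eq_mul, Finsupp.zero_apply] at h
  have hp : (p : ℤ_[p]) ≠ 0 := by exact_mod_cast (Fact.out : p.Prime).ne_zero
  simpa [hp] using h

/-- Completeness with respect to an equivalent principal ideal. -/
lemma isAdicComplete_of_dvd_pow {A : Type*} [CommRing A] {q r : A}
    [IsAdicComplete (Ideal.span {q}) A] (h : r ∣ q) {e : ℕ} (h' : q ∣ r ^ e) :
    IsAdicComplete (Ideal.span {r}) A := by
  have h'' : q ∣ r ^ (e + 1) := h'.trans (pow_dvd_pow _ e.le_succ)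
  have key : ∀ n, q ^ n ∣ r ^ ((e + 1) * n) := fun n => by
    rw [pow_mul]; exact pow_dvd_pow_of_dvd h'' n
  refine isAdicComplete_span_singleton (fun x hx => ?_) fun f hf => ?_
  · exact dvd_pow_of_isHausdorff (q := q) fun n => (key n).trans (hx _)
  · have hmn : ∀ m n, m ≤ n → r ^ m ∣ f n - f m := by
      intro m n hmn
      induction n, hmn using Nat.le_induction with
      | base => simp
      | succ n hmn ih =>
        have := dvd_add ((pow_dvd_pow r hmn).trans (hf n)) ih
        rwa [sub_add_sub_cancel] at this
    obtain ⟨L, hL⟩ := exists_limit_of_isPrecomplete (q := q) (fun n => f ((e + 1) * n)) fun n =>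
      (key n).trans (hmn _ _ (Nat.mul_le_mul_left _ n.le_succ))
    refine ⟨L, fun n => ?_⟩
    have := dvd_add ((pow_dvd_pow_of_dvd h n).trans (hL n))
      (hmn n ((e + 1) * n) (Nat.le_mul_of_pos_left n e.succ_pos))
    rwa [sub_add_sub_cancel] at this

variable (p K) in
/-- A basis of `𝒪_K ⊗ ℤ_p`. -/
def OKpBasis : Module.Basis (Module.Free.ChooseBasisIndex ℤ (𝓞 K)) ℤ_[p] (OKp p K) :=
  Algebra.TensorProduct.basis ℤ_[p] (Module.Free.chooseBasis ℤ (𝓞 K))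

instance : IsAdicComplete (Ideal.span {(p : OKp p K)}) (OKp p K) :=
  isAdicComplete_of_basis (OKpBasis p K)

/-- Integers represent all classes of `ℤ_p` modulo `p`. Consequently an ideal of `𝒪_{K,p}` that
contains `p` is determined by its elements from `𝒪_K`. -/
lemma exists_toOKp_add (x : OKp p K) : ∃ y z, x = toOKp p K y + (p : OKp p K) * z := by
  induction x using TensorProduct.induction_on with
  | zero => exact ⟨0, 0, by simp⟩
  | add x y hx hy =>
    obtain ⟨a, b, rfl⟩ := hx
    obtain ⟨c, d, rfl⟩ := hy
    exact ⟨a + c, b + d, by rw [map_add]; ring⟩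
  | tmul a y =>
    obtain ⟨n, hn⟩ : ∃ n : ℕ, (p : ℤ_[p]) ∣ a - n := ⟨a.zmodRepr, by
      rw [← Ideal.mem_span_singleton, ← PadicInt.maximalIdeal_eq_span_p]
      exact PadicInt.sub_zmodRepr_mem a⟩
    obtain ⟨a', ha'⟩ := hn
    refine ⟨n * y, a' ⊗ₜ y, ?_⟩
    have hnat : ∀ n : ℕ, (n : OKp p K) = ((n : ℤ_[p]) ⊗ₜ[ℤ] (1 : 𝓞 K)) := fun n =>
      (map_natCast (algebraMap ℤ_[p] (OKp p K)) n).symm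
    have h2 : toOKp p K (n * y) = (n : ℤ_[p]) ⊗ₜ[ℤ] y := by
      rw [map_mul, map_natCast]
      rw [hnat]
      change _ * ((1 : ℤ_[p]) ⊗ₜ[ℤ] y) = _
      simp
    rw [hnat p, h2, Algebra.TensorProduct.tmul_mul_tmul, one_mul, ← ha', ← TensorProduct.add_tmul]
    simp

lemma map_comap_toOKp (v : MaximalSpectrum (OKp p K)) :
    (v.asIdeal.comap (toOKp p K)).map (toOKp p K) = v.asIdeal := by
  refine le_antisymm Ideal.map_comap_le fun x hx => ?_
  have hp : (p : OKp p K) ∈ (v.asIdeal.comap (toOKp p K)).map (toOKp p K) := by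
    have : (p : 𝓞 K) ∈ v.asIdeal.comap (toOKp p K) := by simpa using p_mem v
    simpa using Ideal.mem_map_of_mem (toOKp p K) this
  obtain ⟨y, z, rfl⟩ := exists_toOKp_add x
  have hy : toOKp p K y ∈ v.asIdeal := by
    have := v.asIdeal.sub_mem hx (v.asIdeal.mul_mem_right z (p_mem v))
    simpa using this
  exact add_mem (Ideal.mem_map_of_mem _ hy) (Ideal.mul_mem_right _ _ hp)

instance : Finite (MaximalSpectrum (OKp p K)) := by
  have hZ : (Ideal.span {(p : ℤ)}).IsMaximal :=
    PrincipalIdealRing.isMaximal_of_irreducible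
      (Nat.prime_iff_prime_int.1 (Fact.out : p.Prime)).irreducible
  have hf := IsDedekindDomain.primesOver_finite (Ideal.span {(p : ℤ)}) (𝓞 K)
  have : Finite ((Ideal.span {(p : ℤ)}).primesOver (𝓞 K)) := hf
  refine Finite.of_injective (fun v : MaximalSpectrum (OKp p K) =>
    (⟨v.asIdeal.comap (toOKp p K), Ideal.comap_isPrime _ _, ⟨?_⟩⟩ :
      (Ideal.span {(p : ℤ)}).primesOver (𝓞 K))) fun v w h => ?_
  · refine hZ.eq_of_le (Ideal.IsPrime.ne_top inferInstance) ?_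
    rw [Ideal.span_singleton_le_iff_mem]
    simpa [Ideal.under] using p_mem v
  · have h1 : v.asIdeal.comap (toOKp p K) = w.asIdeal.comap (toOKp p K) := congrArg Subtype.val h
    apply MaximalSpectrum.ext
    rw [← map_comap_toOKp v, ← map_comap_toOKp w, h1]

-- By integrality over the local ring `ℤ_p`, a prime that contains `p` lies over the maximal ideal
-- of `ℤ_p` and is therefore itself maximal.
variable (p K) in
lemma radical_span_p :
    (Ideal.span {(p : OKp p K)}).radical = ⨅ v : MaximalSpectrum (OKp p K), v.asIdeal := by
  refine le_antisymm (le_iInf fun v => ?_) ?_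
  · rw [Ideal.IsPrime.radical_le_iff inferInstance]
    exact (Ideal.span_singleton_le_iff_mem _).2 (p_mem v)
  · rw [Ideal.radical_eq_sInf]
    refine le_sInf fun q ⟨hq, hq'⟩ => ?_
    have h1 : (q.comap (algebraMap ℤ_[p] (OKp p K))).IsMaximal := by
      have h2 : IsLocalRing.maximalIdeal ℤ_[p] ≤ q.comap (algebraMap ℤ_[p] (OKp p K)) := by
        rw [PadicInt.maximalIdeal_eq_span_p, Ideal.span_singleton_le_iff_mem]
        simpa using (Ideal.span_singleton_le_iff_mem _).1 hq
      have := (IsLocalRing.maximalIdeal.isMaximal ℤ_[p]).eq_of_le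
        (Ideal.IsPrime.ne_top (Ideal.comap_isPrime _ _)) h2
      rw [← this]
      infer_instance
    exact iInf_le (fun v : MaximalSpectrum (OKp p K) => v.asIdeal)
      ⟨q, Ideal.isMaximal_of_isIntegral_of_isMaximal_comap q h1⟩

lemma mem_jacobson_of_forall_mem {x : OKp p K}
    (h : ∀ v : MaximalSpectrum (OKp p K), x ∈ v.asIdeal) : IsUnit (1 - x) := by
  by_contra hx
  obtain ⟨M, hM, hxM⟩ := exists_max_ideal_of_mem_nonunits hx
  have := add_mem hxM (h ⟨M, hM⟩)
  rw [sub_add_cancel] at this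
  exact hM.ne_top ((Ideal.eq_top_iff_one _).2 this)

lemma eq_zero_of_isIdempotentElem {x : OKp p K} (hx : IsIdempotentElem x)
    (h : ∀ v : MaximalSpectrum (OKp p K), x ∈ v.asIdeal) : x = 0 := by
  have h1 := mem_jacobson_of_forall_mem h
  have h2 : (1 - x) * x = 0 := by rw [sub_mul, one_mul, hx.eq, sub_self]
  exact h1.mul_right_eq_zero.1 h2

/-- The Chinese remainder theorem gives an element that is idempotent modulo the radical of `(p)`.
It lifts to an idempotent modulo `p`, since the radical is nil there, and then to `𝒪_{K,p}` by
Hensel's lemma for `X ^ 2 - X`. -/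
lemma exists_idempotent (v : MaximalSpectrum (OKp p K)) :
    ∃ e : OKp p K, IsIdempotentElem e ∧ 1 - e ∈ v.asIdeal ∧ ∀ w ≠ v, e ∈ w.asIdeal := by
  classical
  have := Fintype.ofFinite (MaximalSpectrum (OKp p K))
  have hcop : Pairwise fun v w : MaximalSpectrum (OKp p K) => IsCoprime v.asIdeal w.asIdeal := by
    intro v w hvw
    rw [Ideal.isCoprime_iff_sup_eq]
    exact v.isMaximal.coprime_of_ne w.isMaximal fun h => hvw (MaximalSpectrum.ext h)
  obtain ⟨e₀, he₀⟩ := Ideal.pi_mkQ_surjective hcop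
    (fun w => Submodule.Quotient.mk (if w = v then 1 else 0))
  have he₁ : ∀ w : MaximalSpectrum (OKp p K), e₀ - (if w = v then 1 else 0) ∈ w.asIdeal := fun w =>
    (Submodule.Quotient.eq _).1 (congrFun he₀ w)
  have he₂ : 1 - e₀ ∈ v.asIdeal := by
    rw [← neg_sub, neg_mem_iff]
    simpa using he₁ v
  have he₃ : ∀ w ≠ v, e₀ ∈ w.asIdeal := fun w hw => by simpa [hw] using he₁ w
  have he₄ : e₀ * e₀ - e₀ ∈ (Ideal.span {(p : OKp p K)}).radical := by
    rw [radical_span_p, Ideal.mem_iInf]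
    intro w
    have : e₀ * e₀ - e₀ = -(e₀ * (1 - e₀)) := by ring
    rw [this, neg_mem_iff]
    by_cases hw : w = v
    · subst hw; exact Ideal.mul_mem_left _ _ he₂
    · exact Ideal.mul_mem_right _ _ (he₃ w hw)
  have hle : Ideal.span {(p : OKp p K)} ≤ (Ideal.span {(p : OKp p K)}).radical :=
    Ideal.le_radical
  obtain ⟨e₅, he₅, he₆⟩ := exists_isIdempotentElem_eq_of_ker_isNilpotent
    (Ideal.Quotient.factor hle) (fun x hx => by
      obtain ⟨x, rfl⟩ := Ideal.Quotient.mk_surjective x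
      rw [RingHom.mem_ker, Ideal.Quotient.factor_mk, Ideal.Quotient.eq_zero_iff_mem] at hx
      obtain ⟨n, hn⟩ := hx
      exact ⟨n, by rw [← map_pow, Ideal.Quotient.eq_zero_iff_mem]; exact hn⟩)
    (Ideal.Quotient.mk _ e₀) ⟨Ideal.Quotient.mk _ e₀, rfl⟩ (by
      rw [IsIdempotentElem, ← map_mul, Ideal.Quotient.eq]; exact he₄)
  obtain ⟨e₇, rfl⟩ := Ideal.Quotient.mk_surjective e₅
  rw [Ideal.Quotient.factor_mk, Ideal.Quotient.eq] at he₆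
  rw [IsIdempotentElem, ← map_mul, Ideal.Quotient.eq] at he₅
  obtain ⟨e, he, he'⟩ := HenselianRing.is_henselian (I := Ideal.span {(p : OKp p K)})
    (Polynomial.X ^ 2 - Polynomial.X) (by monicity!) e₇ (by simpa [pow_two] using he₅) (by
      -- The derivative `2 X - 1` is its own inverse at an idempotent: `(2 e - 1) ^ 2 - 1 = 4 (e ^ 2
      -- - e)`.
      refine IsUnit.of_mul_eq_one (Ideal.Quotient.mk _ (2 * e₇ - 1)) ?_
      rw [← map_mul, ← map_one (Ideal.Quotient.mk _), Ideal.Quotient.eq]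
      simp only [Polynomial.derivative_sub, Polynomial.derivative_X_pow, Polynomial.derivative_X,
        Polynomial.eval_sub, Polynomial.eval_mul, Polynomial.eval_one, Polynomial.eval_pow,
        Polynomial.eval_X, Nat.cast_ofNat, Polynomial.eval_C]
      have : (2 * e₇ ^ (2 - 1) - 1) * (2 * e₇ - 1) - 1 = 4 * (e₇ * e₇ - e₇) := by ring
      rw [this]
      exact Ideal.mul_mem_left _ _ he₅)
  have hmem : ∀ w : MaximalSpectrum (OKp p K), e - e₀ ∈ w.asIdeal := fun w => by
    have h1 : (Ideal.span {(p : OKp p K)}).radical ≤ w.asIdeal := by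
      rw [radical_span_p]; exact iInf_le _ w
    have := add_mem (h1 (hle he')) (h1 he₆)
    rwa [sub_add_sub_cancel] at this
  refine ⟨e, ?_, ?_, fun w hw => ?_⟩
  · simpa [Polynomial.IsRoot, sub_eq_zero, pow_two, IsIdempotentElem] using he
  · have := sub_mem he₂ (hmem v)
    rwa [sub_sub, add_sub_cancel] at this
  · have := add_mem (hmem w) (he₃ w hw)
    rwa [sub_add_cancel] at this

/-- The idempotent of `𝒪_{K,p}` that corresponds to a maximal ideal. -/
def idem (v : MaximalSpectrum (OKp p K)) : OKp p K := (exists_idempotent v).choose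

lemma idem_mul_self (v : MaximalSpectrum (OKp p K)) : idem v * idem v = idem v :=
  (exists_idempotent v).choose_spec.1

lemma one_sub_idem_mem (v : MaximalSpectrum (OKp p K)) : 1 - idem v ∈ v.asIdeal :=
  (exists_idempotent v).choose_spec.2.1

lemma idem_mem {v w : MaximalSpectrum (OKp p K)} (h : w ≠ v) : idem v ∈ w.asIdeal :=
  (exists_idempotent v).choose_spec.2.2 w h

lemma idem_notMem (v : MaximalSpectrum (OKp p K)) : idem v ∉ v.asIdeal := fun h =>
  v.isMaximal.ne_top ((Ideal.eq_top_iff_one _).2 (by simpa using add_mem (one_sub_idem_mem v) h))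

lemma idem_mul_idem {v w : MaximalSpectrum (OKp p K)} (h : w ≠ v) : idem v * idem w = 0 := by
  refine eq_zero_of_isIdempotentElem ?_ fun x => ?_
  · rw [IsIdempotentElem, mul_mul_mul_comm, idem_mul_self, idem_mul_self]
  · by_cases hx : x = v
    · exact Ideal.mul_mem_left _ _ (idem_mem (hx ▸ h.symm))
    · exact Ideal.mul_mem_right _ _ (idem_mem hx)

variable (p K) in
lemma sum_idem [Fintype (MaximalSpectrum (OKp p K))] :
    ∑ v : MaximalSpectrum (OKp p K), idem v = 1 := by
  classical
  have h1 : IsIdempotentElem (∑ v : MaximalSpectrum (OKp p K), idem v) := by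
    rw [IsIdempotentElem, Finset.sum_mul_sum]
    refine Finset.sum_congr rfl fun v _ => ?_
    rw [Finset.sum_eq_single v (fun w _ hw => idem_mul_idem hw) (by simp), idem_mul_self]
  have h2 := eq_zero_of_isIdempotentElem h1.one_sub fun v => by
    rw [← Finset.add_sum_erase _ _ (Finset.mem_univ v), ← sub_sub]
    exact sub_mem (one_sub_idem_mem v) (sum_mem fun w hw => idem_mem (Finset.ne_of_mem_erase hw).symm)
  exact (sub_eq_zero.1 h2).symm

lemma locMap_isUnit {v : MaximalSpectrum (OKp p K)} {x : OKp p K} (h : x ∉ v.asIdeal) :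
    IsUnit (locMap v x) :=
  IsLocalization.map_units (OKv v) (⟨x, h⟩ : v.asIdeal.primeCompl)

lemma locMap_idem (v : MaximalSpectrum (OKp p K)) : locMap v (idem v) = 1 := by
  refine (locMap_isUnit (idem_notMem v)).mul_left_cancel ?_
  rw [← map_mul, idem_mul_self, mul_one]

lemma locMap_idem_ne {v w : MaximalSpectrum (OKp p K)} (h : w ≠ v) : locMap w (idem v) = 0 := by
  refine (locMap_isUnit (idem_notMem w)).mul_left_cancel ?_
  rw [← map_mul, idem_mul_idem h.symm, map_zero, mul_zero]

/-- An element outside `v` becomes a unit when it is replaced by `1` at the other places. -/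
lemma isUnit_mul_idem_add {v : MaximalSpectrum (OKp p K)} {x : OKp p K} (h : x ∉ v.asIdeal) :
    IsUnit (x * idem v + (1 - idem v)) := by
  by_contra hx
  obtain ⟨M, hM, hxM⟩ := exists_max_ideal_of_mem_nonunits hx
  by_cases hv : (⟨M, hM⟩ : MaximalSpectrum (OKp p K)) = v
  · subst hv
    refine h ?_
    have h1 := one_sub_idem_mem (⟨M, hM⟩ : MaximalSpectrum (OKp p K))
    have h2 := add_mem (sub_mem hxM h1) (Ideal.mul_mem_left _ x h1)
    convert h2 using 1; ring
  · refine hM.ne_top ((Ideal.eq_top_iff_one _).2 ?_)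
    have h1 := idem_mem hv
    have h2 := sub_mem hxM (Ideal.mul_mem_left _ (x - 1) h1)
    convert h2 using 1; ring

/-- A denominator can be replaced by `1` at the other places. It becomes a unit of `𝒪_{K,p}` with
the same image in the localization, so no fractions are needed. -/
lemma locMap_surjective (v : MaximalSpectrum (OKp p K)) : Function.Surjective (locMap v) := by
  intro y
  obtain ⟨b, s, rfl⟩ := IsLocalization.exists_mk'_eq v.asIdeal.primeCompl y
  obtain ⟨u, hu⟩ := isUnit_mul_idem_add s.2
  refine ⟨b * ((u⁻¹ : (OKp p K)ˣ) : OKp p K), ?_⟩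
  rw [eq_comm, IsLocalization.mk'_eq_iff_eq_mul]
  change locMap v b = locMap v (b * _) * locMap v s
  have h1 : locMap v s = locMap v u := by
    rw [hu, map_add, map_mul, map_sub, locMap_idem]; simp
  rw [h1, ← map_mul, mul_assoc, Units.inv_mul, mul_one]

/-- Some element outside `v` kills `b`. Modified to be `1` at the other places it is a unit, and it
still kills the `v`-component of `b`. -/
lemma idem_mul_eq_zero {v : MaximalSpectrum (OKp p K)} {b : OKp p K} (h : locMap v b = 0) :
    idem v * b = 0 := by
  rw [← map_zero (locMap v)] at h
  obtain ⟨s, hs⟩ := (IsLocalization.eq_iff_exists v.asIdeal.primeCompl (OKv v)).1 h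
  rw [mul_zero] at hs
  refine (isUnit_mul_idem_add s.2).mul_right_eq_zero.1 ?_
  have : (s.1 * idem v + (1 - idem v)) * (idem v * b) =
    idem v * idem v * (s.1 * b) + (idem v - idem v * idem v) * b := by ring
  rw [this, hs, idem_mul_self]; simp

variable (p K) in
/-- The ring `𝒪_{K,p}` is the product of its localizations `𝒪_{K,𝔭}`. -/
lemma locMap_bijective :
    Function.Bijective (RingHom.pi fun v : MaximalSpectrum (OKp p K) => locMap v) := by
  classical
  have := Fintype.ofFinite (MaximalSpectrum (OKp p K))
  constructor
  · rw [injective_iff_map_eq_zero]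
    intro b hb
    rw [← one_mul b, ← sum_idem p K, Finset.sum_mul]
    exact Finset.sum_eq_zero fun v _ => idem_mul_eq_zero (congrFun hb v)
  · intro y
    choose b hb using fun v => locMap_surjective v (y v)
    refine ⟨∑ v, idem v * b v, funext fun w => ?_⟩
    change locMap w (∑ v, idem v * b v) = _
    rw [map_sum, Finset.sum_eq_single w (fun v _ hv => by
      rw [map_mul, locMap_idem_ne hv.symm, zero_mul]) (by simp), map_mul, locMap_idem, one_mul, hb]

lemma resToResidueField_red (v : MaximalSpectrum (OKp p K)) (x : OKp p K) :
    resToResidueField v (red p K x) = IsLocalRing.residue (OKv v) (locMap v x) := rfl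

variable (p K) in
lemma resToResidueField_bijective :
    Function.Bijective (RingHom.pi fun v : MaximalSpectrum (OKp p K) => resToResidueField v) := by
  constructor
  · rw [injective_iff_map_eq_zero]
    intro b hb
    obtain ⟨b, rfl⟩ := Ideal.Quotient.mk_surjective b
    refine Ideal.Quotient.eq_zero_iff_mem.2 ?_
    rw [radical_span_p, Ideal.mem_iInf]
    intro v
    have h1 : IsLocalRing.residue (OKv v) (locMap v b) = 0 := congrFun hb v
    rw [IsLocalRing.residue_eq_zero_iff] at h1
    exact (IsLocalization.AtPrime.to_map_mem_maximal_iff (OKv v) v.asIdeal b).1 h1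
  · intro y
    choose x hx using fun v => IsLocalRing.residue_surjective (R := OKv v) (y v)
    obtain ⟨b, hb⟩ := (locMap_bijective p K).2 x
    refine ⟨red p K b, funext fun v => ?_⟩
    change resToResidueField v (red p K b) = _
    rw [resToResidueField_red, ← hx]
    exact congrArg _ (congrFun hb v)

/-- The homomorphism from `𝒪_{K,p} / p ^ j` to `𝒪_{K,𝔭} / p ^ j`. -/
def modPowToLoc (j : ℕ) (v : MaximalSpectrum (OKp p K)) :
    ModPow p K j →+* OKv v ⧸ Ideal.span {(p : OKv v) ^ j} :=
  Ideal.Quotient.lift _ ((Ideal.Quotient.mk _).comp (locMap v)) fun a ha => by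
    obtain ⟨c, rfl⟩ := Ideal.mem_span_singleton.1 ha
    rw [RingHom.comp_apply, Ideal.Quotient.eq_zero_iff_mem, Ideal.mem_span_singleton, map_mul]
    simp

lemma modPowToLoc_modPow (j : ℕ) (v : MaximalSpectrum (OKp p K)) (x : OKp p K) :
    modPowToLoc j v (modPow p K j x) = Ideal.Quotient.mk _ (locMap v x) := rfl

variable (p K) in
lemma modPowToLoc_bijective (j : ℕ) :
    Function.Bijective (RingHom.pi fun v : MaximalSpectrum (OKp p K) => modPowToLoc j v) := by
  constructor
  · rw [injective_iff_map_eq_zero]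
    intro b hb
    obtain ⟨b, rfl⟩ := Ideal.Quotient.mk_surjective b
    refine Ideal.Quotient.eq_zero_iff_mem.2 ?_
    have h1 : ∀ v : MaximalSpectrum (OKp p K), (p : OKv v) ^ j ∣ locMap v b := fun v =>
      Ideal.mem_span_singleton.1 (Ideal.Quotient.eq_zero_iff_mem.1 (congrFun hb v))
    choose c hc using h1
    obtain ⟨d, hd⟩ := (locMap_bijective p K).2 c
    refine Ideal.mem_span_singleton.2 ⟨d, (locMap_bijective p K).1 (funext fun v => ?_)⟩
    have h2 : locMap v d = c v := congrFun hd v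
    change locMap v b = locMap v ((p : OKp p K) ^ j * d)
    rw [hc, map_mul, h2]
    simp
  · intro y
    choose x hx using fun v => Ideal.Quotient.mk_surjective (y v)
    obtain ⟨b, hb⟩ := (locMap_bijective p K).2 x
    refine ⟨modPow p K j b, funext fun v => ?_⟩
    change modPowToLoc j v (modPow p K j b) = _
    rw [modPowToLoc_modPow, ← hx]
    exact congrArg _ (congrFun hb v)

lemma isLeftRegular_p (v : MaximalSpectrum (OKp p K)) : IsLeftRegular (p : OKv v) := by
  rw [isLeftRegular_iff_right_eq_zero_of_mul]
  intro y hy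
  obtain ⟨b, rfl⟩ := locMap_surjective v y
  have h1 : locMap v (p * b) = 0 := by rw [map_mul, map_natCast, hy]
  have h2 := idem_mul_eq_zero h1
  have h3 : idem v * b = 0 := by
    refine isLeftRegular_of_basis (OKpBasis p K) ?_
    change (p : OKp p K) * _ = p * 0
    rw [mul_zero, ← h2]; ring
  have h4 := congrArg (locMap v) h3
  rwa [map_mul, locMap_idem, one_mul, map_zero] at h4

instance (v : MaximalSpectrum (OKp p K)) : Module.Finite ℤ_[p] (OKv v) :=
  Module.Finite.of_surjective (IsScalarTower.toAlgHom ℤ_[p] (OKp p K) (OKv v)).toLinearMap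
    (locMap_surjective v)

instance (v : MaximalSpectrum (OKp p K)) : Module.IsTorsionFree ℤ_[p] (OKv v) := by
  refine ⟨fun r hr => ?_⟩
  have hr0 : r ≠ 0 := hr.ne_zero
  intro x y hxy
  have h1 : r = (PadicInt.unitCoeff hr0 : ℤ_[p]) * (p : ℤ_[p]) ^ r.valuation :=
    PadicInt.unitCoeff_spec hr0
  simp only at hxy
  rw [h1, mul_smul, mul_smul] at hxy
  have h2 := (PadicInt.unitCoeff hr0).isUnit.smul_left_cancel.1 hxy
  rw [Algebra.smul_def, Algebra.smul_def] at h2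
  refine ((isLeftRegular_p v).pow r.valuation) ?_
  simpa using h2

instance (v : MaximalSpectrum (OKp p K)) : Module.Free ℤ_[p] (OKv v) :=
  Module.free_of_finite_type_torsion_free'

instance (v : MaximalSpectrum (OKp p K)) : IsAdicComplete (Ideal.span {(p : OKv v)}) (OKv v) :=
  isAdicComplete_of_basis (Module.finBasis ℤ_[p] (OKv v))

variable (p K) in
lemma sum_finrank [Fintype (MaximalSpectrum (OKp p K))] :
    ∑ v : MaximalSpectrum (OKp p K), Module.finrank ℤ_[p] (OKv v) = Module.finrank ℚ K := by
  have e : OKp p K ≃ₗ[ℤ_[p]] ∀ v : MaximalSpectrum (OKp p K), OKv v :=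
    LinearEquiv.ofBijective (LinearMap.pi fun v =>
      (IsScalarTower.toAlgHom ℤ_[p] (OKp p K) (OKv v)).toLinearMap) (locMap_bijective p K)
  rw [← Module.finrank_pi_fintype, ← e.finrank_eq, Module.finrank_baseChange,
    NumberField.RingOfIntegers.rank]

variable (p K) in
lemma card_sigma_fin (m : ℕ) {k : MaximalSpectrum (OKp p K) → ℕ}
    (b : ∀ v, Module.Basis (Fin (k v)) ℤ_[p] (OKv v)) :
    Nat.card (Σ v : MaximalSpectrum (OKp p K), Fin m × Fin (k v)) = Module.finrank ℚ K * m := by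
  have := Fintype.ofFinite (MaximalSpectrum (OKp p K))
  rw [Nat.card_eq_fintype_card, Fintype.card_sigma, ← sum_finrank p K, Finset.sum_mul]
  refine Finset.sum_congr rfl fun v _ => ?_
  rw [Module.finrank_eq_card_basis (b v)]
  simp [mul_comm]

lemma toOKv_isUnit {v : MaximalSpectrum (OKp p K)} {x : 𝓞 K}
    (h : x ∉ v.asIdeal.comap (toOKp p K)) : IsUnit (toOKv v x) :=
  locMap_isUnit h

lemma comap_toOKp_ne_bot (v : MaximalSpectrum (OKp p K)) :
    v.asIdeal.comap (toOKp p K) ≠ ⊥ := fun h => by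
  have h1 : (p : 𝓞 K) ∈ v.asIdeal.comap (toOKp p K) := by simpa using p_mem v
  rw [h, Ideal.mem_bot] at h1
  exact (Fact.out : p.Prime).ne_zero (by exact_mod_cast h1)

lemma map_locMap (v : MaximalSpectrum (OKp p K)) :
    (v.asIdeal.comap (toOKp p K)).map (toOKv v) = IsLocalRing.maximalIdeal (OKv v) := by
  rw [toOKv, ← Ideal.map_map, map_comap_toOKp]
  exact IsLocalization.AtPrime.map_eq_maximalIdeal v.asIdeal (OKv v)

/-- The rings `𝒪_{K,𝔭}` have uniformizers, and `p` is a power of a uniformizer up to a unit. -/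
lemma exists_uniformizer (v : MaximalSpectrum (OKp p K)) :
    ∃ q : OKv v, Ideal.span {q} = IsLocalRing.maximalIdeal (OKv v) ∧
      (p : OKv v) ∣ q ^ (v.asIdeal.comap (toOKp p K)).ramificationIdx ℤ := by
  set P := v.asIdeal.comap (toOKp p K) with hP
  have hPp : P.IsPrime := Ideal.comap_isPrime _ _
  have hP0 : P ≠ ⊥ := comap_toOKp_ne_bot v
  have hdvr := IsLocalization.AtPrime.isDiscreteValuationRing_of_dedekind_domain (𝓞 K) hP0
    (Localization.AtPrime P)
  -- The localization of `𝒪_K` at `P` is a discrete valuation ring in which `p` generates the `n`-th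
  -- power of the maximal ideal. The uniformizer and the divisibility are transported to `OKv v`
  -- along `f`.
  let f : Localization.AtPrime P →+* OKv v :=
    IsLocalization.lift (M := P.primeCompl) (g := toOKv v) fun x => toOKv_isUnit x.2
  have hf : f.comp (algebraMap (𝓞 K) (Localization.AtPrime P)) = toOKv v :=
    IsLocalization.lift_comp _
  have hmap : (IsLocalRing.maximalIdeal (Localization.AtPrime P)).map f =
      IsLocalRing.maximalIdeal (OKv v) := by
    rw [← map_locMap, ← Localization.AtPrime.map_eq_maximalIdeal, Ideal.map_map, hf]
  obtain ⟨q, hq⟩ := IsDiscreteValuationRing.exists_irreducible (Localization.AtPrime P)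
  have hpq : Ideal.span {(p : Localization.AtPrime P)} ≠ ⊥ := by
    rw [Ne, Ideal.span_singleton_eq_bot]
    have : (p : Localization.AtPrime P) = algebraMap (𝓞 K) _ (p : 𝓞 K) := by simp
    rw [this, IsLocalization.to_map_eq_zero_iff _ P.primeCompl_le_nonZeroDivisors]
    exact_mod_cast (Fact.out : p.Prime).ne_zero
  obtain ⟨n, hn⟩ := IsDiscreteValuationRing.ideal_eq_span_pow_irreducible hpq hq
  have hover : P.under ℤ = Ideal.span {(p : ℤ)} := by
    have hZ : (Ideal.span {(p : ℤ)}).IsMaximal :=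
      PrincipalIdealRing.isMaximal_of_irreducible
        (Nat.prime_iff_prime_int.1 (Fact.out : p.Prime)).irreducible
    refine (hZ.eq_of_le (Ideal.IsPrime.ne_top inferInstance) ?_).symm
    rw [Ideal.span_singleton_le_iff_mem]
    simpa [Ideal.under, hP] using p_mem v
  -- The ramification index is computed as the length of the local ring modulo `p`, and `p`
  -- generates the `n`-th power of its maximal ideal.
  have he : P.ramificationIdx ℤ = n := by
    have h1 : (Ideal.span {(p : ℤ)}).map (algebraMap ℤ (Localization.AtPrime P)) =
        IsLocalRing.maximalIdeal (Localization.AtPrime P) ^ n := by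
      rw [Ideal.map_span, Set.image_singleton, hq.maximalIdeal_eq, Ideal.span_singleton_pow, ← hn]
      simp
    rw [Ideal.ramificationIdx_def, hover, h1, hdvr.length_quotient_pow_maximalIdeal,
      ENat.toNat_natCast]
  refine ⟨f q, ?_, ?_⟩
  · rw [← hmap, hq.maximalIdeal_eq, Ideal.map_span, Set.image_singleton]
  · rw [he, ← map_pow, ← map_natCast f]
    exact map_dvd f (Ideal.mem_span_singleton.1 (hn ▸ Ideal.mem_span_singleton_self _))

/-! ### Uniformizers of `𝒪_{K,𝔭}` and divisibility by factorials -/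

section Uniformizer

variable {v : MaximalSpectrum (OKp p K)} {ϖ : OKv v}

lemma p_dvd_pow (hϖ : Ideal.span {ϖ} = IsLocalRing.maximalIdeal (OKv v)) :
    (p : OKv v) ∣ ϖ ^ (v.asIdeal.comap (toOKp p K)).ramificationIdx ℤ := by
  obtain ⟨q, hq, hq'⟩ := exists_uniformizer v
  refine hq'.trans (pow_dvd_pow_of_dvd ?_ _)
  rw [← Ideal.mem_span_singleton, hq, ← hϖ]
  exact Ideal.mem_span_singleton_self _

lemma uniformizer_dvd_p (hϖ : Ideal.span {ϖ} = IsLocalRing.maximalIdeal (OKv v)) :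
    ϖ ∣ (p : OKv v) := by
  rw [← Ideal.mem_span_singleton, hϖ]
  have := (IsLocalization.AtPrime.to_map_mem_maximal_iff (OKv v) v.asIdeal (p : OKp p K)).2
    (p_mem v)
  simpa using this

lemma isLeftRegular_uniformizer (hϖ : Ideal.span {ϖ} = IsLocalRing.maximalIdeal (OKv v)) :
    IsLeftRegular ϖ := by
  rw [isLeftRegular_iff_right_eq_zero_of_mul]
  intro x hx
  obtain ⟨c, hc⟩ := uniformizer_dvd_p hϖ
  refine isLeftRegular_p v ?_
  change (p : OKv v) * x = p * 0
  rw [hc, mul_zero, mul_right_comm, hx, zero_mul]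

lemma isAdicComplete_uniformizer (hϖ : Ideal.span {ϖ} = IsLocalRing.maximalIdeal (OKv v)) :
    IsAdicComplete (Ideal.span {ϖ}) (OKv v) :=
  isAdicComplete_of_dvd_pow (uniformizer_dvd_p hϖ) (p_dvd_pow hϖ)

/-- If the ramification index is less than `p - 1`, then `ϖ ^ (i - 1) / i!` is integral and tends
to zero. -/
lemma exists_factorial_mul (hϖ : Ideal.span {ϖ} = IsLocalRing.maximalIdeal (OKv v))
    (he : (v.asIdeal.comap (toOKp p K)).ramificationIdx ℤ < p - 1) :
    ∃ c : ℕ → OKv v, ∀ i, ((i + 1).factorial : OKv v) * c i = ϖ ^ i ∧ ϖ ^ (i / (p - 1)) ∣ c i := by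
  set e := (v.asIdeal.comap (toOKp p K)).ramificationIdx ℤ
  obtain ⟨d, hd⟩ := p_dvd_pow hϖ
  have key : ∀ i : ℕ, ∃ c : OKv v, ((i + 1).factorial : OKv v) * c = ϖ ^ i ∧
      ϖ ^ (i / (p - 1)) ∣ c := by
    intro i
    set N := (i + 1).factorial
    set a := padicValNat p N
    have hN : N ≠ 0 := Nat.factorial_ne_zero _
    obtain ⟨w, hw⟩ : p ^ a ∣ N := pow_padicValNat_dvd
    have hpw : ¬ p ∣ w := by
      rintro ⟨w', rfl⟩
      have : p ^ (a + 1) ∣ N := ⟨w', by rw [hw, pow_succ, mul_assoc]⟩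
      exact pow_succ_padicValNat_not_dvd hN this
    have hwu : IsUnit (w : OKv v) := by
      by_contra h
      have h1 : (w : OKv v) ∈ IsLocalRing.maximalIdeal (OKv v) := h
      have h2 : (p : OKv v) ∈ IsLocalRing.maximalIdeal (OKv v) := by
        rw [← hϖ]; exact Ideal.mem_span_singleton.2 (uniformizer_dvd_p hϖ)
      obtain ⟨x, y, hxy⟩ := Nat.isCoprime_iff_coprime.2
        (((Fact.out : p.Prime).coprime_iff_not_dvd).2 hpw)
      have h3 : (x : OKv v) * p + y * w = 1 := by exact_mod_cast congrArg (Int.cast (R := OKv v)) hxy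
      exact (IsLocalRing.maximalIdeal.isMaximal (OKv v)).ne_top ((Ideal.eq_top_iff_one _).2
        (h3 ▸ add_mem (Ideal.mul_mem_left _ _ h2) (Ideal.mul_mem_left _ _ h1)))
    obtain ⟨w', hw'⟩ := hwu.exists_right_inv
    -- Legendre's formula bounds `(p - 1) * a` strictly by `i + 1`, hence by `i`. As `p ^ a` divides
    -- `ϖ ^ (e * a)` and `e + 1 ≤ p - 1`, at least `i / (p - 1)` factors `ϖ` remain after the
    -- division by the factorial.
    have ha : (p - 1) * a ≤ i := Nat.lt_succ_iff.1
      (sub_one_mul_padicValNat_factorial_lt_of_ne_zero p i.succ_ne_zero)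
    have hle : e * a + i / (p - 1) ≤ i := by
      have h1 : 0 < p - 1 := by omega
      have h2 : a ≤ i / (p - 1) := (Nat.le_div_iff_mul_le h1).2 (by rwa [mul_comm])
      have h3 : (p - 1) * (i / (p - 1)) ≤ i := Nat.mul_div_le _ _
      calc e * a + i / (p - 1) ≤ e * (i / (p - 1)) + i / (p - 1) := by gcongr
        _ = (e + 1) * (i / (p - 1)) := by ring
        _ ≤ (p - 1) * (i / (p - 1)) := Nat.mul_le_mul_right _ he
        _ ≤ i := h3
    obtain ⟨r, hr⟩ := Nat.exists_eq_add_of_le hle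
    refine ⟨w' * d ^ a * ϖ ^ (i / (p - 1) + r), ?_, ?_⟩
    · calc (N : OKv v) * (w' * d ^ a * ϖ ^ (i / (p - 1) + r))
          = (w * w') * (p * d) ^ a * ϖ ^ (i / (p - 1) + r) := by
            rw [hw]; push_cast; ring
        _ = ϖ ^ i := by
            rw [hw', ← hd, one_mul, ← pow_mul, ← pow_add, ← add_assoc, ← hr]
    · rw [pow_add, ← mul_assoc, mul_right_comm]
      exact dvd_mul_left _ _
  choose c hc using key
  exact ⟨c, hc⟩

end Uniformizer

end Structure

/-! ### Morphisms from affine schemes that factor through a local scheme -/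

section Factor

lemma exists_hom_stalk_of_isUnit {Z : Scheme.{u}} {E : Type u} [CommRing E] {U : Z.Opens}
    (hU : IsAffineOpen U) {z : Z} (hzU : z ∈ U) (g : Γ(Z, U) ⟶ CommRingCat.of E)
    (hg : ∀ y : (hU.primeIdealOf ⟨z, hzU⟩).asIdeal.primeCompl, IsUnit (g.hom y)) :
    ∃ h : Z.presheaf.stalk z →+* E,
      Z.presheaf.germ U z hzU ≫ CommRingCat.ofHom h = g := by
  let := Z.presheaf.algebra_section_stalk ⟨z, hzU⟩
  have hloc := IsAffineOpen.isLocalization_stalk hU ⟨z, hzU⟩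
  refine ⟨IsLocalization.lift (M := (hU.primeIdealOf ⟨z, hzU⟩).asIdeal.primeCompl)
    (S := Z.presheaf.stalk z) hg, ?_⟩
  ext y
  exact IsLocalization.lift_eq hg y

/-- A morphism from an affine scheme that maps all closed points to `z` factors through the
spectrum of the local ring at `z`. -/
lemma exists_eq_map_fromSpecStalk {Z : Scheme.{u}} {E : Type u} [CommRing E]
    (P : Spec (CommRingCat.of E) ⟶ Z) (z : Z)
    (hz : ∀ q : PrimeSpectrum E, q.asIdeal.IsMaximal → P q = z) :
    ∃ h : Z.presheaf.stalk z →+* E,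
      Spec.map (CommRingCat.ofHom h) ≫ Z.fromSpecStalk z = P := by
  obtain ⟨_, ⟨U, hU, rfl⟩, hzU, -⟩ := Z.isBasis_affineOpens.exists_subset_of_mem_open
    (TopologicalSpace.Opens.mem_top z) isOpen_univ
  have hU : IsAffineOpen U := hU
  -- Every point specializes to a closed point, which is mapped into `U`; open sets are stable under
  -- generalization. So the whole morphism lands in one affine chart.
  have htop : (⊤ : (Spec (CommRingCat.of E)).Opens) ≤ P ⁻¹ᵁ U := by
    intro q _
    obtain ⟨M, hM, hqM⟩ := Ideal.exists_le_maximal q.asIdeal q.isPrime.ne_top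
    have h1 : P ⟨M, hM.isPrime⟩ ∈ U := by
      rw [hz ⟨M, hM.isPrime⟩ hM]; exact hzU
    have h2 : q ⤳ ⟨M, hM.isPrime⟩ := (PrimeSpectrum.le_iff_specializes _ _).1 hqM
    exact h2.mem_open (P ⁻¹ᵁ U).isOpen h1
  set g : Γ(Z, U) ⟶ CommRingCat.of E :=
    P.appLE U ⊤ htop ≫ (Scheme.ΓSpecIso (CommRingCat.of E)).hom with hg
  have hgP : Spec.map g ≫ IsAffineOpen.fromSpec hU = P := by
    have h1 := IsAffineOpen.SpecMap_appLE_fromSpec P hU (isAffineOpen_top _) htop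
    rw [hg, Spec.map_comp, Category.assoc, h1, IsAffineOpen.fromSpec_top]
    simp
  -- A function that does not vanish at `z` pulls back to one that vanishes at no closed point of
  -- `Spec E`, that is, to a unit. This is what extends the map to the stalk.
  have hunit : ∀ y : (hU.primeIdealOf ⟨z, hzU⟩).asIdeal.primeCompl, IsUnit (g.hom y) := by
    rintro ⟨y, hy⟩
    by_contra hn
    obtain ⟨M, hM, hyM⟩ := exists_max_ideal_of_mem_nonunits hn
    let q : Spec (CommRingCat.of E) := ⟨M, hM.isPrime⟩
    have h1 : IsAffineOpen.fromSpec hU (Spec.map g q) =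
        IsAffineOpen.fromSpec hU (hU.primeIdealOf ⟨z, hzU⟩) := by
      rw [← Scheme.Hom.comp_apply, hgP, IsAffineOpen.fromSpec_primeIdealOf]
      exact hz _ hM
    have h2 := (IsAffineOpen.fromSpec hU).isOpenEmbedding.injective h1
    apply hy
    rw [← h2]
    exact hyM
  obtain ⟨h, hh⟩ := exists_hom_stalk_of_isUnit hU hzU g hunit
  refine ⟨h, ?_⟩
  rw [← IsAffineOpen.fromSpecStalk_eq_fromSpecStalk hU hzU, IsAffineOpen.fromSpecStalk,
   ← Category.assoc, ← Spec.map_comp]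
  exact (congrArg (fun q => Spec.map q ≫ hU.fromSpec) hh).trans hgP

/-- Every maximal ideal contains the Jacobson radical, hence the kernel of `ψ`. Thus the position of
the closed points of `Spec E` can be tested after reduction along `ψ`. -/
lemma exists_isMaximal_of_surjective {E E₀ : Type*} [CommRing E] [CommRing E₀] (ψ : E →+* E₀)
    (hψ : Function.Surjective ψ) (hker : RingHom.ker ψ ≤ Ring.jacobson E)
    (q : PrimeSpectrum E) (hq : q.asIdeal.IsMaximal) :
    ∃ q₀ : PrimeSpectrum E₀, PrimeSpectrum.comap ψ q₀ = q := by
  have h1 : RingHom.ker ψ ≤ q.asIdeal := hker.trans (by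
    rw [← Ideal.jacobson_bot]
    exact sInf_le ⟨bot_le, hq⟩)
  have := (range_comap_of_surjective E₀ ψ hψ).symm.subset
    (show q ∈ PrimeSpectrum.zeroLocus _ from h1)
  exact this

end Factor

/-! ### Points of a scheme as homomorphisms from a local ring -/

section LocalPoints

variable {S : Type u} [CommRing S] {A : Type u} [CommRing A] [IsLocalRing A]
  {X Y : Over (Spec (CommRingCat.of S))} {φ : S →+* A}
  {x : specOver ((IsLocalRing.residue A).comp φ) ⟶ X} {E : Type u} [CommRing E]

/-- The morphism `Spec E ⟶ X` defined by a homomorphism from the local ring of `X_A` at `x`. -/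
def homPt (x : specOver ((IsLocalRing.residue A).comp φ) ⟶ X) (h : localRing φ x →+* E) :
    Spec (CommRingCat.of E) ⟶ X.left :=
  Spec.map (CommRingCat.ofHom h) ≫ (baseChange X φ).fromSpecStalk (residuePt φ x) ≫
    pullback.fst X.hom (Spec.map (CommRingCat.ofHom φ))

lemma fromSpecStalk_snd (x : specOver ((IsLocalRing.residue A).comp φ) ⟶ X) :
    (baseChange X φ).fromSpecStalk (residuePt φ x) ≫
      pullback.snd X.hom (Spec.map (CommRingCat.ofHom φ)) =
    Spec.map (CommRingCat.ofHom (structureMap φ x)) := by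
  rw [← cancel_mono (Spec (CommRingCat.of A)).toSpecΓ, Category.assoc, Scheme.toSpecΓ_naturality,
    ← Category.assoc, Scheme.fromSpecStalk_toSpecΓ, ← Spec.map_comp, ← SpecMap_ΓSpecIso_hom,
    ← Spec.map_comp]
  congr 1
  rw [structureMap, CommRingCat.ofHom_hom, Iso.hom_inv_id_assoc]

lemma liftPoint_eq (h : localRing φ x →+* E) (P : Spec (CommRingCat.of E) ⟶ baseChange X φ) :
    Spec.map (CommRingCat.ofHom h) ≫ (baseChange X φ).fromSpecStalk (residuePt φ x) = P ↔
      homPt x h = P ≫ pullback.fst X.hom (Spec.map (CommRingCat.ofHom φ)) ∧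
      Spec.map (CommRingCat.ofHom (h.comp (structureMap φ x))) =
        P ≫ pullback.snd X.hom (Spec.map (CommRingCat.ofHom φ)) := by
  rw [CommRingCat.ofHom_comp, Spec.map_comp, ← fromSpecStalk_snd]
  constructor
  · rintro rfl
    simp [homPt]
  · rintro ⟨h1, h2⟩
    apply pullback.hom_ext
    · rw [← h1, Category.assoc]; rfl
    · rw [← h2, Category.assoc]

lemma homPt_hom (h : localRing φ x →+* E) :
    homPt x h ≫ X.hom =
      Spec.map (CommRingCat.ofHom ((h.comp (structureMap φ x)).comp φ)) := by
  rw [homPt, Category.assoc, Category.assoc, pullback.condition]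
  rw [← Category.assoc (Scheme.fromSpecStalk _ _), fromSpecStalk_snd, ← Spec.map_comp,
    ← Spec.map_comp]
  rfl

lemma homPt_comp {E' : Type u} [CommRing E'] (h : localRing φ x →+* E) (g : E →+* E') :
    homPt x (g.comp h) = Spec.map (CommRingCat.ofHom g) ≫ homPt x h := by
  rw [homPt, homPt, CommRingCat.ofHom_comp, Spec.map_comp, Category.assoc]

/-- The two hypotheses are the two projections of the fibre product `X_A`, and the morphism from the
spectrum of a stalk to its scheme is a monomorphism. -/
lemma homPt_injective {h h' : localRing φ x →+* E} (h1 : homPt x h = homPt x h')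
    (h2 : h.comp (structureMap φ x) = h'.comp (structureMap φ x)) : h = h' := by
  have h3 := (liftPoint_eq h' _).1 rfl
  rw [← h1, ← h2] at h3
  have h4 := (liftPoint_eq h _).2 h3
  rw [cancel_mono] at h4
  have h5 := congrArg CommRingCat.Hom.hom (Spec.map_injective h4)
  exact h5

/-- A morphism from `Spec E` that reduces to the point `x` is given by a homomorphism from the
local ring at `x`. -/
lemma exists_homPt_eq {E₀ : Type u} [CommRing E₀] (x : specOver ((IsLocalRing.residue A).comp φ) ⟶ X)
    (P : Spec (CommRingCat.of E) ⟶ X.left) (a : A →+* E)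
    (hP : P ≫ X.hom = Spec.map (CommRingCat.ofHom (a.comp φ))) (ψ : E →+* E₀)
    (hψ : Function.Surjective ψ) (hker : RingHom.ker ψ ≤ Ring.jacobson E)
    (c : IsLocalRing.ResidueField A →+* E₀) (hc : c.comp (IsLocalRing.residue A) = ψ.comp a)
    (hx : Spec.map (CommRingCat.ofHom ψ) ≫ P = Spec.map (CommRingCat.ofHom c) ≫ x.left) :
    ∃ h : localRing φ x →+* E, homPt x h = P ∧ h.comp (structureMap φ x) = a := by
  set Q : Spec (CommRingCat.of E) ⟶ baseChange X φ :=
    pullback.lift P (Spec.map (CommRingCat.ofHom a)) (by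
      rw [hP, CommRingCat.ofHom_comp, Spec.map_comp]) with hQ
  have hQ1 : Spec.map (CommRingCat.ofHom ψ) ≫ Q =
      Spec.map (CommRingCat.ofHom c) ≫ liftPoint φ (IsLocalRing.residue A) x := by
    apply pullback.hom_ext
    · rw [Category.assoc, Category.assoc, liftPoint_fst, pullback.lift_fst, hx]
    · rw [Category.assoc, Category.assoc, liftPoint_snd, pullback.lift_snd, ← Spec.map_comp,
        ← Spec.map_comp, ← CommRingCat.ofHom_comp, ← CommRingCat.ofHom_comp, hc]
  -- A closed point of `Spec E` comes from `Spec E₀`, and there the morphism factors through the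
  -- spectrum of the residue field of `A`, which has a single point.
  obtain ⟨h, hh⟩ := exists_eq_map_fromSpecStalk Q (residuePt φ x) fun q hq => by
    obtain ⟨q₀, hq₀⟩ := exists_isMaximal_of_surjective ψ hψ hker q hq
    subst hq₀
    have h1 := (Scheme.Hom.comp_apply (Spec.map (CommRingCat.ofHom ψ)) Q q₀).symm
    rw [hQ1] at h1
    refine h1.trans ((Scheme.Hom.comp_apply _ _ _).trans ?_)
    refine congrArg (liftPoint φ (IsLocalRing.residue A) x) ?_
    exact Subsingleton.elim (α := PrimeSpectrum (IsLocalRing.ResidueField A)) _ _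
  have h2 := (liftPoint_eq h Q).1 hh
  rw [pullback.lift_fst, pullback.lift_snd] at h2
  refine ⟨h, h2.1, ?_⟩
  exact congrArg CommRingCat.Hom.hom (Spec.map_injective h2.2)

lemma homPt_evalAt (σ : specOver φ ⟶ X)
    (h : specOverMap φ (IsLocalRing.residue A) ≫ σ = x) :
    homPt x (evalAt φ x σ h) = σ.left ∧
      (evalAt φ x σ h).comp (structureMap φ x) = RingHom.id A := by
  have h1 := (liftPoint_eq (evalAt φ x σ h) (liftPoint φ (RingHom.id A) σ)).1 (by
    rw [evalAt, CommRingCat.ofHom_hom, Spec.map_comp, Category.assoc,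
      Scheme.SpecMap_stalkSpecializes_fromSpecStalk, Scheme.Spec_stalkClosedPointTo_fromSpecStalk])
  rw [liftPoint_fst, liftPoint_snd] at h1
  exact ⟨h1.1, congrArg CommRingCat.Hom.hom (Spec.map_injective h1.2)⟩

/-- The homomorphism from the local ring at `x` to the residue field of `A` given by `x`. -/
def residueHom (x : specOver ((IsLocalRing.residue A).comp φ) ⟶ X) :
    localRing φ x →+* IsLocalRing.ResidueField A :=
  (Scheme.stalkClosedPointTo (liftPoint φ (IsLocalRing.residue A) x)).hom

lemma homPt_residueHom (x : specOver ((IsLocalRing.residue A).comp φ) ⟶ X) :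
    homPt x (residueHom x) = x.left ∧
      (residueHom x).comp (structureMap φ x) = IsLocalRing.residue A := by
  have h1 := (liftPoint_eq (residueHom x) (liftPoint φ (IsLocalRing.residue A) x)).1 (by
    exact Scheme.Spec_stalkClosedPointTo_fromSpecStalk _)
  rw [liftPoint_fst, liftPoint_snd] at h1
  exact ⟨h1.1, congrArg CommRingCat.Hom.hom (Spec.map_injective h1.2)⟩

instance isLocalHom_residueHom (x : specOver ((IsLocalRing.residue A).comp φ) ⟶ X) :
    IsLocalHom (residueHom x) :=
  Scheme.isLocalHom_stalkClosedPointTo' _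

lemma homPt_localRingMap (f : X ⟶ Y) (h : localRing φ x →+* E) :
    homPt (x ≫ f) (h.comp (localRingMap φ x f)) = homPt x h ≫ f.left := by
  rw [homPt_comp, homPt, homPt, Category.assoc]
  congr 1
  rw [localRingMap, CommRingCat.ofHom_hom, Spec.map_comp, Category.assoc,
    ← Category.assoc (Spec.map ((baseChange Y φ).presheaf.stalkSpecializes _)),
    Scheme.SpecMap_stalkSpecializes_fromSpecStalk, ← Category.assoc,
    Scheme.SpecMap_stalkMap_fromSpecStalk, Category.assoc, Category.assoc, baseChangeMap_fst]

lemma localRingMap_structureMap (f : X ⟶ Y) :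
    (localRingMap φ x f).comp (structureMap φ (x ≫ f)) = structureMap φ x := by
  have h : Spec.map (CommRingCat.ofHom ((localRingMap φ x f).comp (structureMap φ (x ≫ f)))) =
      Spec.map (CommRingCat.ofHom (structureMap φ x)) := by
    rw [CommRingCat.ofHom_comp, Spec.map_comp, ← fromSpecStalk_snd, ← fromSpecStalk_snd,
      localRingMap, CommRingCat.ofHom_hom, Spec.map_comp, Category.assoc,
      ← Category.assoc (Spec.map ((baseChange Y φ).presheaf.stalkSpecializes _)),
      Scheme.SpecMap_stalkSpecializes_fromSpecStalk, ← Category.assoc,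
      Scheme.SpecMap_stalkMap_fromSpecStalk, Category.assoc, baseChangeMap_snd]
  exact congrArg CommRingCat.Hom.hom (Spec.map_injective h)

end LocalPoints

/-! ### Points with values in finite products of rings -/

section Products

variable {J : Type u} [Finite J] {B : Type u} [CommRing B] {C : J → Type u} [∀ j, CommRing (C j)]
  {π : ∀ j, B →+* C j} {X : Scheme.{u}}

lemma sigmaι_sigmaSpec_map (π : ∀ j, B →+* C j) (j : J) :
    Sigma.ι (fun j => Spec (CommRingCat.of (C j))) j ≫
      sigmaSpec (fun j => CommRingCat.of (C j)) ≫ Spec.map (CommRingCat.ofHom (RingHom.pi π)) =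
    Spec.map (CommRingCat.ofHom (π j)) := by
  rw [← Category.assoc, ι_sigmaSpec, ← Spec.map_comp]
  rfl

lemma isIso_specMap_of_bijective {B C : Type u} [CommRing B] [CommRing C] (f : B →+* C)
    (hf : Function.Bijective f) : IsIso (Spec.map (CommRingCat.ofHom f)) := by
  have : IsIso (CommRingCat.ofHom f) :=
    (RingEquiv.ofBijective f hf).toCommRingCatIso.isIso_hom
  infer_instance

lemma hom_ext_of_bijective (hπ : Function.Bijective (RingHom.pi π))
    {P P' : Spec (CommRingCat.of B) ⟶ X}
    (h : ∀ j, Spec.map (CommRingCat.ofHom (π j)) ≫ P = Spec.map (CommRingCat.ofHom (π j)) ≫ P') :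
    P = P' := by
  have := isIso_specMap_of_bijective _ hπ
  rw [← cancel_epi (sigmaSpec (fun j => CommRingCat.of (C j)) ≫
    Spec.map (CommRingCat.ofHom (RingHom.pi π)))]
  refine Sigma.hom_ext _ _ fun j => ?_
  have h1 := h j
  rw [← sigmaι_sigmaSpec_map π j] at h1
  simpa only [Category.assoc] using h1

lemma exists_hom_of_bijective (hπ : Function.Bijective (RingHom.pi π))
    (P : ∀ j, Spec (CommRingCat.of (C j)) ⟶ X) :
    ∃ Q : Spec (CommRingCat.of B) ⟶ X, ∀ j, Spec.map (CommRingCat.ofHom (π j)) ≫ Q = P j := by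
  have := isIso_specMap_of_bijective _ hπ
  refine ⟨inv (sigmaSpec (fun j => CommRingCat.of (C j)) ≫
    Spec.map (CommRingCat.ofHom (RingHom.pi π))) ≫ Sigma.desc P, fun j => ?_⟩
  rw [← sigmaι_sigmaSpec_map π j, Category.assoc, IsIso.hom_inv_id_assoc, Sigma.ι_desc]

end Products

/-! ### The local ring of a smooth scheme at a rational point -/

section LocalAlgebra

variable {S : Type u} [CommRing S] {A : Type u} [CommRing A] [IsLocalRing A]
  {X Y : Over (Spec (CommRingCat.of S))} {φ : S →+* A}
  {x : specOver ((IsLocalRing.residue A).comp φ) ⟶ X} {E : Type u} [CommRing E]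

instance algebraLocalRing (x : specOver ((IsLocalRing.residue A).comp φ) ⟶ X) :
    Algebra A (localRing φ x) :=
  (structureMap φ x).toAlgebra

lemma residueHom_algebraMap (a : A) :
    residueHom x (algebraMap A (localRing φ x) a) = IsLocalRing.residue A a :=
  RingHom.congr_fun (homPt_residueHom x).2 a

lemma mem_maximalIdeal_localRing {r : localRing φ x} :
    r ∈ IsLocalRing.maximalIdeal (localRing φ x) ↔ residueHom x r = 0 := by
  rw [IsLocalRing.mem_maximalIdeal, mem_nonunits_iff, ← isUnit_map_iff (residueHom x),
    isUnit_iff_ne_zero, not_not]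

lemma isRational_localRing {ϖ : A} (hϖ : Ideal.span {ϖ} = IsLocalRing.maximalIdeal A)
    (x : specOver ((IsLocalRing.residue A).comp φ) ⟶ X) : IsRational ϖ (localRing φ x) := by
  refine IsRational.of_span hϖ ⟨fun a ha => ?_⟩ fun r => ?_
  · have h := ha.map (residueHom x)
    rw [residueHom_algebraMap] at h
    exact (isUnit_map_iff (IsLocalRing.residue A) a).1 h
  · obtain ⟨a, ha⟩ := IsLocalRing.residue_surjective (residueHom x r)
    refine ⟨a, ?_⟩
    rw [mem_maximalIdeal_localRing, map_sub, residueHom_algebraMap, ha, sub_self]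

lemma formallySmooth_localRing (hX : Smooth X.hom)
    (x : specOver ((IsLocalRing.residue A).comp φ) ⟶ X) :
    Algebra.FormallySmooth A (localRing φ x) := by
  set z := residuePt φ x
  obtain ⟨_, ⟨U, hU, rfl⟩, hzU, -⟩ :=
    (baseChange X φ).isBasis_affineOpens.exists_subset_of_mem_open
      (TopologicalSpace.Opens.mem_top z) isOpen_univ
  have hU : IsAffineOpen U := hU
  have h1 := Smooth.smooth_appLE (pullback.snd X.hom (Spec.map (CommRingCat.ofHom φ)))
    (isAffineOpen_top _) hU le_top
  have h2 : (Scheme.ΓSpecIso (CommRingCat.of A)).inv.hom.FormallySmooth :=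
    RingHom.FormallySmooth.of_bijective
      (Scheme.ΓSpecIso (CommRingCat.of A)).symm.commRingCatIsoToRingEquiv.bijective
  have h3 : ((baseChange X φ).presheaf.germ U z hzU).hom.FormallySmooth := by
    let := (baseChange X φ).presheaf.algebra_section_stalk ⟨z, hzU⟩
    have hloc := IsAffineOpen.isLocalization_stalk hU ⟨z, hzU⟩
    exact Algebra.FormallySmooth.of_isLocalization (hU.primeIdealOf ⟨z, hzU⟩).asIdeal.primeCompl
  have h4 := (h2.comp h1.formallySmooth).comp h3
  have h5 : structureMap φ x = ((baseChange X φ).presheaf.germ U z hzU).hom.comp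
      ((Scheme.Hom.appLE (pullback.snd X.hom (Spec.map (CommRingCat.ofHom φ))) ⊤ U
        le_top).hom.comp (Scheme.ΓSpecIso (CommRingCat.of A)).inv.hom) := by
    rw [structureMap, ← CommRingCat.hom_comp, ← CommRingCat.hom_comp, Category.assoc]
    congr 2
    rw [← (baseChange X φ).presheaf.germ_res (homOfLE le_top) z hzU, ← Category.assoc]
    rfl
  rw [← h5] at h4
  exact h4

/-- The value at a point that reduces to `x`, as a homomorphism of `A`-algebras. -/
def evalHom (x : specOver ((IsLocalRing.residue A).comp φ) ⟶ X) (σ : specOver φ ⟶ X)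
    (h : specOverMap φ (IsLocalRing.residue A) ≫ σ = x) : localRing φ x →ₐ[A] A where
  __ := evalAt φ x σ h
  commutes' a := RingHom.congr_fun (homPt_evalAt σ h).2 a

lemma homPt_evalHom (x : specOver ((IsLocalRing.residue A).comp φ) ⟶ X) (σ : specOver φ ⟶ X)
    (h : specOverMap φ (IsLocalRing.residue A) ≫ σ = x) :
    homPt x (evalHom x σ h : localRing φ x →+* A) = σ.left :=
  (homPt_evalAt σ h).1

/-- The reduction to `x` is automatic for `A`-algebra homomorphisms to `A`, because `r - h r` lies
in the kernel of `h` and so is not a unit. Hence the residue disk consists of all such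
homomorphisms. -/
lemma residue_comp_algHom (h : localRing φ x →ₐ[A] A) :
    (IsLocalRing.residue A).comp (h : localRing φ x →+* A) = residueHom x := by
  ext r
  obtain ⟨a, ha⟩ := IsLocalRing.residue_surjective (residueHom x r)
  have h1 : r - algebraMap A (localRing φ x) a ∈ IsLocalRing.maximalIdeal (localRing φ x) := by
    rw [mem_maximalIdeal_localRing, map_sub, residueHom_algebraMap, ha, sub_self]
  rw [← ha, RingHom.comp_apply, ← sub_eq_zero, ← map_sub, IsLocalRing.residue_eq_zero_iff,
    IsLocalRing.mem_maximalIdeal, mem_nonunits_iff]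
  intro h2
  have h3 : IsUnit (algebraMap A (localRing φ x) (h r - a)) := h2.map _
  rw [IsLocalRing.mem_maximalIdeal, mem_nonunits_iff] at h1
  have h4 : r - algebraMap A (localRing φ x) (h r) ∈
      IsLocalRing.maximalIdeal (localRing φ x) := by
    by_contra h5
    rw [IsLocalRing.mem_maximalIdeal, mem_nonunits_iff, not_not] at h5
    have h6 := h5.map h
    simp at h6
  have h7 : algebraMap A (localRing φ x) (h r - a) ∈
      IsLocalRing.maximalIdeal (localRing φ x) := by
    have := sub_mem (show r - algebraMap A (localRing φ x) a ∈
      IsLocalRing.maximalIdeal (localRing φ x) from h1) h4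
    rw [map_sub]
    convert this using 1
    ring
  exact h7 h3

lemma homPt_residue_comp (h : localRing φ x →ₐ[A] A) :
    Spec.map (CommRingCat.ofHom (IsLocalRing.residue A)) ≫
      homPt x (h : localRing φ x →+* A) = x.left := by
  rw [← homPt_comp, residue_comp_algHom, (homPt_residueHom x).1]

lemma homPt_algHom_hom (h : localRing φ x →ₐ[A] A) :
    homPt x (h : localRing φ x →+* A) ≫ X.hom = Spec.map (CommRingCat.ofHom φ) := by
  rw [homPt_hom]
  congr 2
  ext a
  exact h.commutes (φ a)

lemma homPt_algHom_injective {W : Type u} [CommRing W] [Algebra A W]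
    {h h' : localRing φ x →ₐ[A] W}
    (h1 : homPt x (h : localRing φ x →+* W) = homPt x (h' : localRing φ x →+* W)) : h = h' := by
  refine AlgHom.coe_ringHom_injective (homPt_injective h1 ?_)
  ext a
  exact (h.commutes a).trans (h'.commutes a).symm

/-- The comorphism on local rings, as a homomorphism of `A`-algebras. -/
def localRingAlgHom (x : specOver ((IsLocalRing.residue A).comp φ) ⟶ X) (f : X ⟶ Y) :
    localRing φ (x ≫ f) →ₐ[A] localRing φ x where
  toRingHom := localRingMap φ x f
  commutes' := RingHom.congr_fun (localRingMap_structureMap (x := x) f)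

end LocalAlgebra

/-! ### Residue disks as sets of homomorphisms -/

section DiskHom

variable {p : ℕ} [Fact p.Prime] {K : Type u} [Field K] [NumberField K]
  {X Y : Over (Spec (CommRingCat.of (𝓞 K)))} {x : ResPoint p X}

/-- The evaluation of the local ring at `x_𝔭` at a point of the residue disk of `x`. -/
def Disk.evalHom (σ : Disk x) (v : MaximalSpectrum (OKp p K)) :
    x.localRing v →ₐ[OKv v] OKv v :=
  ResidueDisk.evalHom (x.at v) (σ.at v) (σ.at_reduces v)

lemma Disk.evalHom_apply (σ : Disk x) (v : MaximalSpectrum (OKp p K)) (t : x.localRing v) :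
    σ.evalHom v t = σ.eval t := rfl

lemma Disk.homPt_evalHom (σ : Disk x) (v : MaximalSpectrum (OKp p K)) :
    homPt (x.at v) (σ.evalHom v : x.localRing v →+* OKv v) =
      Spec.map (CommRingCat.ofHom (locMap v)) ≫ σ.pt.left :=
  ResidueDisk.homPt_evalHom _ _ _

/-- Morphisms from the spectrum of a finite product are families of morphisms. This applies to
`𝒪_{K,p}` and also to its reduced residue ring, where `homPt_residue_comp` shows that the glued
point reduces to `x`. -/
lemma Disk.evalHom_bijective (x : ResPoint p X) :
    Function.Bijective fun (σ : Disk x) (v : MaximalSpectrum (OKp p K)) => σ.evalHom v := by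
  constructor
  · intro σ σ' h
    apply Disk.ext
    ext1
    refine hom_ext_of_bijective (locMap_bijective p K) fun v => ?_
    rw [← Disk.homPt_evalHom, ← Disk.homPt_evalHom]
    exact congrArg (fun g : x.localRing v →ₐ[OKv v] OKv v =>
      homPt (x.at v) (g : x.localRing v →+* OKv v)) (congrFun h v)
  · intro h
    obtain ⟨P, hP⟩ := exists_hom_of_bijective (locMap_bijective p K)
      fun v => homPt (x.at v) (h v : x.localRing v →+* OKv v)
    have hP1 : P ≫ X.hom = Spec.map (CommRingCat.ofHom (toOKp p K)) := by
      refine hom_ext_of_bijective (locMap_bijective p K) fun v => ?_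
      rw [← Category.assoc, hP, homPt_algHom_hom, ← Spec.map_comp]
      rfl
    have hP2 : Spec.map (CommRingCat.ofHom (red p K)) ≫ P = x.left := by
      refine hom_ext_of_bijective (resToResidueField_bijective p K) fun v => ?_
      have h1 := homPt_residue_comp (h v)
      rw [← hP, ← Category.assoc, ← Spec.map_comp] at h1
      rw [← Category.assoc, ← Spec.map_comp]
      exact h1
    refine ⟨⟨Over.homMk P hP1, ?_⟩, ?_⟩
    · ext1
      exact hP2
    · funext v
      apply homPt_algHom_injective
      rw [Disk.homPt_evalHom]
      exact hP v

lemma Disk.evalHom_map (σ : Disk x) (f : X ⟶ Y) (v : MaximalSpectrum (OKp p K)) :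
    (σ.map f).evalHom v = (σ.evalHom v).comp (localRingAlgHom (x.at v) f) := by
  apply homPt_algHom_injective
  rw [Disk.homPt_evalHom]
  have h1 := homPt_localRingMap (x := x.at v) f (σ.evalHom v : x.localRing v →+* OKv v)
  rw [Disk.homPt_evalHom] at h1
  exact h1.symm

/-- Two points of a residue disk agree modulo `p ^ j` if and only if the evaluations do. -/
lemma Disk.modPow_eq_iff (σ σ' : Disk x) (j : ℕ) :
    σ.modPow j = σ'.modPow j ↔ ∀ v (r : x.localRing v),
      (p : OKv v) ^ j ∣ σ.evalHom v r - σ'.evalHom v r := by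
  have key : ∀ v, (Spec.map (CommRingCat.ofHom (modPowToLoc j v)) ≫ (σ.modPow j).left =
      Spec.map (CommRingCat.ofHom (modPowToLoc j v)) ≫ (σ'.modPow j).left) ↔
      ∀ r : x.localRing v, (p : OKv v) ^ j ∣ σ.evalHom v r - σ'.evalHom v r := by
    intro v
    have h1 : ∀ σ : Disk x, Spec.map (CommRingCat.ofHom (modPowToLoc j v)) ≫ (σ.modPow j).left =
        homPt (x.at v) ((Ideal.Quotient.mk (Ideal.span {(p : OKv v) ^ j})).comp
          (σ.evalHom v : x.localRing v →+* OKv v)) := by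
      intro σ
      rw [homPt_comp, Disk.homPt_evalHom]
      change Spec.map _ ≫ (Spec.map (CommRingCat.ofHom (ResidueDisk.modPow p K j)) ≫ σ.pt.left) = _
      rw [← Category.assoc, ← Category.assoc, ← Spec.map_comp, ← Spec.map_comp]
      rfl
    rw [h1, h1]
    constructor
    · intro h r
      rw [← Ideal.mem_span_singleton, ← Ideal.Quotient.eq]
      refine RingHom.congr_fun (homPt_injective h ?_) r
      ext a
      exact congrArg (Ideal.Quotient.mk _)
        (((σ.evalHom v).commutes a).trans ((σ'.evalHom v).commutes a).symm)
    · intro h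
      congr 1
      ext r
      exact Ideal.Quotient.eq.2 (Ideal.mem_span_singleton.2 (h r))
  constructor
  · intro h v
    exact (key v).1 (by rw [h])
  · intro h
    ext1
    exact hom_ext_of_bijective (modPowToLoc_bijective p K j) fun v => (key v).2 (h v)

end DiskHom

/-! ### Charts of residue disks -/

section Charts

variable {p : ℕ} [Fact p.Prime] {K : Type u} [Field K] [NumberField K]
  {X Y : Over (Spec (CommRingCat.of (𝓞 K)))} {x : ResPoint p X}
  {ϖ : ∀ v : MaximalSpectrum (OKp p K), OKv v} {I : MaximalSpectrum (OKp p K) → Type}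
  {k : MaximalSpectrum (OKp p K) → ℕ} {b : ∀ v, Module.Basis (Fin (k v)) ℤ_[p] (OKv v)}
  {τ : ∀ v, I v → x.localRing v} {α : Type u}

/-- The evaluation of restricted power series at points with coordinates in `ℤ_p`. -/
def seriesEval {v : MaximalSpectrum (OKp p K)} {ϖ : OKv v}
    (hϖ : Ideal.span {ϖ} = IsLocalRing.maximalIdeal (OKv v)) (z : α → ℤ_[p]) :
    restrictedSeries ϖ α →ₐ[OKv v] OKv v :=
  have := isAdicComplete_uniformizer hϖ
  restrictedSeries.eval (isLeftRegular_uniformizer hϖ) fun i => algebraMap ℤ_[p] (OKv v) (z i)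

lemma seriesEval_ofPolynomial {v : MaximalSpectrum (OKp p K)} {ϖ : OKv v}
    (hϖ : Ideal.span {ϖ} = IsLocalRing.maximalIdeal (OKv v)) (z : α → ℤ_[p])
    (f : MvPolynomial α (OKv v)) :
    seriesEval hϖ z (restrictedSeries.ofPolynomial f) =
      MvPolynomial.aeval (fun i => algebraMap ℤ_[p] (OKv v) (z i)) f :=
  have := isAdicComplete_uniformizer hϖ
  restrictedSeries.eval_ofPolynomial (isLeftRegular_uniformizer hϖ) _ _

/-- The element of `𝒪_{K,𝔭}` with variable coordinates with respect to a `ℤ_p`-basis. -/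
def genericElement (ϖ : ∀ v : MaximalSpectrum (OKp p K), OKv v)
    (b : ∀ v, Module.Basis (Fin (k v)) ℤ_[p] (OKv v)) (v : MaximalSpectrum (OKp p K))
    (c : Fin (k v) → α) : restrictedSeries (ϖ v) α :=
  restrictedSeries.ofPolynomial (∑ j, MvPolynomial.C (b v j) * MvPolynomial.X (c j))

lemma seriesEval_genericElement (hϖ : ∀ v, Ideal.span {ϖ v} = IsLocalRing.maximalIdeal (OKv v))
    (v : MaximalSpectrum (OKp p K)) (c : Fin (k v) → α) (z : α → ℤ_[p]) :
    seriesEval (hϖ v) z (genericElement ϖ b v c) = ∑ j, z (c j) • b v j := by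
  rw [genericElement, seriesEval_ofPolynomial, map_sum]
  refine Finset.sum_congr rfl fun j _ => ?_
  rw [map_mul, MvPolynomial.aeval_X, MvPolynomial.aeval_C, Algebra.smul_def, mul_comm]
  rfl

/-- This is the universal point of the disk, with indeterminates for its `ℤ_p`-coordinates. The map
`c` says which variables play this role, so that further variables, such as an exponent, can be
present. -/
lemma exists_universalHom [∀ v, Finite (I v)] (hX : Smooth X.hom)
    (hϖ : ∀ v, Ideal.span {ϖ v} = IsLocalRing.maximalIdeal (OKv v))
    (hτ : ∀ v, IsCoordinateSystem (ϖ v) (τ v)) (v : MaximalSpectrum (OKp p K))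
    (c : I v → Fin (k v) → α) :
    ∃ h : x.localRing v →ₐ[OKv v] restrictedSeries (ϖ v) α, IsCentered (ϖ v) h ∧
      ∀ i, h (τ v i) = algebraMap _ _ (ϖ v) * genericElement ϖ b v (c i) := by
  have := isAdicComplete_uniformizer (hϖ v)
  have := restrictedSeries.isAdicComplete α (isLeftRegular_uniformizer (hϖ v))
  have := formallySmooth_localRing hX (x.at v)
  exact (hτ v).exists_hom (isRational_localRing (hϖ v) (x.at v)) _

lemma isCentered_evalHom {v : MaximalSpectrum (OKp p K)} {ϖ : OKv v}
    (hϖ : Ideal.span {ϖ} = IsLocalRing.maximalIdeal (OKv v)) (h : x.localRing v →ₐ[OKv v] OKv v) :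
    IsCentered ϖ h :=
  isCentered_of_isRational (isRational_localRing hϖ (x.at v)) h

/-- Injectivity is `IsCoordinateSystem.hom_ext` and surjectivity is `IsCoordinateSystem.exists_hom`,
both with values in `OKv v` itself. -/
lemma exists_chart [∀ v, Finite (I v)] (hX : Smooth X.hom)
    (hϖ : ∀ v, Ideal.span {ϖ v} = IsLocalRing.maximalIdeal (OKv v))
    (hτ : ∀ v, IsCoordinateSystem (ϖ v) (τ v)) :
    ∃ e : Disk x ≃ ((Σ v, I v × Fin (k v)) → ℤ_[p]),
      IsChart ϖ b (fun v i σ => σ.eval (τ v i)) e := by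
  have h1 : ∀ v i (σ : Disk x), ∃ c, σ.eval (τ v i) = ϖ v * c := fun v i σ =>
    isCentered_evalHom (hϖ v) (σ.evalHom v) _ ((hτ v).mem i)
  choose c hc using h1
  let f : Disk x → ((Σ v, I v × Fin (k v)) → ℤ_[p]) := fun σ s =>
    (b s.1).repr (c s.1 s.2.1 σ) s.2.2
  have hf : ∀ σ v i, ∑ j, f σ ⟨v, i, j⟩ • b v j = c v i σ := fun σ v i =>
    (b v).sum_repr (c v i σ)
  have hbij : Function.Bijective f := by
    constructor
    · intro σ σ' h
      apply (Disk.evalHom_bijective x).1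
      funext v
      have := isAdicComplete_uniformizer (hϖ v)
      refine (hτ v).hom_ext (isRational_localRing (hϖ v) (x.at v)) (isCentered_evalHom (hϖ v) _)
        (isCentered_evalHom (hϖ v) _) fun i => ?_
      rw [Disk.evalHom_apply, Disk.evalHom_apply, hc, hc, ← hf, ← hf, h]
    · intro z
      have h2 : ∀ v, ∃ h : x.localRing v →ₐ[OKv v] OKv v, IsCentered (ϖ v) h ∧
          ∀ i, h (τ v i) = ϖ v * ∑ j, z ⟨v, i, j⟩ • b v j := fun v => by
        have := isAdicComplete_uniformizer (hϖ v)
        have := formallySmooth_localRing hX (x.at v)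
        exact (hτ v).exists_hom (W := OKv v) (isRational_localRing (hϖ v) (x.at v)) _
      choose h _ hh using h2
      obtain ⟨σ, hσ⟩ := (Disk.evalHom_bijective x).2 h
      refine ⟨σ, funext fun ⟨v, i, j⟩ => ?_⟩
      have h3 : c v i σ = ∑ j, z ⟨v, i, j⟩ • b v j := by
        apply isLeftRegular_uniformizer (hϖ v)
        change ϖ v * c v i σ = ϖ v * _
        rw [← hc, ← hh, ← Disk.evalHom_apply]
        exact DFunLike.congr_fun (congrFun hσ v) _
      change (b v).repr (c v i σ) j = _
      rw [h3, (b v).repr_sum_self]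
  refine ⟨Equiv.ofBijective f hbij, fun σ v i => ?_⟩
  change ϖ v * ∑ j, f σ ⟨v, i, j⟩ • b v j = _
  rw [hf]
  exact (hc v i σ).symm

/-- Both sides are centered and agree on the coordinate system, so they coincide by
`IsCoordinateSystem.hom_ext`. This is what makes `h` universal: its specializations are exactly the
points of the disk. -/
lemma seriesEval_comp_universalHom
    (hϖ : ∀ v, Ideal.span {ϖ v} = IsLocalRing.maximalIdeal (OKv v))
    (hτ : ∀ v, IsCoordinateSystem (ϖ v) (τ v)) {e : Disk x ≃ ((Σ v, I v × Fin (k v)) → ℤ_[p])}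
    (he : IsChart ϖ b (fun v i σ => σ.eval (τ v i)) e) (v : MaximalSpectrum (OKp p K))
    (c : (Σ v, I v × Fin (k v)) → α)
    {h : x.localRing v →ₐ[OKv v] restrictedSeries (ϖ v) α}
    (hh : ∀ i, h (τ v i) =
      algebraMap _ _ (ϖ v) * genericElement ϖ b v fun j => c ⟨v, i, j⟩) (z : α → ℤ_[p]) :
    (seriesEval (hϖ v) z).comp h = (e.symm fun s => z (c s)).evalHom v := by
  have := isAdicComplete_uniformizer (hϖ v)
  refine (hτ v).hom_ext (isRational_localRing (hϖ v) (x.at v)) (isCentered_evalHom (hϖ v) _)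
    (isCentered_evalHom (hϖ v) _) fun i => ?_
  have h1 := he (e.symm fun s => z (c s)) v i
  rw [Equiv.apply_symm_apply] at h1
  rw [Disk.evalHom_apply]
  refine Eq.trans ?_ h1
  rw [AlgHom.comp_apply, hh, map_mul, AlgHom.commutes, seriesEval_genericElement]
  rfl

lemma givenByConvergentPowerSeries_of_seriesEval {D : Type*}
    (hϖ : ∀ v, Ideal.span {ϖ v} = IsLocalRing.maximalIdeal (OKv v)) {t : ∀ v, I v → D → OKv v}
    {e : D ≃ ((Σ v, I v × Fin (k v)) → ℤ_[p])} (he : IsChart ϖ b t e) (F : (α → ℤ_[p]) → D)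
    (hF : ∀ v i, ∃ f : restrictedSeries (ϖ v) α, ∀ z, t v i (F z) = ϖ v * seriesEval (hϖ v) z f) :
    GivenByConvergentPowerSeries fun z => e (F z) := by
  rintro ⟨v, i, j⟩
  obtain ⟨f, hf⟩ := hF v i
  have := isAdicComplete_uniformizer (hϖ v)
  obtain ⟨g, hg, hg'⟩ := restrictedSeries.exists_series_repr
    (isLeftRegular_uniformizer (hϖ v)) (p_dvd_pow (hϖ v)) (b v) j f
  refine ⟨g, hg, fun z => ?_⟩
  have h1 : e (F z) ⟨v, i, j⟩ = (b v).repr (seriesEval (hϖ v) z f) j := by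
    have h2 : ∑ j, e (F z) ⟨v, i, j⟩ • b v j = seriesEval (hϖ v) z f := by
      apply isLeftRegular_uniformizer (hϖ v)
      change ϖ v * _ = ϖ v * _
      rw [← hf, he]
    rw [← h2, (b v).repr_sum_self]
  change HasSum _ (e (F z) ⟨v, i, j⟩)
  rw [h1]
  exact hg' z

/-- The comorphism on the local rings at the component of `x` at `𝔭`. -/
def ResPoint.comap (x : ResPoint p X) (f : X ⟶ Y) (v : MaximalSpectrum (OKp p K)) :
    (ResPoint.localRing (x ≫ f) v) →ₐ[OKv v] x.localRing v :=
  localRingAlgHom (x.at v) f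

lemma Disk.map_eval (σ : Disk x) (f : X ⟶ Y) (v : MaximalSpectrum (OKp p K))
    (r : ResPoint.localRing (x ≫ f) v) : (σ.map f).eval r = σ.eval (x.comap f v r) :=
  DFunLike.congr_fun (Disk.evalHom_map σ f v) r

lemma ResPoint.comap_mem (x : ResPoint p X) (f : X ⟶ Y) (v : MaximalSpectrum (OKp p K))
    {r : ResPoint.localRing (x ≫ f) v} (hr : r ∈ IsLocalRing.maximalIdeal _) :
    x.comap f v r ∈ IsLocalRing.maximalIdeal (x.localRing v) := by
  have h1 : (residueHom (x.at v)).comp (localRingMap (toOKv v) (x.at v) f) =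
      residueHom (x.at v ≫ f) := by
    refine homPt_injective (x := x.at v ≫ f) ?_ ?_
    · rw [homPt_localRingMap, (homPt_residueHom _).1, (homPt_residueHom _).1]
      rfl
    · rw [RingHom.comp_assoc, localRingMap_structureMap, (homPt_residueHom _).2,
        (homPt_residueHom _).2]
  rw [mem_maximalIdeal_localRing]
  have h2 : residueHom (x.at v ≫ f) r = 0 := mem_maximalIdeal_localRing.1 hr
  rw [← h1] at h2
  exact h2

lemma LocalParameters.isCoordinateSystem {n : MaximalSpectrum (OKp p K) → ℕ}
    (t : LocalParameters x ϖ n)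
    (hϖ : ∀ v, Ideal.span {ϖ v} = IsLocalRing.maximalIdeal (OKv v))
    (v : MaximalSpectrum (OKp p K)) : IsCoordinateSystem (ϖ v) (t.t v) :=
  isCoordinateSystem_of_spanFinrank (isRational_localRing (hϖ v) (x.at v)) (t.span_eq v)
    (t.minimal v)

/-- A morphism of smooth schemes is given by convergent power series on residue disks. -/
lemma givenByConvergentPowerSeries_map [∀ v, Finite (I v)] {I' : MaximalSpectrum (OKp p K) → Type}
    {f : X ⟶ Y} {τ' : ∀ v, I' v → ResPoint.localRing (x ≫ f) v} (hX : Smooth X.hom)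
    (hϖ : ∀ v, Ideal.span {ϖ v} = IsLocalRing.maximalIdeal (OKv v))
    (hτ : ∀ v, IsCoordinateSystem (ϖ v) (τ v)) (hτ' : ∀ v, IsCoordinateSystem (ϖ v) (τ' v))
    {e : Disk x ≃ ((Σ v, I v × Fin (k v)) → ℤ_[p])}
    (he : IsChart ϖ b (fun v i σ => σ.eval (τ v i)) e)
    {e' : Disk (x ≫ f) ≃ ((Σ v, I' v × Fin (k v)) → ℤ_[p])}
    (he' : IsChart ϖ b (fun v i σ => σ.eval (τ' v i)) e') :
    GivenByConvergentPowerSeries fun z => e' ((e.symm z).map f) := by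
  refine givenByConvergentPowerSeries_of_seriesEval hϖ he' _ fun v i => ?_
  obtain ⟨h, hh, hh'⟩ := exists_universalHom (b := b) hX hϖ hτ v fun i j =>
    (⟨v, i, j⟩ : Σ v, I v × Fin (k v))
  -- The pulled-back parameter lies in the maximal ideal, so its value at the universal point is `ϖ
  -- * g`; the series `g` describes the corresponding coordinate of the image.
  obtain ⟨g, hg⟩ := hh _ (x.comap_mem f v ((hτ' v).mem i))
  refine ⟨g, fun z => ?_⟩
  have h1 := seriesEval_comp_universalHom hϖ hτ he v id hh' z
  rw [Disk.map_eval, ← Disk.evalHom_apply]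
  change ((e.symm fun s => z (id s)).evalHom v) _ = _
  rw [← h1, AlgHom.comp_apply, hg, map_mul, AlgHom.commutes]
  rfl

end Charts

/-! ### Points of group schemes near the identity -/

section GroupPoints

open IsLocalRing

variable {K : Type u} [Field K] [NumberField K] {Y : Over (Spec (CommRingCat.of (𝓞 K)))}
  (G : Over Y.left) [GrpObj G]

/-- The pull-back homomorphism between groups of points of `G`. -/
def pullPt {T T' : Scheme.{u}} (a : T' ⟶ T) {q : T ⟶ Y.left} {q' : T' ⟶ Y.left}
    (h : a ≫ q = q') : (Over.mk q ⟶ G) →* (Over.mk q' ⟶ G) where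
  toFun g := (Over.homMk a h : Over.mk q' ⟶ Over.mk q) ≫ g
  map_one' := MonObj.comp_one _
  map_mul' := MonObj.comp_mul _

variable {G}

lemma pullPt_left {T T' : Scheme.{u}} (a : T' ⟶ T) {q : T ⟶ Y.left} {q' : T' ⟶ Y.left}
    (h : a ≫ q = q') (g : Over.mk q ⟶ G) : (pullPt G a h g).left = a ≫ g.left := rfl

lemma hom_mk_ext {T : Scheme.{u}} {q : T ⟶ Y.left} {g g' : Over.mk q ⟶ G}
    (h : g.left = g'.left) : g = g' := by
  ext1
  exact h

lemma left_hom {T : Scheme.{u}} {q : T ⟶ Y.left} (g : Over.mk q ⟶ G) : g.left ≫ G.hom = q :=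
  Over.w g

variable (G) in
lemma one_left_mk {T : Scheme.{u}} (q : T ⟶ Y.left) :
    (1 : Over.mk q ⟶ G).left = q ≫ (idSection G).left :=
  one_left G (Over.homMk q : Over.mk (q ≫ Y.hom) ⟶ Y)

lemma eq_one_iff {T : Scheme.{u}} {q : T ⟶ Y.left} (g : Over.mk q ⟶ G) :
    g = 1 ↔ g.left = q ≫ (idSection G).left := by
  rw [← one_left_mk G q]
  exact ⟨fun h => by rw [h], hom_mk_ext⟩

lemma pullPt_eq_one_iff {T T' : Scheme.{u}} (a : T' ⟶ T) {q : T ⟶ Y.left} (g : Over.mk q ⟶ G) :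
    pullPt G a rfl g = 1 ↔ a ≫ g.left = a ≫ q ≫ (idSection G).left := by
  rw [eq_one_iff, pullPt_left, Category.assoc]

variable {A : Type u} [CommRing A] [IsLocalRing A] {φ : 𝓞 K →+* A}
  {y : specOver ((residue A).comp φ) ⟶ Y} {W : Type u} [CommRing W] [Algebra A W]

-- The map is obtained by factoring a morphism to `Y` through the local ring at `y`. Applying
-- `localRingMap` to `proj G` would instead start from the local ring at `(y ≫ idSection G) ≫ proj
-- G`, a point that equals `y` only up to a proof.
variable (G y) in
lemma exists_baseMap : ∃ h : localRing φ y →ₐ[A] localRing φ (y ≫ idSection G),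
    homPt y (h : localRing φ y →+* localRing φ (y ≫ idSection G)) =
      homPt (y ≫ idSection G) (RingHom.id _) ≫ G.hom := by
  obtain ⟨h, h1, h2⟩ := exists_homPt_eq y
    (homPt (y ≫ idSection G) (RingHom.id _) ≫ G.hom) (structureMap φ (y ≫ idSection G))
    (by
      rw [Category.assoc]
      exact homPt_hom (x := y ≫ idSection G) (RingHom.id _))
    (residueHom (y ≫ idSection G)) (fun c => by
      obtain ⟨a, rfl⟩ := residue_surjective c
      exact ⟨_, residueHom_algebraMap a⟩)
    (by
      rw [ringJacobson_eq_maximalIdeal]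
      intro r hr
      exact mem_maximalIdeal_localRing.2 hr)
    (RingHom.id _) (homPt_residueHom _).2.symm (by
      rw [← Category.assoc, ← homPt_comp, RingHom.comp_id, (homPt_residueHom _).1]
      have h3 : (idSection G).left ≫ G.hom = 𝟙 _ :=
        congrArg (fun q => q.left) (idSection_proj G)
      change (y.left ≫ (idSection G).left) ≫ G.hom = _
      rw [Category.assoc, h3, Category.comp_id]
      exact ((congrArg (· ≫ y.left) (Spec.map_id _)).trans (Category.id_comp _)).symm)
  exact ⟨⟨h, fun a => RingHom.congr_fun h2 a⟩, h1⟩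

variable (G y) in
/-- The comorphism on local rings of the structure morphism `G ⟶ Y`. -/
def baseMap : localRing φ y →ₐ[A] localRing φ (y ≫ idSection G) :=
  (exists_baseMap G y).choose

lemma homPt_comp_baseMap (h : localRing φ (y ≫ idSection G) →ₐ[A] W) :
    homPt y (h.comp (baseMap G y) : localRing φ y →+* W) =
      homPt (y ≫ idSection G) (h : localRing φ (y ≫ idSection G) →+* W) ≫ G.hom := by
  have h1 := (exists_baseMap G y).choose_spec
  rw [AlgHom.comp_toRingHom, homPt_comp, baseMap, h1, ← Category.assoc, ← homPt_comp]
  rfl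

variable (G y) in
/-- The comorphism on local rings of the identity section. -/
def sectionMap : localRing φ (y ≫ idSection G) →ₐ[A] localRing φ y :=
  localRingAlgHom y (idSection G)

lemma homPt_comp_sectionMap (h : localRing φ y →ₐ[A] W) :
    homPt (y ≫ idSection G)
        (h.comp (sectionMap G y) : localRing φ (y ≫ idSection G) →+* W) =
      homPt y (h : localRing φ y →+* W) ≫ (idSection G).left :=
  homPt_localRingMap (x := y) (idSection G) (h : localRing φ y →+* W)

lemma sectionMap_comp_baseMap :
    (sectionMap G y).comp (baseMap G y) = AlgHom.id A (localRing φ y) := by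
  apply homPt_algHom_injective
  rw [homPt_comp_baseMap]
  have h1 := homPt_comp_sectionMap (G := G) (AlgHom.id A (localRing φ y))
  rw [AlgHom.id_comp] at h1
  rw [h1, Category.assoc]
  have h3 : (idSection G).left ≫ G.hom = 𝟙 _ :=
    congrArg (fun q => q.left) (idSection_proj G)
  rw [h3, Category.comp_id]

lemma sectionMap_baseMap (r : localRing φ y) : sectionMap G y (baseMap G y r) = r :=
  DFunLike.congr_fun (sectionMap_comp_baseMap (G := G) (y := y)) r

variable {E₀ : Type u} [CommRing E₀] {ψ : W →+* E₀} {c : ResidueField A →+* E₀}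

lemma homPt_residual {h : localRing φ (y ≫ idSection G) →ₐ[A] W}
    (hh : ψ.comp (h : localRing φ (y ≫ idSection G) →+* W) = c.comp (residueHom _)) :
    Spec.map (CommRingCat.ofHom ψ) ≫ homPt (y ≫ idSection G)
        (h : localRing φ (y ≫ idSection G) →+* W) =
      Spec.map (CommRingCat.ofHom c) ≫ y.left ≫ (idSection G).left := by
  rw [← homPt_comp, hh, homPt_comp, (homPt_residueHom _).1]
  rfl

lemma homPt_residual_hom {h : localRing φ (y ≫ idSection G) →ₐ[A] W}
    (hh : ψ.comp (h : localRing φ (y ≫ idSection G) →+* W) = c.comp (residueHom _)) :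
    Spec.map (CommRingCat.ofHom ψ) ≫ homPt (y ≫ idSection G)
        (h : localRing φ (y ≫ idSection G) →+* W) ≫ G.hom =
      Spec.map (CommRingCat.ofHom c) ≫ y.left := by
  have h3 : (idSection G).left ≫ G.hom = 𝟙 _ :=
    congrArg (fun q => q.left) (idSection_proj G)
  rw [← Category.assoc, homPt_residual hh, Category.assoc, Category.assoc, h3, Category.comp_id]

/-- A point that reduces to the identity in `E₀` has trivial image in the group of points with
values in `E₀`. -/
lemma pullPt_eq_one {h : localRing φ (y ≫ idSection G) →ₐ[A] W}
    (hh : ψ.comp (h : localRing φ (y ≫ idSection G) →+* W) = c.comp (residueHom _))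
    {q : Spec (CommRingCat.of W) ⟶ Y.left} {g : Over.mk q ⟶ G}
    (hg : homPt (y ≫ idSection G) (h : localRing φ (y ≫ idSection G) →+* W) = g.left) :
    pullPt G (Spec.map (CommRingCat.ofHom ψ)) rfl g = 1 := by
  rw [eq_one_iff, pullPt_left, ← hg, homPt_residual hh, ← left_hom g, ← hg,
    homPt_residual_hom hh, Category.assoc]

/-- Points that reduce to the identity are given by homomorphisms from the local ring. -/
lemma exists_homPt_eq_left (hψ : Function.Surjective ψ) (hker : RingHom.ker ψ ≤ Ring.jacobson W)
    (hc : c.comp (residue A) = ψ.comp (algebraMap A W))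
    {h : localRing φ (y ≫ idSection G) →ₐ[A] W}
    (hh : ψ.comp (h : localRing φ (y ≫ idSection G) →+* W) = c.comp (residueHom _))
    {q : Spec (CommRingCat.of W) ⟶ Y.left}
    (hq : homPt (y ≫ idSection G) (h : localRing φ (y ≫ idSection G) →+* W) ≫ G.hom = q)
    {g : Over.mk q ⟶ G} (hg : pullPt G (Spec.map (CommRingCat.ofHom ψ)) rfl g = 1) :
    ∃ h' : localRing φ (y ≫ idSection G) →ₐ[A] W,
      homPt (y ≫ idSection G) (h' : localRing φ (y ≫ idSection G) →+* W) = g.left ∧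
      ψ.comp (h' : localRing φ (y ≫ idSection G) →+* W) = c.comp (residueHom _) := by
  have hx : Spec.map (CommRingCat.ofHom ψ) ≫ g.left =
      Spec.map (CommRingCat.ofHom c) ≫ (y ≫ idSection G).left := by
    rw [← pullPt_left (Spec.map (CommRingCat.ofHom ψ)) rfl g, hg, one_left_mk, ← hq,
      homPt_residual_hom hh, Category.assoc]
    rfl
  obtain ⟨h', h1, h2⟩ := exists_homPt_eq (y ≫ idSection G) g.left (algebraMap A W) (by
    have h3 := homPt_hom (x := y ≫ idSection G) (h : localRing φ (y ≫ idSection G) →+* W)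
    have h4 : (h : localRing φ (y ≫ idSection G) →+* W).comp (structureMap φ _) =
      algebraMap A W := RingHom.ext fun a => h.commutes a
    rw [h4] at h3
    rw [← h3]
    change g.left ≫ G.hom ≫ Y.hom = _ ≫ G.hom ≫ Y.hom
    rw [← Category.assoc, left_hom, ← Category.assoc, hq]) ψ hψ hker c hc hx
  refine ⟨⟨h', fun a => RingHom.congr_fun h2 a⟩, h1, ?_⟩
  refine homPt_injective (x := y ≫ idSection G) ?_ ?_
  · rw [homPt_comp, homPt_comp, (homPt_residueHom _).1, ← hx]
    exact congrArg _ h1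
  · rw [RingHom.comp_assoc, RingHom.comp_assoc, (homPt_residueHom _).2, hc]
    exact congrArg _ h2

/-! #### Differences of powers -/

variable (A) in
/-- The algebra of pairs of elements that are congruent modulo `q`. -/
def congruentPairs (q : W) : Subalgebra A (W × W) where
  carrier := {x | q ∣ x.2 - x.1}
  mul_mem' := by
    intro x x' hx hx'
    have e : (x * x').2 - (x * x').1 = x.2 * (x'.2 - x'.1) + (x.2 - x.1) * x'.1 := by
      simp only [Prod.snd_mul, Prod.fst_mul]; ring
    change q ∣ _
    rw [e]
    exact dvd_add (dvd_mul_of_dvd_right hx' _) (dvd_mul_of_dvd_left hx _)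
  add_mem' := by
    intro x x' hx hx'
    have e : (x + x').2 - (x + x').1 = (x.2 - x.1) + (x'.2 - x'.1) := by
      simp only [Prod.snd_add, Prod.fst_add]; ring
    change q ∣ _
    rw [e]
    exact dvd_add hx hx'
  algebraMap_mem' := by
    intro a
    change q ∣ algebraMap A W a - algebraMap A W a
    simp

namespace congruentPairs

variable (A) (q : W)

/-- The first projection. -/
def fst : congruentPairs A q →ₐ[A] W := (AlgHom.fst A W W).comp (congruentPairs A q).val

/-- The second projection. -/
def snd : congruentPairs A q →ₐ[A] W := (AlgHom.snd A W W).comp (congruentPairs A q).val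

/-- The diagonal embedding. -/
def diag : W →ₐ[A] congruentPairs A q :=
  ((AlgHom.id A W).prod (AlgHom.id A W)).codRestrict _ fun w => by
    change q ∣ w - w
    simp

variable {A q}

lemma dvd_snd_sub_fst (x : congruentPairs A q) : q ∣ snd A q x - fst A q x := x.2

lemma ext {x y : congruentPairs A q} (h : fst A q x = fst A q y) (h' : snd A q x = snd A q y) :
    x = y :=
  Subtype.ext (Prod.ext h h')

/-- Inverses `a`, `b` of congruent units are congruent, since `b - a = -(a * b) * (x₂ - x₁)`. -/
lemma isUnit_of_isUnit {x : congruentPairs A q} (h : IsUnit (fst A q x))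
    (h' : IsUnit (snd A q x)) : IsUnit x := by
  obtain ⟨a, ha⟩ := h.exists_right_inv
  obtain ⟨b, hb⟩ := h'.exists_right_inv
  obtain ⟨d, hd⟩ := dvd_snd_sub_fst x
  refine IsUnit.of_mul_eq_one (⟨(a, b), ⟨-(a * b * d), ?_⟩⟩ : congruentPairs A q) (ext ?_ ?_)
  · change b - a = q * _
    linear_combination (-b) * ha + a * hb - a * b * hd
  · rw [map_one]; exact ha
  · rw [map_one]; exact hb

lemma mem_jacobson {x : congruentPairs A q} (h : fst A q x ∈ Ring.jacobson W)
    (h' : snd A q x ∈ Ring.jacobson W) : x ∈ Ring.jacobson (congruentPairs A q) := by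
  rw [← Ideal.jacobson_bot, Ideal.mem_jacobson_bot] at *
  intro y
  refine isUnit_of_isUnit ?_ ?_
  · simpa using h (fst A q y)
  · simpa using h' (snd A q y)

end congruentPairs

lemma map_fwdDiff_iter {M M' : Type*} [AddCommGroup M] [AddCommGroup M'] (g : M →+ M')
    (f : ℕ → M) (i n : ℕ) :
    (fwdDiff 1)^[i] (fun j => g (f j)) n = g ((fwdDiff 1)^[i] f n) := by
  simp [fwdDiff_iter_eq_sum_shift, map_sum]

/-- If `g` is trivial modulo `ϖ`, then the `i`-th differences of the values at `g₀ g ^ j` are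
divisible by `ϖ ^ i`. -/
theorem pow_dvd_fwdDiff (ϖ : A) (i : ℕ) : ∀ (W : Type u) [CommRing W] [Algebra A W]
    (ψ : W →+* E₀) (_ : Function.Surjective ψ) (_ : RingHom.ker ψ ≤ Ring.jacobson W)
    (_ : ψ (algebraMap A W ϖ) = 0) (_ : c.comp (residue A) = ψ.comp (algebraMap A W))
    (q : Spec (CommRingCat.of W) ⟶ Y.left) (g₀ g : Over.mk q ⟶ G)
    (f : ℕ → (localRing φ (y ≫ idSection G) →ₐ[A] W))
    (_ : ∀ j, homPt (y ≫ idSection G) (f j : localRing φ (y ≫ idSection G) →+* W) =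
      (g₀ * g ^ j).left)
    (_ : ψ.comp (f 0 : localRing φ (y ≫ idSection G) →+* W) = c.comp (residueHom _))
    (_ : pullPt G (Spec.map (CommRingCat.ofHom
      (Ideal.Quotient.mk (Ideal.span {algebraMap A W ϖ})))) rfl g = 1)
    (r : localRing φ (y ≫ idSection G)),
    algebraMap A W ϖ ^ i ∣ (fwdDiff 1)^[i] (fun j => f j r) 0 := by
  induction i with
  | zero => intros; simp
  | succ i ih =>
    -- The values at `g₀ g ^ j` and `g₀ g ^ (j + 1)` form one point over the ring `D` of pairs
    -- congruent modulo `ϖ`, namely `g₀' g' ^ j` with `g₀' = (g₀, g₀ g)` and `g' = (g, g)`. The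
    -- induction hypothesis over `D` makes the `i`-th difference a multiple `ϖ ^ i * d` in `D`.
    -- Subtracting the components of `d` yields the additional factor `ϖ`.
    intro W _ _ ψ hψ hker hψϖ hc q g₀ g f hf hf0 hg r
    set w := algebraMap A W ϖ with hw
    let R := localRing φ (y ≫ idSection G)
    let mk := Ideal.Quotient.mk (Ideal.span {w})
    let D := congruentPairs A w
    -- consecutive values are congruent modulo `ϖ`
    have hcong : ∀ j r, w ∣ f (j + 1) r - f j r := by
      intro j r
      have h1 : ∀ j, homPt (y ≫ idSection G) (mk.comp (f j : R →+* W)) =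
          (pullPt G (Spec.map (CommRingCat.ofHom mk)) rfl g₀).left := by
        intro j
        rw [homPt_comp, hf, ← pullPt_left (Spec.map (CommRingCat.ofHom mk)) rfl, map_mul, map_pow,
          hg, one_pow, mul_one]
      have h2 : mk.comp (f (j + 1) : R →+* W) = mk.comp (f j : R →+* W) := by
        refine homPt_injective (x := y ≫ idSection G) ((h1 _).trans (h1 _).symm) ?_
        ext a
        exact congrArg mk (((f (j + 1)).commutes a).trans ((f j).commutes a).symm)
      rw [← Ideal.mem_span_singleton, ← Ideal.Quotient.eq]
      exact RingHom.congr_fun h2 r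
    let F : ℕ → (R →ₐ[A] D) := fun j =>
      ((f j).prod (f (j + 1))).codRestrict _ fun r => hcong j r
    let δ : W →+* D := (congruentPairs.diag A w : W →+* D)
    let π₁ : D →+* W := (congruentPairs.fst A w : D →+* W)
    let π₂ : D →+* W := (congruentPairs.snd A w : D →+* W)
    have hδ₁ : π₁.comp δ = RingHom.id W := rfl
    have hδ₂ : π₂.comp δ = RingHom.id W := rfl
    let ψ' : D →+* E₀ := ψ.comp π₁
    have hq : ∀ j, homPt y ((f j).comp (baseMap G y) : localRing φ y →+* W) = q := fun j => by
      rw [homPt_comp_baseMap, hf, left_hom]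
    have hbase : homPt (y ≫ idSection G) (F 0 : R →+* D) ≫ G.hom =
        Spec.map (CommRingCat.ofHom δ) ≫ q := by
      rw [← homPt_comp_baseMap, ← hq 0, ← homPt_comp]
      congr 1
      refine RingHom.ext fun r => congruentPairs.ext (A := A) (q := w) rfl ?_
      exact DFunLike.congr_fun (homPt_algHom_injective ((hq 1).trans (hq 0).symm)) r
    have key : ∀ π : D →+* W, π.comp δ = RingHom.id W →
        Spec.map (CommRingCat.ofHom π) ≫ Spec.map (CommRingCat.ofHom δ) = 𝟙 _ := by
      intro π hπ
      rw [← Spec.map_comp, ← CommRingCat.ofHom_comp, hπ]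
      exact Spec.map_id _
    have key' : ∀ π : D →+* W, π.comp δ = RingHom.id W →
        Spec.map (CommRingCat.ofHom π) ≫ Spec.map (CommRingCat.ofHom δ) ≫ q = q := by
      intro π hπ
      rw [← Category.assoc, key π hπ, Category.id_comp]
    let g₀' : Over.mk (Spec.map (CommRingCat.ofHom δ) ≫ q) ⟶ G :=
      Over.homMk (homPt (y ≫ idSection G) (F 0 : R →+* D)) hbase
    let g' := pullPt G (Spec.map (CommRingCat.ofHom δ)) rfl g
    have hg' : ∀ (π : D →+* W) (hπ : π.comp δ = RingHom.id W),
        pullPt G (Spec.map (CommRingCat.ofHom π)) (key' π hπ) g' = g := by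
      intro π hπ
      apply hom_mk_ext
      rw [pullPt_left, pullPt_left, ← Category.assoc, key π hπ, Category.id_comp]
    have hg₀₁ : pullPt G (Spec.map (CommRingCat.ofHom π₁)) (key' π₁ hδ₁) g₀' = g₀ := by
      apply hom_mk_ext
      rw [pullPt_left]
      change _ ≫ homPt _ _ = _
      rw [← homPt_comp]
      refine (hf 0).trans ?_
      rw [pow_zero, mul_one]
    have hg₀₂ : pullPt G (Spec.map (CommRingCat.ofHom π₂)) (key' π₂ hδ₂) g₀' = g₀ * g := by
      apply hom_mk_ext
      rw [pullPt_left]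
      change _ ≫ homPt _ _ = _
      rw [← homPt_comp]
      refine (hf 1).trans ?_
      rw [pow_one]
    have hψ' : Function.Surjective ψ' := fun e => by
      obtain ⟨a, rfl⟩ := hψ e
      exact ⟨δ a, rfl⟩
    have hker' : RingHom.ker ψ' ≤ Ring.jacobson D := by
      intro x hx
      have hx' : ψ (π₁ x) = 0 := hx
      refine congruentPairs.mem_jacobson (hker hx') (hker ?_)
      obtain ⟨d, hd⟩ := congruentPairs.dvd_snd_sub_fst x
      rw [sub_eq_iff_eq_add.1 hd, RingHom.mem_ker, map_add, map_mul, hψϖ, zero_mul, zero_add]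
      exact hx'
    -- maps that kill `ϖ` send `g` to the identity
    have hone : ∀ (E : Type u) [CommRing E] (χ : W →+* E), χ w = 0 →
        Spec.map (CommRingCat.ofHom χ) ≫ g.left =
          Spec.map (CommRingCat.ofHom χ) ≫ q ≫ (idSection G).left := by
      intro E _ χ hχ
      let χ' := Ideal.Quotient.lift (Ideal.span {w}) χ fun a ha => by
        obtain ⟨d, rfl⟩ := Ideal.mem_span_singleton.1 ha
        rw [map_mul, hχ, zero_mul]
      have hχ' : χ = χ'.comp mk := rfl
      rw [hχ', CommRingCat.ofHom_comp, Spec.map_comp, Category.assoc, Category.assoc,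
        (pullPt_eq_one_iff _ g).1 hg]
    have hone' : ∀ (E : Type u) [CommRing E] (χ : D →+* E), χ (δ w) = 0 →
        pullPt G (Spec.map (CommRingCat.ofHom χ)) rfl g' = 1 := by
      intro E _ χ hχ
      rw [pullPt_eq_one_iff, pullPt_left, Category.assoc, ← Category.assoc, ← Spec.map_comp,
        ← Category.assoc (Spec.map (CommRingCat.ofHom χ)), ← Spec.map_comp]
      exact hone E (χ.comp δ) hχ
    have hg₀ψ : pullPt G (Spec.map (CommRingCat.ofHom ψ')) rfl g₀' = 1 :=
      pullPt_eq_one (h := F 0) (c := c) hf0 rfl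
    -- The product `g₀' * g' ^ j` reduces to the identity, so it comes from some homomorphism `H` on
    -- the local ring. The components of `H` are `f j` and `f (j + 1)`, which identifies it with `F
    -- j`.
    have hFj : ∀ j, homPt (y ≫ idSection G) (F j : R →+* D) = (g₀' * g' ^ j).left := by
      intro j
      obtain ⟨H, hH, -⟩ := exists_homPt_eq_left (ψ := ψ') (c := c) hψ' hker' hc (h := F 0) hf0
        hbase (g := g₀' * g' ^ j) (by
          rw [map_mul, map_pow, hg₀ψ, hone' _ ψ' hψϖ, one_pow, one_mul])
      have h1 : (congruentPairs.fst A w).comp H = f j := by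
        apply homPt_algHom_injective
        rw [hf, AlgHom.comp_toRingHom, homPt_comp, hH]
        have := map_mul (pullPt G (Spec.map (CommRingCat.ofHom π₁)) (key' π₁ hδ₁)) g₀' (g' ^ j)
        rw [map_pow, hg' π₁ hδ₁, hg₀₁] at this
        rw [← this]
        rfl
      have h2 : (congruentPairs.snd A w).comp H = f (j + 1) := by
        apply homPt_algHom_injective
        rw [hf, AlgHom.comp_toRingHom, homPt_comp, hH]
        have := map_mul (pullPt G (Spec.map (CommRingCat.ofHom π₂)) (key' π₂ hδ₂)) g₀' (g' ^ j)
        rw [map_pow, hg' π₂ hδ₂, hg₀₂, mul_assoc, ← pow_succ'] at this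
        rw [← this]
        rfl
      have h3 : F j = H := by
        exact AlgHom.ext fun r => congruentPairs.ext (A := A) (q := w) (DFunLike.congr_fun h1 r).symm (DFunLike.congr_fun h2 r).symm
      rw [h3, hH]
    obtain ⟨d, hd⟩ := ih D ψ' hψ' hker' hψϖ hc _ g₀' g' F hFj hf0
      (hone' _ _ (Ideal.Quotient.eq_zero_iff_mem.2 (Ideal.mem_span_singleton_self _))) r
    have h1 : (fwdDiff 1)^[i + 1] (fun j => f j r) 0 =
        (π₂.toAddMonoidHom - π₁.toAddMonoidHom) ((fwdDiff 1)^[i] (fun j => F j r) 0) := by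
      rw [← map_fwdDiff_iter]
      rfl
    obtain ⟨b, hb⟩ := congruentPairs.dvd_snd_sub_fst d
    refine ⟨b, ?_⟩
    rw [h1, hd]
    change congruentPairs.snd A w _ - congruentPairs.fst A w _ = _
    rw [map_mul, map_mul, map_pow, map_pow, AlgHom.commutes, AlgHom.commutes, ← mul_sub, hb,
      pow_succ, mul_assoc]

end GroupPoints

/-! ### Powers with exponents in `ℤ_p` -/

section PadicPowers

variable {p : ℕ} [Fact p.Prime]

lemma PadicInt_sub_mem_span_iff (j : ℕ) (m n : ℤ) :
    ((m : ℤ_[p]) - n) ∈ Ideal.span {(p : ℤ_[p]) ^ j} ↔ ((p : ℤ) ^ j) ∣ m - n := by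
  rw [← PadicInt.norm_le_pow_iff_mem_span_pow, ← Int.cast_sub, PadicInt.norm_int_le_pow_iff_dvd]

/-- A separated and complete group whose elements become trivial modulo `p ^ j` when raised to the
power `p ^ j` admits powers with exponents in `ℤ_p`. -/
theorem exists_padicPowerAction {H : Type*} [Group H] {Q : ℕ → Type*} [∀ j, Group (Q j)]
    (q : ∀ j, H →* Q j) (hsep : ∀ h h', (∀ j, q j h = q j h') → h = h')
    (hcomp : ∀ f : ℕ → H, (∀ j, q j (f (j + 1)) = q j (f j)) → ∃ L, ∀ j, q j L = q j (f j))
    (hpow : ∀ j h, q j (h ^ p ^ j) = 1) :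
    ∃ act : ℤ_[p] → H → H, IsPadicPowerAction act ∧
      ∀ (j : ℕ) (a : ℤ_[p]) (n : ℤ) (h : H), a - n ∈ Ideal.span {(p : ℤ_[p]) ^ j} →
        q j (act a h) = q j (h ^ n) := by
  have hcongr : ∀ (j : ℕ) (m n : ℤ) (h : H), ((m : ℤ_[p]) - n) ∈ Ideal.span {(p : ℤ_[p]) ^ j} →
      q j (h ^ m) = q j (h ^ n) := by
    intro j m n h hmn
    obtain ⟨d, hd⟩ := (PadicInt_sub_mem_span_iff j m n).1 hmn
    have h1 : h ^ m = (h ^ p ^ j) ^ d * h ^ n := by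
      rw [← zpow_natCast h, ← zpow_mul, ← zpow_add]
      congr 1
      push_cast
      linarith
    rw [h1, map_mul, map_zpow, hpow, one_zpow, one_mul]
  -- Integer approximations of `a` give a Cauchy sequence of powers by `hcongr`. Its limit is pinned
  -- down at each level `j` by any integer congruent to `a`, so all identities reduce to those for
  -- integer exponents.
  have hex : ∀ (a : ℤ_[p]) (h : H), ∃ L, ∀ (j : ℕ) (n : ℤ),
      a - n ∈ Ideal.span {(p : ℤ_[p]) ^ j} → q j L = q j (h ^ n) := by
    intro a h
    have happr : ∀ j (n : ℤ), a - n ∈ Ideal.span {(p : ℤ_[p]) ^ j} →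
        q j (h ^ (a.appr j : ℤ)) = q j (h ^ n) := by
      intro j n hn
      apply hcongr
      have h1 := sub_mem hn (PadicInt.appr_spec j a)
      rw [sub_sub_sub_cancel_left] at h1
      exact_mod_cast h1
    obtain ⟨L, hL⟩ := hcomp (fun j => h ^ (a.appr j : ℤ)) fun j => (happr j _ (by
      have h1 := PadicInt.appr_spec (j + 1) a
      have h2 : Ideal.span {(p : ℤ_[p]) ^ (j + 1)} ≤ Ideal.span {(p : ℤ_[p]) ^ j} :=
        Ideal.span_singleton_le_span_singleton.2 (pow_dvd_pow _ j.le_succ)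
      exact_mod_cast h2 h1)).symm
    exact ⟨L, fun j n hn => (hL j).trans (happr j n hn)⟩
  choose act hact using hex
  have hint : ∀ (j : ℕ) (a : ℤ_[p]), ∃ n : ℤ, a - n ∈ Ideal.span {(p : ℤ_[p]) ^ j} := fun j a =>
    ⟨a.appr j, by exact_mod_cast PadicInt.appr_spec j a⟩
  refine ⟨act, ⟨fun n h => ?_, fun a b h => ?_, fun a b h => ?_, fun a h h' hh => ?_⟩,
    fun j a n h hn => hact a h j n hn⟩ <;> refine hsep _ _ fun j => ?_
  · exact hact n h j n (by simp)
  · obtain ⟨m, hm⟩ := hint j a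
    obtain ⟨n, hn⟩ := hint j b
    rw [map_mul, hact a h j m hm, hact b h j n hn, ← map_mul, ← zpow_add]
    refine hact _ h j _ ?_
    have := add_mem hm hn
    rw [Int.cast_add]
    convert this using 1
    ring
  · obtain ⟨m, hm⟩ := hint j a
    obtain ⟨n, hn⟩ := hint j b
    rw [hact a _ j m hm, map_zpow, hact b h j n hn, ← map_zpow, ← zpow_mul]
    refine hact _ h j _ ?_
    have := add_mem (Ideal.mul_mem_right b _ hm) (Ideal.mul_mem_left _ (m : ℤ_[p]) hn)
    rw [Int.cast_mul]
    convert this using 1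
    · ring
  · obtain ⟨m, hm⟩ := hint j a
    rw [map_mul, hact a _ j m hm, hact a _ j m hm, hact a _ j m hm, hh.mul_zpow, map_mul]

end PadicPowers

/-! ### Powers of points near the identity -/

section PowHom

open IsLocalRing

variable {K : Type u} [Field K] [NumberField K] {Y : Over (Spec (CommRingCat.of (𝓞 K)))}
  {G : Over Y.left} [GrpObj G] {A : Type u} [CommRing A] [IsLocalRing A] {φ : 𝓞 K →+* A}
  {y : specOver ((residue A).comp φ) ⟶ Y} {W W' : Type u} [CommRing W] [Algebra A W]
  [CommRing W'] [Algebra A W'] {ϖ : A}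

/-- The point of `G` given by a homomorphism from the local ring, as a point over `Y`. -/
def fibrePt (h : localRing φ (y ≫ idSection G) →ₐ[A] W) :
    Over.mk (homPt (y ≫ idSection G) (h : localRing φ (y ≫ idSection G) →+* W) ≫ G.hom) ⟶ G :=
  Over.homMk (homPt (y ≫ idSection G) (h : localRing φ (y ≫ idSection G) →+* W)) rfl

variable (W) in
lemma exists_residueField_hom (hϖ : Ideal.span {ϖ} = maximalIdeal A) :
    ∃ c : ResidueField A →+* W ⧸ Ideal.span {algebraMap A W ϖ},
      c.comp (residue A) = (Ideal.Quotient.mk _).comp (algebraMap A W) :=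
  ⟨Ideal.Quotient.lift (maximalIdeal A) ((Ideal.Quotient.mk _).comp (algebraMap A W))
    (fun a ha => by
      rw [← hϖ] at ha
      obtain ⟨d, rfl⟩ := Ideal.mem_span_singleton.1 ha
      rw [RingHom.comp_apply, Ideal.Quotient.eq_zero_iff_mem, Ideal.mem_span_singleton, map_mul]
      exact dvd_mul_right _ _), RingHom.ext fun a => rfl⟩

lemma isCentered_iff {c : ResidueField A →+* W ⧸ Ideal.span {algebraMap A W ϖ}}
    (hc : c.comp (residue A) = (Ideal.Quotient.mk _).comp (algebraMap A W))
    (h : localRing φ (y ≫ idSection G) →ₐ[A] W) :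
    IsCentered ϖ h ↔ (Ideal.Quotient.mk (Ideal.span {algebraMap A W ϖ})).comp
      (h : localRing φ (y ≫ idSection G) →+* W) = c.comp (residueHom _) := by
  constructor
  · intro hh
    ext r
    obtain ⟨a, ha⟩ := residue_surjective (residueHom (y ≫ idSection G) r)
    have h1 : r - algebraMap A _ a ∈ maximalIdeal (localRing φ (y ≫ idSection G)) := by
      rw [mem_maximalIdeal_localRing, map_sub, residueHom_algebraMap, ha, sub_self]
    rw [RingHom.comp_apply, RingHom.comp_apply, ← ha]
    refine Eq.trans ?_ (RingHom.congr_fun hc a).symm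
    refine Ideal.Quotient.eq.2 (Ideal.mem_span_singleton.2 ?_)
    have := hh _ h1
    rwa [map_sub, AlgHom.commutes] at this
  · intro hh r hr
    rw [mem_maximalIdeal_localRing] at hr
    have := RingHom.congr_fun hh r
    rw [RingHom.comp_apply, RingHom.comp_apply, hr, map_zero, Ideal.Quotient.eq_zero_iff_mem] at this
    exact Ideal.mem_span_singleton.1 this

lemma exists_powHom (hϖ : Ideal.span {ϖ} = maximalIdeal A)
    (hW : Ideal.span {algebraMap A W ϖ} ≤ Ring.jacobson W)
    {h : localRing φ (y ≫ idSection G) →ₐ[A] W} (hh : IsCentered ϖ h) (n : ℕ) :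
    ∃ h' : localRing φ (y ≫ idSection G) →ₐ[A] W, IsCentered ϖ h' ∧
      homPt (y ≫ idSection G) (h' : localRing φ (y ≫ idSection G) →+* W) =
        (fibrePt h ^ n).left := by
  obtain ⟨c, hc⟩ := exists_residueField_hom W hϖ
  have h1 := (isCentered_iff hc h).1 hh
  obtain ⟨h', h2, h3⟩ := exists_homPt_eq_left Ideal.Quotient.mk_surjective
    (by rwa [Ideal.mk_ker]) hc h1 rfl (g := fibrePt h ^ n) (by
      rw [map_pow, pullPt_eq_one h1 rfl, one_pow])
  exact ⟨h', (isCentered_iff hc h').2 h3, h2⟩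

/-- The values at the `n`-th power of a point of `G`. -/
def powHom (hϖ : Ideal.span {ϖ} = maximalIdeal A)
    (hW : Ideal.span {algebraMap A W ϖ} ≤ Ring.jacobson W)
    {h : localRing φ (y ≫ idSection G) →ₐ[A] W} (hh : IsCentered ϖ h) (n : ℕ) :
    localRing φ (y ≫ idSection G) →ₐ[A] W :=
  (exists_powHom hϖ hW hh n).choose

variable (hϖ : Ideal.span {ϖ} = maximalIdeal A)
  (hW : Ideal.span {algebraMap A W ϖ} ≤ Ring.jacobson W)
  (hW' : Ideal.span {algebraMap A W' ϖ} ≤ Ring.jacobson W')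
  {h : localRing φ (y ≫ idSection G) →ₐ[A] W} (hh : IsCentered ϖ h)

lemma isCentered_powHom (n : ℕ) : IsCentered ϖ (powHom hϖ hW hh n) :=
  (exists_powHom hϖ hW hh n).choose_spec.1

lemma homPt_powHom (n : ℕ) :
    homPt (y ≫ idSection G) (powHom hϖ hW hh n : localRing φ (y ≫ idSection G) →+* W) =
      (fibrePt h ^ n).left :=
  (exists_powHom hϖ hW hh n).choose_spec.2

/-- The zeroth power is the identity section over the base point. In particular functions in the
kernel of the section vanish there, which removes the constant term of the Newton series. -/
lemma powHom_zero (r : localRing φ (y ≫ idSection G)) :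
    powHom hϖ hW hh 0 r = h (baseMap G y (sectionMap G y r)) := by
  have h1 : powHom hϖ hW hh 0 = (h.comp (baseMap G y)).comp (sectionMap G y) := by
    apply homPt_algHom_injective
    rw [homPt_powHom, pow_zero, one_left_mk, homPt_comp_sectionMap, homPt_comp_baseMap]
  rw [h1]
  rfl

/-- Powers are compatible with base change. This is used to specialize the powers of the universal
point. -/
lemma comp_powHom (χ : W →ₐ[A] W') (hχ : IsCentered ϖ (χ.comp h)) (n : ℕ) :
    χ.comp (powHom hϖ hW hh n) = powHom hϖ hW' hχ n := by
  apply homPt_algHom_injective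
  have h1 : pullPt G (Spec.map (CommRingCat.ofHom (χ : W →+* W'))) (by
      rw [← Category.assoc, ← homPt_comp]; rfl) (fibrePt h) = fibrePt (χ.comp h) := by
    apply hom_mk_ext
    exact (homPt_comp (x := y ≫ idSection G) _ _).symm
  rw [AlgHom.comp_toRingHom, homPt_comp, homPt_powHom, homPt_powHom, ← h1, ← map_pow]
  rfl

/-- The differences of the values at the powers of a point are divisible by powers of `ϖ`. -/
lemma pow_dvd_fwdDiff_powHom (i : ℕ) (r : localRing φ (y ≫ idSection G)) :
    algebraMap A W ϖ ^ i ∣ (fwdDiff 1)^[i] (fun j => powHom hϖ hW hh j r) 0 := by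
  obtain ⟨c, hc⟩ := exists_residueField_hom W hϖ
  refine pow_dvd_fwdDiff ϖ i W (Ideal.Quotient.mk (Ideal.span {algebraMap A W ϖ}))
    Ideal.Quotient.mk_surjective (by rwa [Ideal.mk_ker])
    (Ideal.Quotient.eq_zero_iff_mem.2 (Ideal.mem_span_singleton_self _)) hc _ 1 (fibrePt h)
    (fun j => powHom hϖ hW hh j) (fun j => ?_)
    ((isCentered_iff hc _).1 (isCentered_powHom hϖ hW hh 0))
    (pullPt_eq_one ((isCentered_iff hc h).1 hh) rfl) r
  rw [homPt_powHom, one_mul]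

lemma powHom_eq_sum (n : ℕ) (r : localRing φ (y ≫ idSection G)) :
    powHom hϖ hW hh n r = ∑ i ∈ Finset.range (n + 1),
      n.choose i • (fwdDiff 1)^[i] (fun j => powHom hϖ hW hh j r) 0 := by
  rw [← shift_eq_sum_fwdDiff_iter]
  simp

end PowHom

/-! ### The action of `ℤ_p` on residue disks of group schemes -/

section Action

open IsLocalRing

lemma ideal_le_ringJacobson {W : Type*} [CommRing W] (I : Ideal W) [IsAdicComplete I W] :
    I ≤ Ring.jacobson W := by
  rw [← Ideal.jacobson_bot]
  exact IsAdicComplete.le_jacobson_bot I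

/-- The limit of a sequence of homomorphisms. -/
lemma exists_limit_algHom {A R W : Type*} [CommRing A] [CommRing R] [CommRing W] [Algebra A R]
    [Algebra A W] {q : W} [IsAdicComplete (Ideal.span {q}) W] (f : ℕ → R →ₐ[A] W)
    (hf : ∀ n r, q ^ n ∣ f (n + 1) r - f n r) :
    ∃ L : R →ₐ[A] W, ∀ n r, q ^ n ∣ L r - f n r := by
  choose L hL using fun r => exists_limit_of_isPrecomplete (fun n => f n r) fun n => hf n r
  have hext : ∀ x y : W, (∀ n, q ^ n ∣ x - y) → x = y := fun x y h =>
    sub_eq_zero.1 (dvd_pow_of_isHausdorff h)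
  refine ⟨⟨⟨⟨⟨L, ?_⟩, ?_⟩, ?_, ?_⟩, ?_⟩, fun n r => hL r n⟩
  · exact hext _ _ fun n => by simpa using hL 1 n
  · intro r s
    refine hext _ _ fun n => ?_
    have e : L (r * s) - L r * L s =
        (L (r * s) - f n (r * s)) - ((L r - f n r) * L s + (L s - f n s) * f n r) := by
      rw [map_mul]; ring
    change q ^ n ∣ L (r * s) - L r * L s
    rw [e]
    exact dvd_sub (hL _ n) (dvd_add (dvd_mul_of_dvd_left (hL r n) _)
      (dvd_mul_of_dvd_left (hL s n) _))
  · exact hext _ _ fun n => by simpa using hL 0 n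
  · intro r s
    refine hext _ _ fun n => ?_
    have e : L (r + s) - (L r + L s) =
        (L (r + s) - f n (r + s)) - ((L r - f n r) + (L s - f n s)) := by
      rw [map_add]; ring
    change q ^ n ∣ L (r + s) - (L r + L s)
    rw [e]
    exact dvd_sub (hL _ n) (dvd_add (hL r n) (hL s n))
  · intro a
    exact hext _ _ fun n => by simpa using hL (algebraMap A R a) n

variable {p : ℕ} [Fact p.Prime] {K : Type u} [Field K] [NumberField K]
  {Y : Over (Spec (CommRingCat.of (𝓞 K)))} {G : Over Y.left} [GrpObj G] {y : ResPoint p Y}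

/-- The evaluation at a point of the residue disk at the identity of a group scheme. -/
def Disk.groupHom (g : Disk (y ≫ idSection G)) (v : MaximalSpectrum (OKp p K)) :
    localRing (toOKv v) (y.at v ≫ idSection G) →ₐ[OKv v] OKv v :=
  g.evalHom v

lemma Disk.homPt_groupHom (g : Disk (y ≫ idSection G)) (v : MaximalSpectrum (OKp p K)) :
    homPt (y.at v ≫ idSection G)
        (g.groupHom v : localRing (toOKv v) (y.at v ≫ idSection G) →+* OKv v) =
      Spec.map (CommRingCat.ofHom (locMap v)) ≫ g.pt.left :=
  g.homPt_evalHom v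

lemma Disk.ext_groupHom {g g' : Disk (y ≫ idSection G)}
    (h : ∀ v, g.groupHom v = g'.groupHom v) : g = g' :=
  (Disk.evalHom_bijective _).1 (funext h)

lemma Disk.exists_groupHom_eq
    (h : ∀ v, localRing (toOKv v) (y.at v ≫ idSection G) →ₐ[OKv v] OKv v) :
    ∃ g : Disk (y ≫ idSection G), ∀ v, g.groupHom v = h v := by
  obtain ⟨g, hg⟩ := (Disk.evalHom_bijective (y ≫ idSection G)).2 h
  exact ⟨g, congrFun hg⟩

lemma Disk.modPow_eq_iff_groupHom (g g' : Disk (y ≫ idSection G)) (j : ℕ) :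
    g.modPow j = g'.modPow j ↔ ∀ v r, (p : OKv v) ^ j ∣ g.groupHom v r - g'.groupHom v r :=
  Disk.modPow_eq_iff g g' j

lemma Disk.evalHom_toBase (g : Disk (y ≫ idSection G)) (v : MaximalSpectrum (OKp p K)) :
    (g.toBase G).evalHom v = (g.groupHom v).comp (baseMap G (y.at v)) := by
  apply homPt_algHom_injective
  rw [Disk.homPt_evalHom, homPt_comp_baseMap, Disk.homPt_groupHom, Category.assoc]
  rfl

variable {σ : Disk y}

lemma toBase_incl (g : fibre G σ) : (fibre.incl G g).toBase G = σ := by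
  apply Disk.ext
  ext1
  exact Over.w g.1

lemma incl_injective : Function.Injective (fibre.incl G : fibre G σ → _) := by
  intro g g' h
  apply Subtype.ext
  ext1
  exact congrArg (fun d : Disk (y ≫ idSection G) => d.pt.left) h

lemma isCentered_groupHom {v : MaximalSpectrum (OKp p K)} {ϖ : OKv v}
    (hϖ : Ideal.span {ϖ} = maximalIdeal (OKv v)) (g : Disk (y ≫ idSection G)) :
    IsCentered ϖ (g.groupHom v) :=
  isCentered_of_isRational (isRational_localRing hϖ _) _

lemma span_le_jacobson {v : MaximalSpectrum (OKp p K)} {ϖ : OKv v}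
    (hϖ : Ideal.span {ϖ} = maximalIdeal (OKv v)) :
    Ideal.span {algebraMap (OKv v) (OKv v) ϖ} ≤ Ring.jacobson (OKv v) :=
  have := isAdicComplete_uniformizer hϖ
  ideal_le_ringJacobson (Ideal.span {ϖ})

lemma groupHom_incl_pow {v : MaximalSpectrum (OKp p K)} {ϖ : OKv v}
    (hϖ : Ideal.span {ϖ} = maximalIdeal (OKv v)) (g : fibre G σ) (n : ℕ) :
    (fibre.incl G (g ^ n)).groupHom v =
      powHom hϖ (span_le_jacobson hϖ) (isCentered_groupHom hϖ (fibre.incl G g)) n := by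
  apply homPt_algHom_injective
  rw [Disk.homPt_groupHom, homPt_powHom]
  have h1 : homPt (y.at v ≫ idSection G) ((fibre.incl G g).groupHom v :
      localRing (toOKv v) (y.at v ≫ idSection G) →+* OKv v) ≫ G.hom =
      Spec.map (CommRingCat.ofHom (locMap v)) ≫ σ.pt.left := by
    rw [Disk.homPt_groupHom, Category.assoc]
    congr 1
    exact Over.w g.1
  have h2 : pullPt G (Spec.map (CommRingCat.ofHom (locMap v))) h1.symm g.1 =
      fibrePt ((fibre.incl G g).groupHom v) := by
    apply hom_mk_ext
    exact (Disk.homPt_groupHom (fibre.incl G g) v).symm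
  rw [← h2, ← map_pow]
  rfl

/-- The reduction modulo `p ^ j` of points of a fibre. -/
def fibreRed (G : Over Y.left) [GrpObj G] (σ : Disk y) (j : ℕ) :
    fibre G σ →* FibrePoint G (specOverMap (toOKp p K) (ResidueDisk.modPow p K j) ≫ σ.pt) :=
  (FibrePoint.pullback G (specOverMap (toOKp p K) (ResidueDisk.modPow p K j)) σ.pt).comp
    (fibre G σ).subtype

lemma fibreRed_eq_iff (j : ℕ) (g g' : fibre G σ) :
    fibreRed G σ j g = fibreRed G σ j g' ↔
      (fibre.incl G g).modPow j = (fibre.incl G g').modPow j := by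
  constructor
  · intro h
    ext1
    exact congrArg (fun q => q.left) h
  · intro h
    ext1
    exact congrArg (fun q => q.left) h

/-- With `N + 1 = p ^ j` one has `(i + 1) * (N + 1).choose (i + 1) = (N + 1) * N.choose i`. The
factor `i + 1` is supplied by `ϖ ^ i`, which is divisible by `(i + 1)!`. -/
lemma pow_dvd_choose_mul {v : MaximalSpectrum (OKp p K)} {ϖ : OKv v}
    (hϖ : Ideal.span {ϖ} = maximalIdeal (OKv v))
    (he : (v.asIdeal.comap (toOKp p K)).ramificationIdx ℤ < p - 1) (j i : ℕ) :
    (p : OKv v) ^ j ∣ ((p ^ j).choose (i + 1) : OKv v) * ϖ ^ (i + 1) := by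
  obtain ⟨c, hc⟩ := exists_factorial_mul hϖ he
  obtain ⟨N, hN⟩ : ∃ N, p ^ j = N + 1 :=
    Nat.exists_eq_succ_of_ne_zero (pow_ne_zero _ (Fact.out : p.Prime).ne_zero)
  have h1 : (((N + 1).choose (i + 1) : ℕ) : OKv v) * ((i + 1 : ℕ) : OKv v) =
      ((N + 1 : ℕ) : OKv v) * (N.choose i : OKv v) := by
    rw [← Nat.cast_mul, ← Nat.cast_mul, Nat.add_one_mul_choose_eq]
  have h2 := (hc i).1
  rw [Nat.factorial_succ, Nat.cast_mul] at h2
  refine ⟨N.choose i * (i.factorial : OKv v) * c i * ϖ, ?_⟩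
  have h3 : (p : OKv v) ^ j = ((N + 1 : ℕ) : OKv v) := by rw [← hN]; simp
  rw [hN, h3, pow_succ, ← h2]
  linear_combination (i.factorial : OKv v) * c i * ϖ * h1

/-- By Newton's formula, the values at `g ^ (p ^ j)` and at the identity differ by a sum of terms
`(p ^ j).choose (i + 1)` times a difference divisible by `ϖ ^ (i + 1)`. -/
lemma fibreRed_pow (he : ∀ v : MaximalSpectrum (OKp p K),
    (v.asIdeal.comap (toOKp p K)).ramificationIdx ℤ < p - 1) (j : ℕ) (g : fibre G σ) :
    fibreRed G σ j (g ^ p ^ j) = 1 := by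
  rw [← map_one (fibreRed G σ j), fibreRed_eq_iff, Disk.modPow_eq_iff_groupHom]
  intro v r
  obtain ⟨ϖ, hϖ, -⟩ := exists_uniformizer v
  rw [← pow_zero g, groupHom_incl_pow hϖ, groupHom_incl_pow hϖ, powHom_eq_sum,
    Finset.sum_range_succ']
  simp only [Nat.choose_zero_right, one_smul, Function.iterate_zero, id_eq, add_sub_cancel_right]
  refine Finset.dvd_sum fun i _ => ?_
  obtain ⟨d, hd⟩ := pow_dvd_fwdDiff_powHom hϖ (span_le_jacobson hϖ)
    (isCentered_groupHom hϖ (fibre.incl G g)) (i + 1) r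
  rw [hd, nsmul_eq_mul, ← mul_assoc]
  exact dvd_mul_of_dvd_left (pow_dvd_choose_mul hϖ (he v) j i) _

/-- The powers with exponents in `ℤ_p` on the fibres of the residue disk at the identity. -/
theorem exists_fibre_action (he : ∀ v : MaximalSpectrum (OKp p K),
    (v.asIdeal.comap (toOKp p K)).ramificationIdx ℤ < p - 1) (G : Over Y.left) [GrpObj G]
    (σ : Disk y) :
    ∃ act : ℤ_[p] → fibre G σ → fibre G σ, IsPadicPowerAction act ∧
      ∀ (j : ℕ) (a : ℤ_[p]) (n : ℤ) (g : fibre G σ), a - n ∈ Ideal.span {(p : ℤ_[p]) ^ j} →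
        fibreRed G σ j (act a g) = fibreRed G σ j (g ^ n) := by
  have hH : ∀ v : MaximalSpectrum (OKp p K), IsAdicComplete (Ideal.span {(p : OKv v)}) (OKv v) :=
    fun v => inferInstance
  refine exists_padicPowerAction (fibreRed G σ) (fun g g' h => ?_) (fun f hf => ?_)
    (fibreRed_pow he)
  · refine incl_injective (Disk.ext_groupHom fun v => AlgHom.ext fun r => ?_)
    have := hH v
    refine sub_eq_zero.1 (dvd_pow_of_isHausdorff (q := (p : OKv v)) fun j => ?_)
    exact (Disk.modPow_eq_iff_groupHom _ _ j).1 ((fibreRed_eq_iff j _ _).1 (h j)) v r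
  · have h1 : ∀ v, ∃ L : localRing (toOKv v) (y.at v ≫ idSection G) →ₐ[OKv v] OKv v,
        ∀ j r, (p : OKv v) ^ j ∣ L r - (fibre.incl G (f j)).groupHom v r := fun v =>
      have := hH v
      exists_limit_algHom (fun j => (fibre.incl G (f j)).groupHom v) fun j r =>
        (Disk.modPow_eq_iff_groupHom _ _ j).1 ((fibreRed_eq_iff j _ _).1 (hf j)) v r
    choose L hL using h1
    obtain ⟨g, hg⟩ := Disk.exists_groupHom_eq L
    -- The limit point stays in the fibre: on functions from the base, every term of the sequence
    -- has the values prescribed by `σ`.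
    have hbase : g.toBase G = σ := by
      apply (Disk.evalHom_bijective y).1
      funext v
      refine AlgHom.ext fun r => ?_
      have := hH v
      refine sub_eq_zero.1 (dvd_pow_of_isHausdorff (q := (p : OKv v)) fun j => ?_)
      have h2 := hL v j (baseMap G (y.at v) r)
      have h3 : σ.evalHom v = ((fibre.incl G (f j)).toBase G).evalHom v := by rw [toBase_incl]
      change _ ∣ (g.toBase G).evalHom v r - σ.evalHom v r
      rw [h3, Disk.evalHom_toBase, Disk.evalHom_toBase, hg]
      exact h2
    obtain ⟨h, hh⟩ := exists_incl_eq G g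
    subst hbase
    refine ⟨h, fun j => ?_⟩
    rw [fibreRed_eq_iff, hh, Disk.modPow_eq_iff_groupHom]
    intro v r
    rw [hg]
    exact hL v j r

/-- The action of `ℤ_p` on the residue disk at the identity of a group scheme. -/
theorem exists_disk_action (he : ∀ v : MaximalSpectrum (OKp p K),
    (v.asIdeal.comap (toOKp p K)).ramificationIdx ℤ < p - 1) (G : Over Y.left) [GrpObj G]
    (y : ResPoint p Y) :
    ∃ A : ℤ_[p] → Disk (y ≫ idSection G) → Disk (y ≫ idSection G),
      (∀ σ : Disk y, ∃ act : ℤ_[p] → fibre G σ → fibre G σ, IsPadicPowerAction act ∧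
        ∀ a g, A a (fibre.incl G g) = fibre.incl G (act a g)) ∧
      ∀ (j : ℕ) (a a' : ℤ_[p]) (g : Disk (y ≫ idSection G)),
        a - a' ∈ Ideal.span {(p : ℤ_[p]) ^ j} → (A a g).modPow j = (A a' g).modPow j := by
  choose act hact hact' using fun σ : Disk y => exists_fibre_action he G σ
  choose lift hlift using fun g : Disk (y ≫ idSection G) => exists_incl_eq G g
  refine ⟨fun a g => fibre.incl G (act _ a (lift g)), fun σ => ⟨act σ, hact σ, fun a g => ?_⟩,
    fun j a a' g haa' => ?_⟩
  -- The chosen lift lies in the fibre over its own image, which equals `σ` only propositionally;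
  -- the statement is generalized over `σ'` so that the equality can be substituted.
  · have h1 : ∀ (σ' : Disk y) (g' : fibre G σ'), σ' = σ → fibre.incl G g' = fibre.incl G g →
        fibre.incl G (act σ' a g') = fibre.incl G (act σ a g) := by
      rintro σ' g' rfl h
      rw [incl_injective h]
    exact h1 _ _ (toBase_incl g) (hlift _)
  · have hn : a - (a.appr j : ℤ) ∈ Ideal.span {(p : ℤ_[p]) ^ j} := by
      exact_mod_cast PadicInt.appr_spec j a
    have hn' : a' - (a.appr j : ℤ) ∈ Ideal.span {(p : ℤ_[p]) ^ j} := by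
      have := sub_mem hn haa'
      convert this using 1
      ring
    rw [← fibreRed_eq_iff, hact' _ j a _ _ hn, hact' _ j a' _ _ hn']

end Action

/-! ### Coordinate systems adapted to a section -/

section RelativeCoordinates

open IsLocalRing

variable {A R S : Type*} [CommRing A] [CommRing R] [CommRing S] [Algebra A R] [Algebra A S]
  [IsLocalRing R] [IsLocalRing S] {ϖ : A}

lemma IsRational.map_mem (hR : IsRational ϖ R) (hS : IsRational ϖ S) (f : S →ₐ[A] R) {r : S}
    (hr : r ∈ maximalIdeal S) : f r ∈ maximalIdeal R := by
  obtain ⟨a, ha⟩ := hR.exists_sub_mem (f r)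
  by_cases hϖ : ϖ ∣ a
  · have h1 := add_mem ha ((hR.mem_iff a).2 hϖ)
    rwa [sub_add_cancel] at h1
  · exfalso
    have h1 : r - algebraMap A S a ∉ maximalIdeal S := fun h =>
      hϖ ((hS.mem_iff a).1 (by simpa using sub_mem hr h))
    rw [mem_maximalIdeal, mem_nonunits_iff, not_not] at h1
    have h2 := h1.map f
    rw [map_sub, AlgHom.commutes] at h2
    exact ha h2

/-- A coordinate system of `R` and a basis of the conormal module of a section yield a coordinate
system of `S`. -/
theorem IsCoordinateSystem.sumElim (hR : IsRational ϖ R) (hS : IsRational ϖ S)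
    (P : R →ₐ[A] S) (E : S →ₐ[A] R) (hEP : ∀ r, E (P r) = r) (I : Ideal S)
    (hI : ∀ x, x ∈ I ↔ E x = 0) {J J' : Type*} [Fintype J'] {s : J → R}
    (hs : IsCoordinateSystem ϖ s) {t : J' → I} (B : Module.Basis J' (S ⧸ I) I.Cotangent)
    (hB : ∀ i, B i = I.toCotangent (t i)) :
    IsCoordinateSystem ϖ (Sum.elim (fun i => P (s i)) fun i => (t i : S)) := by
  have hIm : I ≤ maximalIdeal S := fun x hx => by
    rw [mem_maximalIdeal, mem_nonunits_iff]
    intro h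
    have := h.map E
    rw [(hI x).1 hx] at this
    exact not_isUnit_zero this
  have hsub : ∀ r, r - P (E r) ∈ I := fun r => by rw [hI, map_sub, hEP, sub_self]
  have hspan : I ≤ Ideal.span (Set.range fun i => (t i : S)) ⊔ I ^ 2 := by
    intro x hx
    choose d hd using fun i => Ideal.Quotient.mk_surjective (B.repr (I.toCotangent ⟨x, hx⟩) i)
    have h1 : I.toCotangent (⟨x, hx⟩ - ∑ i, d i • t i) = 0 := by
      rw [map_sub, map_sum, sub_eq_zero, ← B.sum_repr (I.toCotangent ⟨x, hx⟩)]
      refine Finset.sum_congr rfl fun i _ => ?_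
      rw [map_smul, hB, ← hd]
      rfl
    have h2 : x - ∑ i, d i * (t i : S) ∈ I ^ 2 := by
      have := (Ideal.toCotangent_eq_zero I _).1 h1
      simpa using this
    rw [← add_sub_cancel (∑ i, d i * (t i : S)) x]
    refine Submodule.add_mem_sup (Ideal.sum_mem _ fun i _ => ?_) h2
    exact Ideal.mul_mem_left _ _ (Ideal.subset_span ⟨i, rfl⟩)
  refine ⟨?_, ?_, ?_⟩
  · rintro (i | i)
    · exact IsRational.map_mem hS hR P (hs.mem i)
    · exact hIm (t i).2
  · intro r hr
    -- Decompose `r = P (E r) + (r - P (E r))`. The first summand is treated by the coordinates of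
    -- `R`, the second lies in `I` and is treated by the basis of `I / I ^ 2`.
    set T := insert (algebraMap A S ϖ)
      (Set.range (Sum.elim (fun i => P (s i)) fun i => (t i : S)))
    have h1 : P (E r) ∈ Ideal.span T ⊔ maximalIdeal S ^ 2 := by
      have h2 := Ideal.mem_map_of_mem P (hs.le_span (IsRational.map_mem hR hS E hr))
      rw [Ideal.map_sup, Ideal.map_pow, Ideal.map_span] at h2
      refine (sup_le_sup (Ideal.span_mono ?_) (Ideal.pow_right_mono ?_ 2) :
        _ ≤ Ideal.span T ⊔ maximalIdeal S ^ 2) h2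
      · rintro _ ⟨_, rfl | ⟨i, rfl⟩, rfl⟩
        · exact Or.inl (P.commutes ϖ)
        · exact Or.inr ⟨Sum.inl i, rfl⟩
      · exact Ideal.map_le_iff_le_comap.2 fun x hx => IsRational.map_mem hS hR P hx
    have h3 : r - P (E r) ∈ Ideal.span T ⊔ maximalIdeal S ^ 2 := by
      refine (sup_le_sup (Ideal.span_mono ?_) (Ideal.pow_right_mono hIm 2) :
        _ ≤ Ideal.span T ⊔ maximalIdeal S ^ 2) (hspan (hsub r))
      rintro _ ⟨i, rfl⟩
      exact Or.inr ⟨Sum.inr i, rfl⟩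
    have := add_mem h1 h3
    rwa [add_sub_cancel] at this
  · intro c
    have hPE : ∀ r, residue S (P (E r)) = residue S r := fun r => by
      rw [eq_comm, ← sub_eq_zero, ← map_sub, residue_eq_zero_iff]
      exact hIm (hsub r)
    have : IsLocalHom (P : R →+* S) := ⟨fun r hr => by
      have := hr.map E
      rwa [RingHom.coe_coe, hEP] at this⟩
    let Pbar : ResidueField R →+* ResidueField S := ResidueField.map (P : R →+* S)
    have hPbar : ∀ r, Pbar (residue R r) = residue S (P r) := fun r => rfl
    have hsurj : ∀ i, ∃ a : ResidueField R, Pbar a = c (Sum.inl i) := fun i => by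
      obtain ⟨x, hx⟩ := residue_surjective (c (Sum.inl i))
      exact ⟨residue R (E x), by rw [hPbar, hPE, hx]⟩
    choose a ha using hsurj
    obtain ⟨DY, hDY⟩ := hs.exists_derivation a
    have hsmulR : ∀ (r : R) (x : ResidueField R), r • x = residue R r * x := fun r x =>
      Algebra.smul_def r x
    have hsmulS : ∀ (r : S) (x : ResidueField S), r • x = residue S r * x := fun r x =>
      Algebra.smul_def r x
    have hsmulA : ∀ (r : A) (x : ResidueField R), Pbar (r • x) = r • Pbar x := fun r x => by
      rw [← algebraMap_smul R r x, hsmulR, map_mul, hPbar, P.commutes, ← hsmulS, algebraMap_smul]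
    -- the part along the base
    let D₁ : Derivation A S (ResidueField S) := Derivation.mk'
      { toFun := fun r => Pbar (DY (E r))
        map_add' := fun r r' => by rw [map_add, map_add, map_add]
        map_smul' := fun r x => by rw [map_smul, Derivation.map_smul, hsmulA]; rfl }
      (fun r r' => by
        change Pbar (DY (E (r * r'))) = r • Pbar (DY (E r')) + r' • Pbar (DY (E r))
        rw [map_mul, Derivation.leibniz, map_add, hsmulR, hsmulR, map_mul, map_mul, hPbar, hPbar,
          hPE, hPE, hsmulS, hsmulS])
    -- the part along the fibres
    let fac : S ⧸ I →+* ResidueField S := Ideal.Quotient.lift I (residue S) fun x hx =>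
      (residue_eq_zero_iff x).2 (hIm hx)
    have hfac : ∀ x, fac (Ideal.Quotient.mk I x) = residue S x := fun x => rfl
    let l : I →ₗ[S] ResidueField S :=
      { toFun := fun x => ∑ i, fac (B.repr (I.toCotangent x) i) * c (Sum.inr i)
        map_add' := fun x x' => by
          simp only [map_add, Finsupp.add_apply, add_mul, Finset.sum_add_distrib]
        map_smul' := fun r x => by
          have h1 : I.toCotangent (r • x) = Ideal.Quotient.mk I r • I.toCotangent x := by
            rw [map_smul]; rfl
          simp only [h1, map_smul, Finsupp.smul_apply, smul_eq_mul, map_mul, hfac, hsmulS,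
            Finset.mul_sum, mul_assoc, RingHom.id_apply] }
    have hl : ∀ i, l (t i) = c (Sum.inr i) := fun i => by
      classical
      change ∑ j, fac (B.repr (I.toCotangent (t i)) j) * c (Sum.inr j) = _
      rw [← hB, B.repr_self, Finset.sum_eq_single i]
      · simp
      · intro j _ hj
        simp [hj.symm]
      · simp
    have hcongr : ∀ {x x' : S} (hx : x ∈ I) (hx' : x' ∈ I), x = x' → l ⟨x, hx⟩ = l ⟨x', hx'⟩ := by
      rintro x _ _ _ rfl
      rfl
    let D₂ : Derivation A S (ResidueField S) := Derivation.mk'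
      { toFun := fun r => l ⟨r - P (E r), hsub r⟩
        map_add' := fun r r' => by
          rw [← map_add]
          exact hcongr _ _ (by rw [map_add, map_add]; ring)
        map_smul' := fun r x => by
          rw [RingHom.id_apply, ← algebraMap_smul S r (l _), ← map_smul]
          refine hcongr _ _ ?_
          rw [map_smul, map_smul]
          change _ = algebraMap A S r • (x - P (E x))
          rw [algebraMap_smul, smul_sub] }
      (fun r r' => by
        change l ⟨r * r' - P (E (r * r')), hsub _⟩ = r • l ⟨r' - P (E r'), hsub _⟩ +
          r' • l ⟨r - P (E r), hsub _⟩
        -- The elements `r'` and `P (E r')` act equally on the residue field. After this exchange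
        -- the Leibniz rule becomes an identity inside `I`.
        have h1 : r' • l ⟨r - P (E r), hsub _⟩ = P (E r') • l ⟨r - P (E r), hsub _⟩ := by
          rw [hsmulS, hsmulS, hPE]
        rw [h1, ← map_smul, ← map_smul, ← map_add]
        refine hcongr _ _ ?_
        change _ = r * (r' - P (E r')) + P (E r') * (r - P (E r))
        rw [map_mul, map_mul]
        ring)
    refine ⟨D₁ + D₂, ?_⟩
    rintro (i | i)
    · change Pbar (DY (E (P (s i)))) + l ⟨P (s i) - P (E (P (s i))), hsub _⟩ = _
      have h0 : l ⟨P (s i) - P (E (P (s i))), hsub _⟩ = 0 :=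
        (hcongr _ I.zero_mem (by rw [hEP, sub_self])).trans (map_zero l)
      rw [h0, add_zero, hEP, hDY, ha]
    · change Pbar (DY (E (t i))) + l ⟨t i - P (E (t i)), hsub _⟩ = _
      have h0 : E (t i) = 0 := (hI _).1 (t i).2
      rw [hcongr _ (t i).2 (by rw [h0, map_zero, sub_zero]), h0, map_zero, map_zero, zero_add]
      exact hl i

end RelativeCoordinates

/-! ### Newton series -/

section Newton

lemma exists_sum_of_isPrecomplete {W : Type*} [CommRing W] {q : W}
    [IsPrecomplete (Ideal.span {q}) W] (t : ℕ → W) (d : ℕ) (hd : 0 < d)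
    (ht : ∀ i, q ^ (i / d) ∣ t i) :
    ∃ S, ∀ N M, N * d ≤ M → q ^ N ∣ S - ∑ i ∈ Finset.range M, t i := by
  have key : ∀ N M, N * d ≤ M →
      q ^ N ∣ ∑ i ∈ Finset.range M, t i - ∑ i ∈ Finset.range (N * d), t i := by
    intro N M hM
    rw [← Finset.sum_Ico_eq_sub _ hM]
    refine Finset.dvd_sum fun i hi => (pow_dvd_pow q ?_).trans (ht i)
    exact (Nat.le_div_iff_mul_le hd).2 (Finset.mem_Ico.1 hi).1
  obtain ⟨S, hS⟩ := exists_limit_of_isPrecomplete (q := q)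
    (fun N => ∑ i ∈ Finset.range (N * d), t i)
    fun N => key N _ (Nat.mul_le_mul_right d N.le_succ)
  refine ⟨S, fun N M hM => ?_⟩
  have := dvd_sub (hS N) (key N M hM)
  rwa [sub_sub_sub_cancel_right] at this

lemma prod_range_natCast_sub {W : Type*} [CommRing W] (n k : ℕ) :
    ∏ l ∈ Finset.range k, ((n : W) - l) = n.choose k * k.factorial := by
  rw [← descPochhammer_eval_eq_prod_range, descPochhammer_eval_eq_descFactorial,
    Nat.descFactorial_eq_factorial_mul_choose, Nat.cast_mul, mul_comm]

/-- The Newton series of a function on `ℕ` whose differences are divisible by powers of `ϖ`, as an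
element depending on the variable `X`. -/
theorem exists_newtonSeries {A W : Type*} [CommRing A] [CommRing W] [Algebra A W] {ϖ : A}
    [IsPrecomplete (Ideal.span {algebraMap A W ϖ}) W] [IsHausdorff (Ideal.span {ϖ}) A]
    {c : ℕ → A} {d : ℕ} (hd : 0 < d)
    (hc : ∀ i, ((i + 1).factorial : A) * c i = ϖ ^ i ∧ ϖ ^ (i / d) ∣ c i) (X : W)
    (Δ : ℕ → W) (hΔ : ∀ i, algebraMap A W ϖ ^ i ∣ Δ i) (hΔ0 : Δ 0 = 0) :
    ∃ Ψ : W, ∀ (χ : W →ₐ[A] A) (n : ℕ), χ X = n →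
      ϖ * χ Ψ = ∑ i ∈ Finset.range (n + 1), n.choose i • χ (Δ i) := by
  choose δ hδ using hΔ
  -- The summand is an integral form of `binom(X, i + 1) * Δ (i + 1) / ϖ`: with `Δ (i + 1) = ϖ ^ (i
  -- + 1) * δ (i + 1)`, the quotient `ϖ ^ i / (i + 1)!` is `c i`. The omitted factor `ϖ` is the one
  -- by which charts divide.
  obtain ⟨Ψ, hΨ⟩ := exists_sum_of_isPrecomplete (q := algebraMap A W ϖ)
    (fun i => (∏ l ∈ Finset.range (i + 1), (X - l)) * (algebraMap A W (c i) * δ (i + 1))) d hd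
    fun i => dvd_mul_of_dvd_right (dvd_mul_of_dvd_left
      (by rw [← map_pow]; exact map_dvd _ (hc i).2) _) _
  refine ⟨Ψ, fun χ n hχ => sub_eq_zero.1 (dvd_pow_of_isHausdorff (q := ϖ) fun N => ?_)⟩
  -- The cut-off `N * d` ensures precision `ϖ ^ N`, and the additional `n` includes all nonzero
  -- binomial coefficients.
  have h1 := map_dvd χ (hΨ N (N * d + n) (Nat.le_add_right _ _))
  rw [map_pow, AlgHom.commutes, Algebra.algebraMap_self, RingHom.id_apply, map_sub, map_sum] at h1
  have h2 : ∑ i ∈ Finset.range (n + 1), n.choose i • χ (Δ i) = ϖ *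
      ∑ i ∈ Finset.range (N * d + n), χ ((∏ l ∈ Finset.range (i + 1), (X - l)) *
        (algebraMap A W (c i) * δ (i + 1))) := by
    have h3 : ∑ i ∈ Finset.range (n + 1), n.choose i • χ (Δ i) =
        ∑ i ∈ Finset.range (N * d + n + 1), n.choose i • χ (Δ i) := by
      refine Finset.sum_subset (fun i hi => ?_) fun i _ hi => ?_
      · rw [Finset.mem_range] at *
        exact hi.trans_le (by omega)
      · rw [Finset.mem_range, not_lt] at hi
        rw [Nat.choose_eq_zero_of_lt hi, zero_smul]
    rw [h3, Finset.sum_range_succ', hΔ0, map_zero, smul_zero, add_zero, Finset.mul_sum]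
    refine Finset.sum_congr rfl fun i _ => ?_
    rw [map_mul, map_prod, map_mul, AlgHom.commutes, Algebra.algebraMap_self, RingHom.id_apply,
      hδ, map_mul, map_pow, AlgHom.commutes, Algebra.algebraMap_self, RingHom.id_apply]
    have h4 : ∏ l ∈ Finset.range (i + 1), χ (X - l) = n.choose (i + 1) * (i + 1).factorial := by
      rw [← prod_range_natCast_sub]
      refine Finset.prod_congr rfl fun l _ => ?_
      rw [map_sub, hχ, map_natCast]
    rw [h4, nsmul_eq_mul, pow_succ, ← (hc i).1]
    ring
  rw [h2, ← mul_sub]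
  exact dvd_mul_of_dvd_right h1 _

end Newton

/-! ### The action in coordinates -/

section ActionCoordinates

open IsLocalRing

variable {p : ℕ} [Fact p.Prime] {K : Type u} [Field K] [NumberField K]
  {Y : Over (Spec (CommRingCat.of (𝓞 K)))} {G : Over Y.left} [GrpObj G] {y : ResPoint p Y}
  {ϖ : ∀ v : MaximalSpectrum (OKp p K), OKv v} {n m k : MaximalSpectrum (OKp p K) → ℕ}
  {b : ∀ v, Module.Basis (Fin (k v)) ℤ_[p] (OKv v)}

/-- The pull-backs of local parameters of `Y` together with relative local parameters. -/
def totalParameters (s : LocalParameters y ϖ n) (t : RelativeLocalParameters G y m)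
    (v : MaximalSpectrum (OKp p K)) :
    Fin (n v) ⊕ Fin (m v) → ResPoint.localRing (y ≫ idSection G) v :=
  Sum.elim (fun i => baseMap G (y.at v) (s.t v i)) fun i => (t.t v i).1

lemma isCoordinateSystem_totalParameters
    (hϖ : ∀ v, Ideal.span {ϖ v} = maximalIdeal (OKv v)) (s : LocalParameters y ϖ n)
    (t : RelativeLocalParameters G y m) (v : MaximalSpectrum (OKp p K)) :
    IsCoordinateSystem (ϖ v) (totalParameters s t v) := by
  let I : Ideal (localRing (toOKv v) (y.at v ≫ idSection G)) := idKernel G y v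
  obtain ⟨B, hB⟩ : ∃ B : Module.Basis (Fin (m v))
      (localRing (toOKv v) (y.at v ≫ idSection G) ⧸ I) I.Cotangent,
    ∀ i, B i = I.toCotangent (t.t v i) := t.basis v
  have h1 : ∀ x, x ∈ I ↔ sectionMap G (y.at v) x = 0 := fun x => Iff.rfl
  exact IsCoordinateSystem.sumElim (isRational_localRing (hϖ v) (y.at v))
    (isRational_localRing (hϖ v) (y.at v ≫ idSection G)) (baseMap G (y.at v))
    (sectionMap G (y.at v)) sectionMap_baseMap I h1 (s.isCoordinateSystem hϖ v) B hB

lemma relativeCoordinates_eq (s : LocalParameters y ϖ n) (t : RelativeLocalParameters G y m)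
    (v : MaximalSpectrum (OKp p K)) (i : Fin (n v) ⊕ Fin (m v)) (g : Disk (y ≫ idSection G)) :
    relativeCoordinates G s t v i g = g.eval (totalParameters s t v i) := by
  rcases i with i | i
  · change (g.toBase G).evalHom v (s.t v i) = g.groupHom v (baseMap G (y.at v) (s.t v i))
    rw [Disk.evalHom_toBase]
    rfl
  · rfl

lemma exists_relative_chart (hY : Smooth Y.hom) (hG : Smooth G.hom)
    (hϖ : ∀ v, Ideal.span {ϖ v} = maximalIdeal (OKv v)) (s : LocalParameters y ϖ n)
    (t : RelativeLocalParameters G y m) :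
    ∃ e : Disk (y ≫ idSection G) ≃ ((Σ v, (Fin (n v) ⊕ Fin (m v)) × Fin (k v)) → ℤ_[p]),
      IsChart ϖ b (relativeCoordinates G s t) e := by
  have hX : Smooth (total G).hom := inferInstanceAs (Smooth (G.hom ≫ Y.hom))
  obtain ⟨e, he⟩ := exists_chart (b := b) hX hϖ (isCoordinateSystem_totalParameters hϖ s t)
  refine ⟨e, fun g v i => ?_⟩
  rw [relativeCoordinates_eq]
  exact he g v i

variable {A : ℤ_[p] → Disk (y ≫ idSection G) → Disk (y ≫ idSection G)}

lemma toBase_action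
    (hA : ∀ σ : Disk y, ∃ act : ℤ_[p] → fibre G σ → fibre G σ, IsPadicPowerAction act ∧
      ∀ a g, A a (fibre.incl G g) = fibre.incl G (act a g))
    (a : ℤ_[p]) (g : Disk (y ≫ idSection G)) : (A a g).toBase G = g.toBase G := by
  obtain ⟨act, -, hact⟩ := hA (g.toBase G)
  obtain ⟨h, hh⟩ := exists_incl_eq G g
  have h1 := hact a h
  rw [hh] at h1
  rw [h1, toBase_incl]

lemma groupHom_action_natCast
    (hA : ∀ σ : Disk y, ∃ act : ℤ_[p] → fibre G σ → fibre G σ, IsPadicPowerAction act ∧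
      ∀ a g, A a (fibre.incl G g) = fibre.incl G (act a g))
    {v : MaximalSpectrum (OKp p K)} {ϖ : OKv v} (hϖ : Ideal.span {ϖ} = maximalIdeal (OKv v))
    (l : ℕ) (g : Disk (y ≫ idSection G)) :
    (A l g).groupHom v = powHom hϖ (span_le_jacobson hϖ) (isCentered_groupHom hϖ g) l := by
  obtain ⟨act, h1, hact⟩ := hA (g.toBase G)
  obtain ⟨h, hh⟩ := exists_incl_eq G g
  generalize g.toBase G = σ at *
  subst hh
  have h2 : act l h = h ^ l := by
    have := h1.intCast l h
    rwa [Int.cast_natCast, zpow_natCast] at this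
  rw [hact, h2, groupHom_incl_pow hϖ]

/-- In coordinates, the action of `ℤ_p` is given by convergent power series. -/
theorem givenByConvergentPowerSeries_action (hY : Smooth Y.hom) (hG : Smooth G.hom)
    (hram : ∀ v : MaximalSpectrum (OKp p K),
      (v.asIdeal.comap (toOKp p K)).ramificationIdx ℤ < p - 1)
    (hA : ∀ σ : Disk y, ∃ act : ℤ_[p] → fibre G σ → fibre G σ, IsPadicPowerAction act ∧
      ∀ a g, A a (fibre.incl G g) = fibre.incl G (act a g))
    (hA' : ∀ (j : ℕ) (a a' : ℤ_[p]) (g : Disk (y ≫ idSection G)),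
      a - a' ∈ Ideal.span {(p : ℤ_[p]) ^ j} → (A a g).modPow j = (A a' g).modPow j)
    (hϖ : ∀ v, Ideal.span {ϖ v} = maximalIdeal (OKv v)) (s : LocalParameters y ϖ n)
    (t : RelativeLocalParameters G y m)
    {e : Disk (y ≫ idSection G) ≃ ((Σ v, (Fin (n v) ⊕ Fin (m v)) × Fin (k v)) → ℤ_[p])}
    (he : IsChart ϖ b (relativeCoordinates G s t) e) :
    GivenByConvergentPowerSeries
      fun z : Option (Σ v, (Fin (n v) ⊕ Fin (m v)) × Fin (k v)) → ℤ_[p] =>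
        e (A (z none) (e.symm fun i => z (some i))) := by
  have hX : Smooth (total G).hom := inferInstanceAs (Smooth (G.hom ≫ Y.hom))
  have hτ := isCoordinateSystem_totalParameters hϖ s t
  have he' : IsChart ϖ b (fun v i (g : Disk (y ≫ idSection G)) =>
      g.eval (totalParameters s t v i)) e := fun g v i => by
    rw [he, relativeCoordinates_eq]
  refine givenByConvergentPowerSeries_of_seriesEval hϖ he _ fun v i => ?_
  have hcompl := isAdicComplete_uniformizer (hϖ v)
  rcases i with i | i
  -- The action preserves fibres, so the coordinates along the base are unchanged, hence polynomial.
  · refine ⟨genericElement ϖ b v fun j => some ⟨v, Sum.inl i, j⟩, fun z => ?_⟩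
    change ((A _ _).toBase G).eval _ = _
    rw [toBase_action hA, seriesEval_genericElement]
    have h1 := he (e.symm fun i => z (some i)) v (Sum.inl i)
    rw [Equiv.apply_symm_apply] at h1
    exact h1.symm
  · let α := Option (Σ v, (Fin (n v) ⊕ Fin (m v)) × Fin (k v))
    have hcomplW := restrictedSeries.isAdicComplete α (isLeftRegular_uniformizer (hϖ v))
    have hW := ideal_le_ringJacobson
      (Ideal.span {algebraMap (OKv v) (restrictedSeries (ϖ v) α) (ϖ v)})
    obtain ⟨h, hh, hh'⟩ := exists_universalHom (b := b) hX hϖ hτ v fun i j =>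
      (some ⟨v, i, j⟩ : α)
    let h₁ : localRing (toOKv v) (y.at v ≫ idSection G) →ₐ[OKv v] restrictedSeries (ϖ v) α := h
    have hh₁ : IsCentered (ϖ v) h₁ := hh
    let r : localRing (toOKv v) (y.at v ≫ idSection G) := (t.t v i).1
    have hr : sectionMap G (y.at v) r = 0 := (t.t v i).2
    have hp1 : 0 < p - 1 := (Nat.zero_le _).trans_lt (hram v)
    obtain ⟨c, hc⟩ := exists_factorial_mul (hϖ v) (hram v)
    -- The Newton series is formed at the universal point, with the variable `none` as the exponent.
    -- There is no constant term because `r` vanishes on the identity section.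
    obtain ⟨Ψ, hΨ⟩ := exists_newtonSeries hp1 hc
      (restrictedSeries.ofPolynomial (MvPolynomial.X (none : α)))
      (fun i => (fwdDiff 1)^[i] (fun j => powHom (hϖ v) hW hh₁ j r) 0)
      (fun i => pow_dvd_fwdDiff_powHom (hϖ v) hW hh₁ i r) (by
        change powHom (hϖ v) hW hh₁ 0 r = 0
        rw [powHom_zero, hr, map_zero, map_zero])
    refine ⟨Ψ, fun z => ?_⟩
    set g := e.symm fun i => z (some i) with hg
    change (A (z none) g).groupHom v r = _
    refine sub_eq_zero.1 (dvd_pow_of_isHausdorff (q := ϖ v) fun N => ?_)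
    -- Newton's formula is available for natural exponents only. Replacing the exponent by `l`,
    -- congruent to it modulo `p ^ N`, changes both sides by multiples of `ϖ ^ N`, and `N` is
    -- arbitrary.
    let l := (z none).appr N
    let z' : α → ℤ_[p] := fun i => i.elim (l : ℤ_[p]) fun i => z (some i)
    have h1 : ϖ v ^ N ∣ (A (z none) g).groupHom v r - (A l g).groupHom v r :=
      (pow_dvd_pow_of_dvd (uniformizer_dvd_p (hϖ v)) N).trans
        ((Disk.modPow_eq_iff_groupHom _ _ N).1
          (hA' N _ _ g (PadicInt.appr_spec N (z none))) v r)
    have h2 : (seriesEval (hϖ v) z').comp h₁ = g.groupHom v :=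
      seriesEval_comp_universalHom hϖ hτ he' v some hh' z'
    have h3 : (A l g).groupHom v r = ϖ v * seriesEval (hϖ v) z' Ψ := by
      rw [hΨ (seriesEval (hϖ v) z') l, groupHom_action_natCast hA (hϖ v)]
      · have h4 := comp_powHom (hϖ v) hW (span_le_jacobson (hϖ v)) hh₁ (seriesEval (hϖ v) z')
          (by rw [h2]; exact isCentered_groupHom (hϖ v) g) l
        simp only [h2] at h4
        rw [← h4, AlgHom.comp_apply, powHom_eq_sum, map_sum]
        simp only [map_nsmul]
      · rw [seriesEval_ofPolynomial, MvPolynomial.aeval_X]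
        change algebraMap ℤ_[p] (OKv v) (l : ℤ_[p]) = _
        rw [map_natCast]
    have h5 : ϖ v ^ N ∣ seriesEval (hϖ v) z Ψ - seriesEval (hϖ v) z' Ψ := by
      refine restrictedSeries.pow_dvd_eval_sub_eval (isLeftRegular_uniformizer (hϖ v)) _ _ N (fun i => ?_) Ψ
      rcases i with _ | i
      · have h6 : (p : ℤ_[p]) ^ N ∣ z none - l :=
          Ideal.mem_span_singleton.1 (PadicInt.appr_spec N (z none))
        have h7 := map_dvd (algebraMap ℤ_[p] (OKv v)) h6
        rw [map_pow, map_natCast, map_sub] at h7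
        exact (pow_dvd_pow_of_dvd (uniformizer_dvd_p (hϖ v)) N).trans h7
      · change _ ∣ algebraMap ℤ_[p] (OKv v) (z (some i)) - algebraMap ℤ_[p] (OKv v) (z (some i))
        rw [sub_self]
        exact dvd_zero _
    rw [h3] at h1
    have h8 := dvd_sub h1 (dvd_mul_of_dvd_right h5 (ϖ v))
    rwa [mul_sub, sub_sub_sub_cancel_right] at h8

end ActionCoordinates

end ResidueDisk

end

/-! ### The theorem -/

theorem mainTheorem8 (p : ℕ) [Fact p.Prime] (K : Type u) [Field K] [NumberField K] :
    -- (1) morphisms of smooth schemes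
    (∀ (X Y : Over (Spec (CommRingCat.of (𝓞 K)))) (m n : ℕ)
        (_ : SmoothOfRelativeDimension m X.hom) (_ : SmoothOfRelativeDimension n Y.hom)
        (f : X ⟶ Y) (x : ResidueDisk.ResPoint p X)
        -- uniformizers, local parameters, and `ℤ_p`-bases for the restriction of scalars
        (ϖ : ∀ v : MaximalSpectrum (ResidueDisk.OKp p K), ResidueDisk.OKv v)
        (_ : ∀ v, Ideal.span {ϖ v} = IsLocalRing.maximalIdeal (ResidueDisk.OKv v))
        (t : ResidueDisk.LocalParameters x ϖ (fun _ => m))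
        (s : ResidueDisk.LocalParameters (x ≫ f) ϖ (fun _ => n))
        (k : MaximalSpectrum (ResidueDisk.OKp p K) → ℕ)
        (b : ∀ v, Module.Basis (Fin (k v)) ℤ_[p] (ResidueDisk.OKv v)),
      Nat.card (Σ v : MaximalSpectrum (ResidueDisk.OKp p K), Fin m × Fin (k v)) =
          Module.finrank ℚ K * m ∧
      Nat.card (Σ v : MaximalSpectrum (ResidueDisk.OKp p K), Fin n × Fin (k v)) =
          Module.finrank ℚ K * n ∧
      ∃ (eX : ResidueDisk.Disk x ≃
            ((Σ v : MaximalSpectrum (ResidueDisk.OKp p K), Fin m × Fin (k v)) → ℤ_[p]))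
        (eY : ResidueDisk.Disk (x ≫ f) ≃
            ((Σ v : MaximalSpectrum (ResidueDisk.OKp p K), Fin n × Fin (k v)) → ℤ_[p])),
        ResidueDisk.IsChart ϖ b (fun v i σ => σ.eval (t.t v i)) eX ∧
        ResidueDisk.IsChart ϖ b (fun v i σ => σ.eval (s.t v i)) eY ∧
        ResidueDisk.GivenByConvergentPowerSeries (fun z => eY ((eX.symm z).map f))) ∧
    -- (2) smooth group schemes, for `e(𝔭/p) < p - 1` at all `𝔭` above `p`
    ((∀ 𝔭 : Ideal (𝓞 K), 𝔭.IsPrime → (p : 𝓞 K) ∈ 𝔭 → 𝔭.ramificationIdx ℤ < p - 1) →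
      ∀ (Y : Over (Spec (CommRingCat.of (𝓞 K)))) (_ : Smooth Y.hom)
        (G : Over Y.left) [GrpObj G] (_ : Smooth G.hom) (y : ResidueDisk.ResPoint p Y),
      ∃ A : ℤ_[p] → ResidueDisk.Disk (y ≫ ResidueDisk.idSection G) →
          ResidueDisk.Disk (y ≫ ResidueDisk.idSection G),
        -- on each fibre, `A` is an action of `ℤ_p` that extends the multiplication by integers
        (∀ σ : ResidueDisk.Disk y,
          ∃ act : ℤ_[p] → ResidueDisk.fibre G σ → ResidueDisk.fibre G σ,
            ResidueDisk.IsPadicPowerAction act ∧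
            ∀ a g, A a (ResidueDisk.fibre.incl G g) = ResidueDisk.fibre.incl G (act a g)) ∧
        -- modulo `p ^ j`, it only depends on the acting scalar modulo `p ^ j`
        (∀ (j : ℕ) (a a' : ℤ_[p]) (g : ResidueDisk.Disk (y ≫ ResidueDisk.idSection G)),
          a - a' ∈ Ideal.span {(p : ℤ_[p]) ^ j} →
          (A a g).modPow j = (A a' g).modPow j) ∧
        -- for all choices of parameters and bases, it is given by convergent power series
        ∀ (ϖ : ∀ v : MaximalSpectrum (ResidueDisk.OKp p K), ResidueDisk.OKv v)
          (_ : ∀ v, Ideal.span {ϖ v} = IsLocalRing.maximalIdeal (ResidueDisk.OKv v))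
          (n m : MaximalSpectrum (ResidueDisk.OKp p K) → ℕ)
          (s : ResidueDisk.LocalParameters y ϖ n)
          (t : ResidueDisk.RelativeLocalParameters G y m)
          (k : MaximalSpectrum (ResidueDisk.OKp p K) → ℕ)
          (b : ∀ v, Module.Basis (Fin (k v)) ℤ_[p] (ResidueDisk.OKv v)),
          ∃ e : ResidueDisk.Disk (y ≫ ResidueDisk.idSection G) ≃
              ((Σ v : MaximalSpectrum (ResidueDisk.OKp p K),
                (Fin (n v) ⊕ Fin (m v)) × Fin (k v)) → ℤ_[p]),
            ResidueDisk.IsChart ϖ b (ResidueDisk.relativeCoordinates G s t) e ∧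
            ResidueDisk.GivenByConvergentPowerSeries
              (fun z : Option (Σ v : MaximalSpectrum (ResidueDisk.OKp p K),
                  (Fin (n v) ⊕ Fin (m v)) × Fin (k v)) → ℤ_[p] =>
                e (A (z none) (e.symm fun i => z (some i))))) := by
  refine ⟨fun X Y m n hX hY f x ϖ hϖ t s k b => ?_, fun hram Y hY G _ hG y => ?_⟩
  · have hX' : Smooth X.hom := SmoothOfRelativeDimension.smooth m X.hom
    have hY' : Smooth Y.hom := SmoothOfRelativeDimension.smooth n Y.hom
    obtain ⟨eX, heX⟩ := ResidueDisk.exists_chart (b := b) hX' hϖ (t.isCoordinateSystem hϖ)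
    obtain ⟨eY, heY⟩ := ResidueDisk.exists_chart (b := b) hY' hϖ (s.isCoordinateSystem hϖ)
    exact ⟨ResidueDisk.card_sigma_fin p K m b, ResidueDisk.card_sigma_fin p K n b, eX, eY, heX,
      heY, ResidueDisk.givenByConvergentPowerSeries_map hX' hϖ (t.isCoordinateSystem hϖ)
        (s.isCoordinateSystem hϖ) heX heY⟩
  · have he : ∀ v : MaximalSpectrum (ResidueDisk.OKp p K),
        (v.asIdeal.comap (ResidueDisk.toOKp p K)).ramificationIdx ℤ < p - 1 := fun v =>
      hram _ inferInstance (by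
        rw [Ideal.mem_comap, map_natCast]
        exact ResidueDisk.p_mem v)
    obtain ⟨A, hA, hA'⟩ := ResidueDisk.exists_disk_action he G y
    refine ⟨A, hA, hA', fun ϖ hϖ n m s t k b => ?_⟩
    obtain ⟨e, he'⟩ := ResidueDisk.exists_relative_chart (b := b) hY hG hϖ s t
    exact ⟨e, he', ResidueDisk.givenByConvergentPowerSeries_action hY hG he hA hA' hϖ s t he'⟩
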